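/- **Source calculus $\pi$.** Processes are $P,Q ::= 0 \mid m(x).P \mid \overline{m}n.P \mid (c)P \mid P|Q \mid\ !m(x).P$, up to $\alpha$-conversion and without free name variables, with the usual early labelled transition system whose actions are $\tau$, $a(b)$, $\overline{a}b$ and $\overline{a}(b)$. Ground bisimilarity $\approx_g$ is the largest symmetric relation $\mathcal R$ such that $P\,\mathcal R\,Q$ and $P\xrightarrow{\alpha}P'$ (with the bound name of $\alpha$ fresh) imply $Q\stackrel{\hat\alpha}{\Longrightarrow}Q'$ and $P'\,\mathcal R\,Q'$ for some $Q'$. **Target calculus $\Pi^{D,d}$.** Terms are $T ::= 0 \mid X \mid u(X).T \mid \overline{u}T'.T \mid T|T' \mid (c)T \mid\ !u(X).T \mid\ !\overline{u}T'.T \mid \langle U_1,\dots,U_n\rangle T \mid T'\langle K_1,\dots,K_n\rangle$ ($n\ge 1$), where the $U_i$ are either all process variables (and the $K_i$ terms) or all name variables (and the $K_i$ names). Structural congruence $\equiv$ is the least congruence containing the commutative monoid laws of $|$, commutation of restrictions, $(c)(T|T')\equiv (c)T|T'$ for $c\notin fn(T')$, and $(\langle \widetilde U\rangle T)\langle\widetilde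 K\rangle\equiv T\{\widetilde K/\widetilde U\}$ when the lengths and kinds agree. The transitions of closed terms have the actions $\tau$, $a(A)$ and $(\widetilde c)\overline{a}A$, are those of the process-passing calculus, and are closed under $\equiv$. A *context bisimulation* is a symmetric relation $\mathcal R$ on closed terms such that, whenever $P\,\mathcal R\,Q$: 1. if $P\xrightarrow{\alpha}P'$ with $\alpha=\tau$ or $\alpha=a(A)$, then $Q\stackrel{\hat\alpha}{\Longrightarrow}Q'$ and $P'\,\mathcal R\,Q'$ for some $Q'$; 2. if $P\xrightarrow{(\widetilde c)\overline aA}P'$, then $Q\stackrel{(\widetilde d)\overline aB}{\Longrightarrow}Q'$ for some $\widetilde d,B,Q'$ such that $B$ is of the same kind as $A$ (process abstraction, name abstraction, or no abstraction, up to $\equiv$), and for every $E[X]$ with $\{\widetilde c,\widetilde d\}\cap fn(E)=\emptyset$ one has $(\widetilde c)(E[A]\,|\,P')\;\mathcal R\;(\widetilde d)(E[B]\,|\,Q')$. Context bisimilarity $\approx_{ct}$ is the largest context bisimulation. **Encoding.** $\llbracket m(x).P\rrbracket = m(Y).Y\langle\langle x\rangle\llbracket P\rrbracket\rangle$, $\llbracket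 \overline m n.Q\rrbracket=\overline m[\langle Z\rangle(Z\langle n\rangle)].\llbracket Q\rrbracket$, $\llbracket !m(x).P\rrbracket=\ !\llbracket m(x).P\rrbracket$, and $\llbracket\cdot\rrbracket$ is homomorphic on $0$, $|$ and restriction. The *image* is the set of closed $T$ with $T\equiv\llbracket P\rrbracket$ for some $\pi$ process $P$. Context bisimilarity within the image of the encoding, $\dot\approx_{ct}$, is defined like $\approx_{ct}$, but with relations $\mathcal R$ on the image, with input actions $a(A)$ only for messages $A$ representing a name, i.e. $A\equiv\langle Z\rangle(Z\langle b\rangle)$ for some name $b$, and with clause 2 only for those $E[X]$ for which $E[A]$ and $E[B]$ are in the image. **Statement.** (Weak soundness.) For all $\pi$ processes $P,Q$: if $P\approx_g Q$, then $\llbracket P\rrbracket\mathrel{\dot\approx_{ct}}\llbracket Q\rrbracket$. Full soundness fails: there are $\pi$ processes $P,Q$ with $P\approx_g Q$ and not $\llbracket P\rrbracket\approx_{ct}\llbracket Q\rrbracket$. -/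

import Mathlib

/-!  Names are de Bruijn indices `0, 1, 2, …` (so processes are identified up to
alpha-conversion).  A name index that is not bound is a global name constant; the index of the
innermost name binder is `0`.  Name binders are restriction (a local name constant), the input
prefix of the first-order calculus and name abstraction (name variables).  Hence no term has free
name variables. -/

/-! ### Index maps for names -/

/-- The action of a renaming under `k` name binders. -/
def upName (k : ℕ) (ρ : ℕ → ℕ) (i : ℕ) : ℕ := if i < k then i else ρ (i - k) + k

/-- Instantiation of the `n` innermost name indices by the names `v`; the others are lowered. -/
def instName {n : ℕ} (v : Fin n → ℕ) (i : ℕ) : ℕ := if h : i < n then v ⟨i, h⟩ else i - n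

/-- Makes room for a new name at index `k`. -/
def skipName (k i : ℕ) : ℕ := if i < k then i else i + 1

/-- Moves the name at index `k` to index `0` and the names `0, …, k - 1` up by one;
`rotName 1` exchanges `0` and `1`. -/
def rotName (k i : ℕ) : ℕ := if i < k then i + 1 else if i = k then 0 else i

/-! ### The first-order pi-calculus -/

/-- Processes of the pi-calculus. -/
inductive PiProc : Type
  /-- `0` -/
  | nil : PiProc
  /-- `m(x).P`; binds the name index `0` in `P` -/
  | inp (m : ℕ) (P : PiProc) : PiProc
  /-- `m̄n.P` -/
  | out (m n : ℕ) (P : PiProc) : PiProc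
  /-- `(c)P`; binds the name index `0` in `P` -/
  | nu (P : PiProc) : PiProc
  /-- `P | Q` -/
  | par (P Q : PiProc) : PiProc
  /-- `!m(x).P`; binds the name index `0` in `P` -/
  | rep (m : ℕ) (P : PiProc) : PiProc

namespace PiProc

/-- Simultaneous (capture-avoiding) replacement of names. -/
def ren : (ℕ → ℕ) → PiProc → PiProc
  | _, nil => nil
  | ρ, inp m P => inp (ρ m) (ren (upName 1 ρ) P)
  | ρ, out m n P => out (ρ m) (ρ n) (ren ρ P)
  | ρ, nu P => nu (ren (upName 1 ρ) P)
  | ρ, par P Q => par (ren ρ P) (ren ρ Q)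
  | ρ, rep m P => rep (ρ m) (ren (upName 1 ρ) P)

/-- `P{b/x}` where `x` is the innermost name index of `P`. -/
def inst (P : PiProc) (b : ℕ) : PiProc := ren (instName fun _ : Fin 1 => b) P

/-- `P` in the scope of `k` additional names, which are the indices `0, …, k - 1`. -/
def shift (k : ℕ) (P : PiProc) : PiProc := ren (· + k) P

end PiProc

/-- Actions of the pi-calculus. -/
inductive PiAct : Type
  /-- internal move -/
  | tau : PiAct
  /-- input `a(b)` -/
  | inp (a b : ℕ) : PiAct
  /-- free output `āb` -/
  | out (a b : ℕ) : PiAct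
  /-- bound output `ā(b)`; in the process reached, the fresh name `b` is the index `0` and all
  other names are raised by one -/
  | bout (a : ℕ) : PiAct

namespace PiAct

/-- The number of bound names of an action. -/
def bn : PiAct → ℕ
  | bout _ => 1
  | _ => 0

/-- The action, as an action inside a restriction whose local name does not occur in it. -/
def under : PiAct → PiAct
  | tau => tau
  | inp a b => inp (a + 1) (b + 1)
  | out a b => out (a + 1) (b + 1)
  | bout a => bout (a + 1)

end PiAct

namespace PiProc

/-- The labelled transition system of the pi-calculus. -/
inductive Step : PiProc → PiAct → PiProc → Prop
  | inp (a b : ℕ) (P : PiProc) : Step (inp a P) (.inp a b) (P.inst b)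
  | out (a b : ℕ) (P : PiProc) : Step (out a b P) (.out a b) P
  | rep (a b : ℕ) (P : PiProc) : Step (rep a P) (.inp a b) (par (P.inst b) (rep a P))
  /-- `(c)P` makes the transitions of `P` in which `c` does not occur -/
  | res {P P' : PiProc} {α : PiAct} :
      Step P α.under P' → Step (nu P) α (nu (P'.ren (rotName α.bn)))
  /-- `(c)P` makes the transition `ā(c)` if `P` makes the transition `āc` with `c ≠ a` -/
  | opn {P P' : PiProc} {a : ℕ} : Step P (.out (a + 1) 0) P' → Step (nu P) (.bout a) P'
  | parL {P P' : PiProc} {α : PiAct} (Q : PiProc) :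
      Step P α P' → Step (par P Q) α (par P' (Q.shift α.bn))
  | parR {Q Q' : PiProc} {α : PiAct} (P : PiProc) :
      Step Q α Q' → Step (par P Q) α (par (P.shift α.bn) Q')
  | comL {P P' Q Q' : PiProc} {a b : ℕ} :
      Step P (.inp a b) P' → Step Q (.out a b) Q' → Step (par P Q) .tau (par P' Q')
  | comR {P P' Q Q' : PiProc} {a b : ℕ} :
      Step P (.out a b) P' → Step Q (.inp a b) Q' → Step (par P Q) .tau (par P' Q')
  /-- communication of a local name, which is fresh for the receiver -/
  | closeL {P P' Q Q' : PiProc} {a : ℕ} :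
      Step (P.shift 1) (.inp (a + 1) 0) P' → Step Q (.bout a) Q' →
        Step (par P Q) .tau (nu (par P' Q'))
  | closeR {P P' Q Q' : PiProc} {a : ℕ} :
      Step P (.bout a) P' → Step (Q.shift 1) (.inp (a + 1) 0) Q' →
        Step (par P Q) .tau (nu (par P' Q'))

/-- Finitely many (possibly no) internal moves. -/
def Taus : PiProc → PiProc → Prop := Relation.ReflTransGen fun P P' => Step P .tau P'

/-- `P ⟹ ⟶α ⟹ P'` -/
def Weak (P : PiProc) (α : PiAct) (P' : PiProc) : Prop :=
  ∃ P₁ P₂, Taus P P₁ ∧ Step P₁ α P₂ ∧ Taus P₂ P'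

/-- `Weak` for a visible action, `Taus` for the internal move. -/
def WeakHat (P : PiProc) (α : PiAct) (P' : PiProc) : Prop :=
  (α = .tau ∧ Taus P P') ∨ (α ≠ .tau ∧ Weak P α P')

/-- Ground bisimulations. -/
def IsGroundBisim (R : PiProc → PiProc → Prop) : Prop :=
  (∀ P Q, R P Q → R Q P) ∧
  ∀ P Q, R P Q → ∀ α P', Step P α P' → ∃ Q', WeakHat Q α Q' ∧ R P' Q'

/-- Ground bisimilarity. -/
def GroundBisim (P Q : PiProc) : Prop := ∃ R, IsGroundBisim R ∧ R P Q

end PiProc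

/-! ### The higher-order calculus with parameterization on processes and on names -/

/-- Terms of the higher-order calculus with `d` free process variables.  A binder of `k` process
variables binds the last `k` of the `d + k` variables of its body.  Abstractions and applications
have a positive number `n + 1` of parameters. -/
inductive HO : ℕ → Type
  /-- `0` -/
  | nil {d : ℕ} : HO d
  /-- `X` -/
  | var {d : ℕ} (X : Fin d) : HO d
  /-- `u(X).T` -/
  | inp {d : ℕ} (u : ℕ) (T : HO (d + 1)) : HO d
  /-- `ūA.T` -/
  | out {d : ℕ} (u : ℕ) (A T : HO d) : HO d
  /-- `T | T'` -/
  | par {d : ℕ} (T T' : HO d) : HO d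
  /-- `(c)T`; binds the name index `0` in `T` -/
  | nu {d : ℕ} (T : HO d) : HO d
  /-- `!u(X).T` -/
  | repInp {d : ℕ} (u : ℕ) (T : HO (d + 1)) : HO d
  /-- `!ūA.T` -/
  | repOut {d : ℕ} (u : ℕ) (A T : HO d) : HO d
  /-- process abstraction `⟨X₀, …, Xₙ⟩T` -/
  | pabs {d : ℕ} (n : ℕ) (T : HO (d + (n + 1))) : HO d
  /-- name abstraction `⟨x₀, …, xₙ⟩T`; binds the name indices `0, …, n` in `T` -/
  | nabs {d : ℕ} (n : ℕ) (T : HO d) : HO d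
  /-- application to processes `T⟨K₀, …, Kₙ⟩` -/
  | papp {d : ℕ} (n : ℕ) (T : HO d) (K : Fin (n + 1) → HO d) : HO d
  /-- application to names `T⟨v₀, …, vₙ⟩` -/
  | napp {d : ℕ} (n : ℕ) (T : HO d) (v : Fin (n + 1) → ℕ) : HO d

namespace HO

/-- Simultaneous (capture-avoiding) replacement of names. -/
def renN : {d : ℕ} → (ℕ → ℕ) → HO d → HO d
  | _, _, nil => nil
  | _, _, var X => var X
  | _, ρ, inp u T => inp (ρ u) (renN ρ T)
  | _, ρ, out u A T => out (ρ u) (renN ρ A) (renN ρ T)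
  | _, ρ, par T T' => par (renN ρ T) (renN ρ T')
  | _, ρ, nu T => nu (renN (upName 1 ρ) T)
  | _, ρ, repInp u T => repInp (ρ u) (renN ρ T)
  | _, ρ, repOut u A T => repOut (ρ u) (renN ρ A) (renN ρ T)
  | _, ρ, pabs n T => pabs n (renN ρ T)
  | _, ρ, nabs n T => nabs n (renN (upName (n + 1) ρ) T)
  | _, ρ, papp n T K => papp n (renN ρ T) (fun i => renN ρ (K i))
  | _, ρ, napp n T v => napp n (renN ρ T) (fun i => ρ (v i))

/-- A renaming of process variables under `k` binders. -/
def upVar {d e : ℕ} (k : ℕ) (ρ : Fin d → Fin e) : Fin (d + k) → Fin (e + k) :=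
  Fin.addCases (fun i => Fin.castAdd k (ρ i)) (fun j => Fin.natAdd e j)

/-- Renaming of process variables. -/
def renP : {d e : ℕ} → (Fin d → Fin e) → HO d → HO e
  | _, _, _, nil => nil
  | _, _, ρ, var X => var (ρ X)
  | _, _, ρ, inp u T => inp u (renP (upVar 1 ρ) T)
  | _, _, ρ, out u A T => out u (renP ρ A) (renP ρ T)
  | _, _, ρ, par T T' => par (renP ρ T) (renP ρ T')
  | _, _, ρ, nu T => nu (renP ρ T)
  | _, _, ρ, repInp u T => repInp u (renP (upVar 1 ρ) T)
  | _, _, ρ, repOut u A T => repOut u (renP ρ A) (renP ρ T)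
  | _, _, ρ, pabs n T => pabs n (renP (upVar (n + 1) ρ) T)
  | _, _, ρ, nabs n T => nabs n (renP ρ T)
  | _, _, ρ, papp n T K => papp n (renP ρ T) (fun i => renP ρ (K i))
  | _, _, ρ, napp n T v => napp n (renP ρ T) v

/-- `T` in the scope of `k` additional names, which are the indices `0, …, k - 1`. -/
def shift {d : ℕ} (k : ℕ) (T : HO d) : HO d := renN (· + k) T

/-- A substitution under `k` binders of process variables. -/
def upSub {d e : ℕ} (k : ℕ) (σ : Fin d → HO e) : Fin (d + k) → HO (e + k) :=
  Fin.addCases (fun i => renP (Fin.castAdd k) (σ i)) (fun j => var (Fin.natAdd e j))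

/-- Simultaneous (capture-avoiding) substitution for process variables. -/
def subst : {d e : ℕ} → (Fin d → HO e) → HO d → HO e
  | _, _, _, nil => nil
  | _, _, σ, var X => σ X
  | _, _, σ, inp u T => inp u (subst (upSub 1 σ) T)
  | _, _, σ, out u A T => out u (subst σ A) (subst σ T)
  | _, _, σ, par T T' => par (subst σ T) (subst σ T')
  | _, _, σ, nu T => nu (subst (fun X => shift 1 (σ X)) T)
  | _, _, σ, repInp u T => repInp u (subst (upSub 1 σ) T)
  | _, _, σ, repOut u A T => repOut u (subst σ A) (subst σ T)
  | _, _, σ, pabs n T => pabs n (subst (upSub (n + 1) σ) T)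
  | _, _, σ, nabs n T => nabs n (subst (fun X => shift (n + 1) (σ X)) T)
  | _, _, σ, papp n T K => papp n (subst σ T) (fun i => subst σ (K i))
  | _, _, σ, napp n T v => napp n (subst σ T) v

/-- `T{K/X}` where `X` is the tuple of the last `k` process variables of `T`. -/
def instP {d k : ℕ} (T : HO (d + k)) (K : Fin k → HO d) : HO d :=
  subst (Fin.addCases var K) T

/-- `T{A/X}` where `X` is the last process variable of `T`. -/
def inst {d : ℕ} (T : HO (d + 1)) (A : HO d) : HO d := instP T fun _ => A

/-- `T{v/x}` where `x` is the tuple of the `n` innermost name indices of `T`. -/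
def instN {d n : ℕ} (T : HO d) (v : Fin n → ℕ) : HO d := renN (instName v) T

/-- The set of free names. -/
def fn : {d : ℕ} → HO d → Set ℕ
  | _, nil => ∅
  | _, var _ => ∅
  | _, inp u T => {u} ∪ fn T
  | _, out u A T => {u} ∪ fn A ∪ fn T
  | _, par T T' => fn T ∪ fn T'
  | _, nu T => {i | i + 1 ∈ fn T}
  | _, repInp u T => {u} ∪ fn T
  | _, repOut u A T => {u} ∪ fn A ∪ fn T
  | _, pabs _ T => fn T
  | _, nabs n T => {i | i + (n + 1) ∈ fn T}
  | _, papp _ T K => fn T ∪ ⋃ i, fn (K i)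
  | _, napp _ T v => fn T ∪ Set.range v

/-- Restriction of the `k` innermost names. -/
def nus {d : ℕ} : ℕ → HO d → HO d
  | 0, T => T
  | k + 1, T => nu (nus k T)

/-- Structural congruence: the least congruence with the monoid laws for parallel composition,
the commutation and scope laws for restriction, and the application laws. -/
inductive Struct : {d : ℕ} → HO d → HO d → Prop
  | refl {d : ℕ} (T : HO d) : Struct T T
  | symm {d : ℕ} {T T' : HO d} : Struct T T' → Struct T' T
  | trans {d : ℕ} {T T' T'' : HO d} : Struct T T' → Struct T' T'' → Struct T T''
  | parNil {d : ℕ} (T : HO d) : Struct (par T nil) T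
  | parComm {d : ℕ} (T T' : HO d) : Struct (par T T') (par T' T)
  | parAssoc {d : ℕ} (T T' T'' : HO d) : Struct (par (par T T') T'') (par T (par T' T''))
  | nuComm {d : ℕ} (T : HO d) : Struct (nu (nu T)) (nu (nu (renN (rotName 1) T)))
  /-- `(c)(T | T') ≡ (c)T | T'` for `c` not free in `T'` -/
  | nuPar {d : ℕ} (T T' : HO d) : Struct (nu (par T (shift 1 T'))) (par (nu T) T')
  | pbeta {d : ℕ} (n : ℕ) (T : HO (d + (n + 1))) (K : Fin (n + 1) → HO d) :
      Struct (papp n (pabs n T) K) (instP T K)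
  | nbeta {d : ℕ} (n : ℕ) (T : HO d) (v : Fin (n + 1) → ℕ) :
      Struct (napp n (nabs n T) v) (instN T v)
  | inp {d : ℕ} (u : ℕ) {T T' : HO (d + 1)} : Struct T T' → Struct (inp u T) (inp u T')
  | out {d : ℕ} (u : ℕ) {A A' T T' : HO d} :
      Struct A A' → Struct T T' → Struct (out u A T) (out u A' T')
  | par {d : ℕ} {T T' S S' : HO d} :
      Struct T T' → Struct S S' → Struct (par T S) (par T' S')
  | nu {d : ℕ} {T T' : HO d} : Struct T T' → Struct (nu T) (nu T')
  | repInp {d : ℕ} (u : ℕ) {T T' : HO (d + 1)} :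
      Struct T T' → Struct (repInp u T) (repInp u T')
  | repOut {d : ℕ} (u : ℕ) {A A' T T' : HO d} :
      Struct A A' → Struct T T' → Struct (repOut u A T) (repOut u A' T')
  | pabs {d : ℕ} (n : ℕ) {T T' : HO (d + (n + 1))} :
      Struct T T' → Struct (pabs n T) (pabs n T')
  | nabs {d : ℕ} (n : ℕ) {T T' : HO d} : Struct T T' → Struct (nabs n T) (nabs n T')
  | papp {d : ℕ} (n : ℕ) {T T' : HO d} {K K' : Fin (n + 1) → HO d} :
      Struct T T' → (∀ i, Struct (K i) (K' i)) → Struct (papp n T K) (papp n T' K')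
  | napp {d : ℕ} (n : ℕ) {T T' : HO d} (v : Fin (n + 1) → ℕ) :
      Struct T T' → Struct (napp n T v) (napp n T' v)

end HO

/-- Actions of the higher-order calculus. -/
inductive HOAct : Type
  /-- internal move -/
  | tau : HOAct
  /-- input `a(A)` -/
  | inp (a : ℕ) (A : HO 0) : HOAct
  /-- output `(c₁)…(cₖ)āA`; in `A` and in the process reached, the extruded names are the indices
  `0, …, k - 1` and all other names are raised by `k` -/
  | out (k a : ℕ) (A : HO 0) : HOAct

namespace HOAct

/-- The number of bound names of an action. -/
def bn : HOAct → ℕ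
  | out k _ _ => k
  | _ => 0

/-- The action, as an action inside a restriction whose local name does not occur in it. -/
def under : HOAct → HOAct
  | tau => tau
  | inp a A => inp (a + 1) (A.shift 1)
  | out k a A => out k (a + 1) (A.renN (skipName k))

end HOAct

namespace HO

/-- The labelled transition system on closed processes of the higher-order calculus. -/
inductive Step : HO 0 → HOAct → HO 0 → Prop
  | inp (a : ℕ) (A : HO 0) (T : HO 1) : Step (inp a T) (.inp a A) (inst T A)
  | out (a : ℕ) (A T : HO 0) : Step (out a A T) (.out 0 a A) T
  | repInp (a : ℕ) (A : HO 0) (T : HO 1) :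
      Step (repInp a T) (.inp a A) (par (inst T A) (repInp a T))
  | repOut (a : ℕ) (A T : HO 0) :
      Step (repOut a A T) (.out 0 a A) (par T (repOut a A T))
  /-- `(c)T` makes the transitions of `T` in which `c` does not occur -/
  | res {T T' : HO 0} {α : HOAct} :
      Step T α.under T' → Step (nu T) α (nu (T'.renN (rotName α.bn)))
  /-- `(d)T` extrudes `d` if `d` is free in the message, not extruded yet, and not the subject -/
  | opn {T T' A : HO 0} {k a : ℕ} :
      Step T (.out k (a + 1) A) T' → k ∈ fn A → Step (nu T) (.out (k + 1) a A) T'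
  | par {T T' : HO 0} {α : HOAct} (S : HO 0) :
      Step T α T' → Step (par T S) α (par T' (S.shift α.bn))
  /-- communication; the extruded names are fresh for the receiver -/
  | com {T T' S S' A : HO 0} {k a : ℕ} :
      Step (T.shift k) (.inp (a + k) A) T' → Step S (.out k a A) S' →
        Step (par T S) .tau (nus k (par T' S'))
  | str {T T' S S' : HO 0} {α : HOAct} :
      Struct S T → Step T α T' → Struct T' S' → Step S α S'

/-- Finitely many (possibly no) internal moves. -/
def Taus : HO 0 → HO 0 → Prop := Relation.ReflTransGen fun T T' => Step T .tau T'

/-- `T ⟹ ⟶α ⟹ T'` -/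
def Weak (T : HO 0) (α : HOAct) (T' : HO 0) : Prop :=
  ∃ T₁ T₂, Taus T T₁ ∧ Step T₁ α T₂ ∧ Taus T₂ T'

/-- `A` is a process abstraction. -/
def IsProcAbs (A : HO 0) : Prop := ∃ n T, Struct A (pabs n T)

/-- `A` is a name abstraction. -/
def IsNameAbs (A : HO 0) : Prop := ∃ n T, Struct A (nabs n T)

/-- Context bisimulations for a sub-model of the higher-order calculus: its processes are those
satisfying `Proc`, it receives the messages satisfying `Msg` from the environment, and the receiving
contexts `E[X]` of its outputs are those for which `E[A]` and `E[B]` are processes of the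
sub-model.  For `k` extruded names, `E` is put in their scope by `shift k`, so that none of them
occurs in it. -/
def IsContextBisim (Proc Msg : HO 0 → Prop) (R : HO 0 → HO 0 → Prop) : Prop :=
  (∀ P Q, R P Q → R Q P) ∧
  (∀ P Q, R P Q → Proc P ∧ Proc Q) ∧
  ∀ P Q, R P Q →
    (∀ P', Step P .tau P' → ∃ Q', Taus Q Q' ∧ R P' Q') ∧
    (∀ a A P', Msg A → Step P (.inp a A) P' → ∃ Q', Weak Q (.inp a A) Q' ∧ R P' Q') ∧
    (∀ k a A P', Step P (.out k a A) P' →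
      ∃ l B Q', Weak Q (.out l a B) Q' ∧
        (IsProcAbs A ↔ IsProcAbs B) ∧ (IsNameAbs A ↔ IsNameAbs B) ∧
        ∀ E : HO 1, Proc (inst (E.shift k) A) → Proc (inst (E.shift l) B) →
          R (nus k (par (inst (E.shift k) A) P')) (nus l (par (inst (E.shift l) B) Q')))

/-- Context bisimilarity on all closed processes. -/
def ContextBisim (P Q : HO 0) : Prop :=
  ∃ R, IsContextBisim (fun _ => True) (fun _ => True) R ∧ R P Q

/-- The message `⟨Z⟩(Z⟨n⟩)` that represents the name `n`. -/
def nameMsg {d : ℕ} (n : ℕ) : HO d :=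
  pabs 0 (napp 0 (var (Fin.natAdd d 0)) fun _ => n)

end HO

/-! ### The encoding -/

/-- The encoding of the pi-calculus, with values in the terms with `d` process variables (which do
not occur). -/
def encode : (d : ℕ) → PiProc → HO d
  | _, .nil => .nil
  | d, .inp m P => .inp m (.papp 0 (.var (Fin.last d)) fun _ => .nabs 0 (encode (d + 1) P))
  | d, .out m n P => .out m (HO.nameMsg n) (encode d P)
  | d, .nu P => .nu (encode d P)
  | d, .par P Q => .par (encode d P) (encode d Q)
  | d, .rep m P => .repInp m (.papp 0 (.var (Fin.last d)) fun _ => .nabs 0 (encode (d + 1) P))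

/-- The encoding `⟦P⟧`. -/
def enc (P : PiProc) : HO 0 := encode 0 P

/-- The image of the encoding, up to structural congruence. -/
def InImage (T : HO 0) : Prop := ∃ P : PiProc, HO.Struct T (enc P)

/-- Messages representing a name, up to structural congruence. -/
def RepresentsName (A : HO 0) : Prop := ∃ b : ℕ, HO.Struct A (HO.nameMsg b)

/-- Context bisimilarity within the image of the encoding. -/
def ImageContextBisim (P Q : HO 0) : Prop :=
  ∃ R, HO.IsContextBisim InImage RepresentsName R ∧ R P Q

/-!
Soundness is witnessed by the relation of all pairs `(T, S)` with `T ≡ ⟦P⟧`, `S ≡ ⟦Q⟧` and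
`P ≈g Q` (`isContextBisim_image`).  A transition of `T` is reflected by `P`, answered by `Q`, and
the answer is replayed by `S`; the receiving contexts of an output only add parallel components
and restrictions, which preserve ground bisimilarity.

The encoding preserves transitions by an induction (`PiProc.Step.encStep`).  That it reflects them
is less obvious, since a term `T ≡ ⟦P⟧` need not look like an encoding: structural congruence
contains the application laws in both directions, for untyped and possibly divergent terms, and
the transitions are closed under it.  Structural congruence is therefore split into the
congruence `HO.Cong` generated by the monoid and scope laws, and the parallel reduction `HO.PRed`
generated by the application laws.  `HO.Cong` is a bisimulation for `HO.PRed` (`HO.Cong.redSim`),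
and `HO.PRed` has the diamond property up to `HO.Cong` (`HO.PRed.diamond`), so structurally
congruent terms have a common reduct (`HO.Struct.joinable`).  Encodings are normal, because in them
only variables are applied; hence `T ≡ ⟦P⟧` reduces to a term that is congruent to `⟦P⟧` without
the application laws, and such a term has the shape of the encoding of a process structurally
congruent to `P` (`HO.Struct.represents`).

On the other side, every transition has a prenex form up to structural congruence: restrictions, in
front of the acting prefixes and an inert rest (`HO.Step.prenex`).  Reduction acts on the parts of
a prenex form separately, so the acting prefixes reduce to encoded prefixes, and `P` has the
corresponding transition (`HO.Struct.backward_inp`, `HO.Struct.backward_tau`,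
`HO.Struct.backward_out`).  A message congruent to `⟨Z⟩(Z⟨b⟩)` may contain further free names, so an
output of `T` may extrude names that the output of `P` does not; such names are restricted again
around the receiving context, where they do no harm.

In the pi-calculus this uses that structurally congruent processes have the same transitions
(`PiProc.SC.stepSim`), and that ground bisimilarity is preserved by parallel composition and
restriction (`PiProc.BisimCtx.groundBisim`).  It is not preserved by arbitrary replacements of
names, but it is by permutations, and on two given processes a shift is a permutation.

Full soundness fails for `a(x).a(y).0` and `a(x).0 | a(y).0`.  Without a restriction on messages
the environment may send `0` in place of a name; the encoding of the first process then becomes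
`0⟨⟨x⟩⟦a(y).0⟧⟩`, which is stuck, whereas that of the second process can still receive.  That a
term which is only structurally congruent to a stuck term has no transitions follows by
counting the active prefixes of its normal form (`HO.weight`).
-/

/-! ### Renaming and substitution -/

theorem upName_comp (k : ℕ) (ρ τ : ℕ → ℕ) :
    upName k (fun i => ρ (τ i)) = fun i => upName k ρ (upName k τ i) := by
  funext i; unfold upName; split_ifs <;> grind

theorem upName_id (k : ℕ) : upName k (fun i => i) = fun i => i := by
  funext i; simp only [upName]; split_ifs <;> omega

namespace HO

theorem renN_renN {d : ℕ} (T : HO d) (ρ τ : ℕ → ℕ) :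
    renN ρ (renN τ T) = renN (fun i => ρ (τ i)) T := by
  induction T generalizing ρ τ <;> simp_all [renN, upName_comp]

theorem renN_id {d : ℕ} (T : HO d) : renN (fun i => i) T = T := by
  induction T <;> simp_all [renN, upName_id]

theorem renN_eq_self {d : ℕ} (T : HO d) {ρ : ℕ → ℕ} (h : ∀ i, ρ i = i) : renN ρ T = T := by
  rw [show ρ = fun i => i from funext h, renN_id]

@[simp] theorem shift_zero {d : ℕ} (T : HO d) : shift 0 T = T := renN_id T

theorem shift_shift {d : ℕ} (T : HO d) (k l : ℕ) : shift k (shift l T) = shift (l + k) T := by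
  simp [shift, renN_renN, add_assoc]

/-- Renaming after a shift: the two maps only have to agree after composition. -/
theorem renN_shift_comm {d : ℕ} (T : HO d) {k l : ℕ} {ρ τ : ℕ → ℕ}
    (h : ∀ i, ρ (i + k) = τ i + l) : renN ρ (shift k T) = shift l (renN τ T) := by
  simp only [shift, renN_renN, h]

theorem renN_renP {d e : ℕ} (T : HO d) (ρ : ℕ → ℕ) (τ : Fin d → Fin e) :
    renN ρ (renP τ T) = renP τ (renN ρ T) := by
  induction T generalizing ρ e <;> simp_all [renN, renP]

theorem upSub_castAdd {d e : ℕ} (k : ℕ) (σ : Fin d → HO e) (i : Fin d) :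
    upSub k σ (Fin.castAdd k i) = renP (Fin.castAdd k) (σ i) := by simp [upSub]

theorem upSub_natAdd {d e : ℕ} (k : ℕ) (σ : Fin d → HO e) (j : Fin k) :
    upSub k σ (Fin.natAdd d j) = var (Fin.natAdd e j) := by simp [upSub]

theorem upSub_var {d e : ℕ} (k : ℕ) (ρ : Fin d → Fin e) :
    upSub k (fun X => var (ρ X)) = fun X => var (upVar k ρ X) := by
  funext X
  induction X using Fin.addCases <;> simp [upSub, upVar, renP]

theorem renN_upSub {d e : ℕ} (k : ℕ) (σ : Fin d → HO e) (ρ : ℕ → ℕ) :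
    (fun X => renN ρ (upSub k σ X)) = upSub k (fun X => renN ρ (σ X)) := by
  funext X
  induction X using Fin.addCases <;> simp [upSub, renN_renP, renN]

/-- Renaming of process variables is the substitution of variables. -/
theorem renP_eq_subst {d e : ℕ} (T : HO d) (ρ : Fin d → Fin e) :
    renP ρ T = subst (fun X => var (ρ X)) T := by
  induction T generalizing e <;> simp_all [renP, subst, upSub_var, shift, renN]

theorem subst_renP {d e f : ℕ} (T : HO d) (ρ : Fin d → Fin e) (σ : Fin e → HO f) :
    subst σ (renP ρ T) = subst (fun X => σ (ρ X)) T := by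
  have key : ∀ {d e f : ℕ} (k : ℕ) (ρ : Fin d → Fin e) (σ : Fin e → HO f),
      (fun X => upSub k σ (upVar k ρ X)) = upSub k (fun X => σ (ρ X)) := by
    intro d e f k ρ σ
    funext X
    induction X using Fin.addCases <;> simp [upSub, upVar]
  induction T generalizing e f <;> simp_all [renP, subst]

theorem renN_subst {d e : ℕ} (T : HO d) (σ : Fin d → HO e) (ρ : ℕ → ℕ) :
    renN ρ (subst σ T) = subst (fun X => renN ρ (σ X)) (renN ρ T) := by
  have key : ∀ {d e : ℕ} (k : ℕ) (ρ : ℕ → ℕ) (σ : Fin d → HO e),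
      (fun X => renN (upName k ρ) (shift k (σ X))) = fun X => shift k (renN ρ (σ X)) := by
    intro d e k ρ σ
    funext X
    exact renN_shift_comm _ fun i => by simp [upName]
  induction T generalizing e ρ <;> simp_all [renN, subst, renN_upSub]

theorem renP_renP {d e f : ℕ} (T : HO d) (ρ : Fin d → Fin e) (τ : Fin e → Fin f) :
    renP τ (renP ρ T) = renP (fun X => τ (ρ X)) T := by
  rw [renP_eq_subst _ τ, subst_renP, ← renP_eq_subst]

theorem renP_subst {d e f : ℕ} (T : HO d) (σ : Fin d → HO e) (ρ : Fin e → Fin f) :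
    renP ρ (subst σ T) = subst (fun X => renP ρ (σ X)) T := by
  have key : ∀ {d e f : ℕ} (k : ℕ) (ρ : Fin e → Fin f) (σ : Fin d → HO e),
      (fun X => renP (upVar k ρ) (upSub k σ X)) = upSub k (fun X => renP ρ (σ X)) := by
    intro d e f k ρ σ
    funext X
    induction X using Fin.addCases <;> simp [upSub, renP_renP, upVar, renP]
  induction T generalizing e f <;> simp_all [renP, subst, shift, renN_renP]

theorem subst_subst {d e f : ℕ} (T : HO d) (σ : Fin d → HO e) (τ : Fin e → HO f) :
    subst τ (subst σ T) = subst (fun X => subst τ (σ X)) T := by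
  have key : ∀ {d e f : ℕ} (k : ℕ) (τ : Fin e → HO f) (σ : Fin d → HO e),
      (fun X => subst (upSub k τ) (upSub k σ X)) = upSub k (fun X => subst τ (σ X)) := by
    intro d e f k τ σ
    funext X
    induction X using Fin.addCases <;> simp [upSub, subst_renP, renP_subst, subst]
  induction T generalizing e f <;> simp_all [subst, shift, renN_subst]

theorem subst_var {d : ℕ} (T : HO d) : subst var T = T := by
  have key : ∀ {d : ℕ} (k : ℕ), upSub k (var : Fin d → HO d) = var := by
    intro d k
    funext X
    induction X using Fin.addCases <;> simp [upSub, renP]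
  induction T <;> simp_all [subst, shift, renN]

theorem renN_instP {d k : ℕ} (T : HO (d + k)) (K : Fin k → HO d) (ρ : ℕ → ℕ) :
    renN ρ (instP T K) = instP (renN ρ T) fun i => renN ρ (K i) := by
  rw [instP, renN_subst, instP]
  congr 1
  funext X
  induction X using Fin.addCases <;> simp [renN]

theorem subst_instP {d e k : ℕ} (T : HO (d + k)) (K : Fin k → HO d) (σ : Fin d → HO e) :
    subst σ (instP T K) = instP (subst (upSub k σ) T) fun i => subst σ (K i) := by
  rw [instP, subst_subst, instP, subst_subst]
  congr 1
  funext X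
  induction X using Fin.addCases <;> simp [subst, upSub, subst_renP, subst_var]

theorem renN_inst {d : ℕ} (T : HO (d + 1)) (A : HO d) (ρ : ℕ → ℕ) :
    renN ρ (inst T A) = inst (renN ρ T) (renN ρ A) := renN_instP T _ ρ

theorem instName_comp {n : ℕ} (v : Fin n → ℕ) (ρ : ℕ → ℕ) :
    (fun i => ρ (instName v i)) = fun i => instName (fun j => ρ (v j)) (upName n ρ i) := by
  funext i
  simp only [instName, upName]
  split_ifs <;> first | rfl | omega

theorem renN_instN {d n : ℕ} (T : HO d) (v : Fin n → ℕ) (ρ : ℕ → ℕ) :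
    renN ρ (instN T v) = instN (renN (upName n ρ) T) fun i => ρ (v i) := by
  simp only [instN, renN_renN, instName_comp]

theorem instN_shift {d n : ℕ} (T : HO d) (v : Fin n → ℕ) : instN (shift n T) v = T := by
  rw [instN, shift, renN_renN, renN_eq_self]
  intro i; simp [instName]

theorem subst_instN {d e n : ℕ} (T : HO d) (v : Fin n → ℕ) (σ : Fin d → HO e) :
    subst σ (instN T v) = instN (subst (fun X => shift n (σ X)) T) v := by
  rw [instN, instN, renN_subst]
  congr 1
  funext X
  exact (instN_shift _ v).symm

theorem subst_shift {d e : ℕ} (T : HO d) (σ : Fin d → HO e) (k : ℕ) :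
    subst (fun X => shift k (σ X)) (shift k T) = shift k (subst σ T) :=
  (renN_subst T σ _).symm

theorem rotName_one_rotName_one (i : ℕ) : rotName 1 (rotName 1 i) = i := by
  simp only [rotName]; split_ifs <;> omega

theorem rotName_one_upName (ρ : ℕ → ℕ) (i : ℕ) :
    rotName 1 (upName 1 (upName 1 ρ) i) = upName 1 (upName 1 ρ) (rotName 1 i) := by
  rcases i with _ | _ | i <;> simp [rotName, upName]

theorem subst_rot {d e : ℕ} (T : HO d) (σ : Fin d → HO e) :
    subst (fun X => shift 1 (shift 1 (σ X))) (renN (rotName 1) T) =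
      renN (rotName 1) (subst (fun X => shift 1 (shift 1 (σ X))) T) := by
  rw [renN_subst]
  congr 1
  funext X
  simp [shift, renN_renN, rotName]

/-! ### Structural congruence is closed under renaming and substitution -/

theorem Struct.renN {d : ℕ} {T T' : HO d} (h : Struct T T') (ρ : ℕ → ℕ) :
    Struct (HO.renN ρ T) (HO.renN ρ T') := by
  induction h generalizing ρ with
  | refl T => exact .refl _
  | symm _ ih => exact (ih ρ).symm
  | trans _ _ ih ih' => exact (ih ρ).trans (ih' ρ)
  | parNil T => exact .parNil _
  | parComm T T' => exact .parComm _ _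
  | parAssoc T T' T'' => exact .parAssoc _ _ _
  | nuComm T =>
    have := Struct.nuComm (HO.renN (upName 1 (upName 1 ρ)) T)
    simpa [HO.renN, renN_renN, rotName_one_upName] using this
  | nuPar T T' =>
    simp only [HO.renN]
    rw [renN_shift_comm (l := 1) (τ := ρ) T' (by simp [upName])]
    exact .nuPar _ _
  | pbeta n T K => rw [renN_instP]; exact .pbeta _ _ _
  | nbeta n T v => rw [renN_instN]; exact .nbeta _ _ _
  | inp u _ ih => exact .inp _ (ih ρ)
  | out u _ _ ih ih' => exact .out _ (ih ρ) (ih' ρ)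
  | par _ _ ih ih' => exact .par (ih ρ) (ih' ρ)
  | nu _ ih => exact .nu (ih _)
  | repInp u _ ih => exact .repInp _ (ih ρ)
  | repOut u _ _ ih ih' => exact .repOut _ (ih ρ) (ih' ρ)
  | pabs n _ ih => exact .pabs _ (ih ρ)
  | nabs n _ ih => exact .nabs _ (ih _)
  | papp n _ _ ih ih' => exact .papp _ (ih ρ) fun i => ih' i ρ
  | napp n v _ ih => exact .napp _ _ (ih ρ)

theorem Struct.subst {d e : ℕ} {T T' : HO d} (h : Struct T T') (σ : Fin d → HO e) :
    Struct (HO.subst σ T) (HO.subst σ T') := by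
  induction h generalizing e with
  | refl T => exact .refl _
  | symm _ ih => exact (ih σ).symm
  | trans _ _ ih ih' => exact (ih σ).trans (ih' σ)
  | parNil T => exact .parNil _
  | parComm T T' => exact .parComm _ _
  | parAssoc T T' T'' => exact .parAssoc _ _ _
  | nuComm T =>
    simp only [HO.subst]
    rw [subst_rot]
    exact .nuComm _
  | nuPar T T' =>
    simp only [HO.subst]
    rw [subst_shift]
    exact .nuPar _ _
  | pbeta n T K => rw [subst_instP]; exact .pbeta _ _ _
  | nbeta n T v => rw [subst_instN]; exact .nbeta _ _ _
  | inp u _ ih => exact .inp _ (ih _)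
  | out u _ _ ih ih' => exact .out _ (ih _) (ih' _)
  | par _ _ ih ih' => exact .par (ih _) (ih' _)
  | nu _ ih => exact .nu (ih _)
  | repInp u _ ih => exact .repInp _ (ih _)
  | repOut u _ _ ih ih' => exact .repOut _ (ih _) (ih' _)
  | pabs n _ ih => exact .pabs _ (ih _)
  | nabs n _ ih => exact .nabs _ (ih _)
  | papp n _ _ ih ih' => exact .papp _ (ih _) fun i => ih' i _
  | napp n v _ ih => exact .napp _ _ (ih _)

theorem Struct.shift {d : ℕ} {T T' : HO d} (h : Struct T T') (k : ℕ) :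
    Struct (T.shift k) (T'.shift k) := h.renN _

theorem Struct.renP {d e : ℕ} {T T' : HO d} (h : Struct T T') (ρ : Fin d → Fin e) :
    Struct (HO.renP ρ T) (HO.renP ρ T') := by
  simpa only [renP_eq_subst] using h.subst _

theorem Struct.upSub {d e : ℕ} {σ σ' : Fin d → HO e} (h : ∀ X, Struct (σ X) (σ' X)) (k : ℕ)
    (X : Fin (d + k)) : Struct (HO.upSub k σ X) (HO.upSub k σ' X) := by
  induction X using Fin.addCases with
  | left i => simpa only [upSub_castAdd] using (h i).renP _
  | right j => simpa only [upSub_natAdd] using .refl _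

theorem Struct.subst_right {d e : ℕ} (T : HO d) {σ σ' : Fin d → HO e}
    (h : ∀ X, Struct (σ X) (σ' X)) : Struct (HO.subst σ T) (HO.subst σ' T) := by
  induction T generalizing e with
  | nil => exact .refl _
  | var X => exact h X
  | inp u T ih => exact .inp _ (ih (upSub h 1))
  | out u A T ih ih' => exact .out _ (ih h) (ih' h)
  | par T T' ih ih' => exact .par (ih h) (ih' h)
  | nu T ih => exact .nu (ih fun X => (h X).shift 1)
  | repInp u T ih => exact .repInp _ (ih (upSub h 1))
  | repOut u A T ih ih' => exact .repOut _ (ih h) (ih' h)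
  | pabs n T ih => exact .pabs _ (ih (upSub h _))
  | nabs n T ih => exact .nabs _ (ih fun X => (h X).shift _)
  | papp n T K ih ih' => exact .papp _ (ih h) fun i => ih' i h
  | napp n T v ih => exact .napp _ _ (ih h)

theorem Struct.inst {d : ℕ} {T T' : HO (d + 1)} {A A' : HO d} (h : Struct T T')
    (h' : Struct A A') : Struct (HO.inst T A) (HO.inst T' A') := by
  refine (h.subst _).trans (Struct.subst_right _ fun X => ?_)
  induction X using Fin.addCases with
  | left i => simpa using .refl _
  | right j => simpa using h'

/-! ### Free names -/

theorem mem_fn_renN {d : ℕ} (T : HO d) (ρ : ℕ → ℕ) (i : ℕ) :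
    i ∈ fn (renN ρ T) ↔ ∃ j ∈ fn T, ρ j = i := by
  have key : ∀ (k : ℕ) (ρ : ℕ → ℕ) (s : Set ℕ) (i : ℕ),
      (∃ j ∈ s, upName k ρ j = i + k) ↔ ∃ j, j + k ∈ s ∧ ρ j = i := by
    intro k ρ s i
    constructor
    · rintro ⟨j, hj, h⟩
      simp only [upName] at h
      split_ifs at h with hk
      · omega
      · exact ⟨j - k, by rwa [Nat.sub_add_cancel (by omega)], by omega⟩
    · rintro ⟨j, hj, rfl⟩
      exact ⟨_, hj, by simp [upName]⟩
  induction T generalizing ρ i with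
  | nil => simp [renN, fn]
  | var X => simp [renN, fn]
  | inp u T ih => simp [renN, fn, ih, or_and_right, exists_or, eq_comm]
  | out u A T ih ih' => simp [renN, fn, ih, ih', or_and_right, exists_or, eq_comm]
  | par T T' ih ih' => simp [renN, fn, ih, ih', or_and_right, exists_or]
  | nu T ih => simp [renN, fn, ih, key]
  | repInp u T ih => simp [renN, fn, ih, or_and_right, exists_or, eq_comm]
  | repOut u A T ih ih' => simp [renN, fn, ih, ih', or_and_right, exists_or, eq_comm]
  | pabs n T ih => simp [renN, fn, ih]
  | nabs n T ih => simp only [renN, fn, Set.mem_ofPred_eq, ih, key]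
  | papp n T K ih ih' =>
    simp only [renN, fn, Set.mem_union, Set.mem_iUnion, ih, ih', or_and_right, exists_or]
    grind
  | napp n T v ih => simp [renN, fn, ih, or_and_right, exists_or]

theorem fn_renP {d e : ℕ} (T : HO d) (ρ : Fin d → Fin e) : fn (renP ρ T) = fn T := by
  induction T generalizing e <;> simp_all [renP, fn]

theorem mem_fn_shift {d : ℕ} (T : HO d) (k i : ℕ) : i + k ∈ fn (shift k T) ↔ i ∈ fn T := by
  simp [shift, mem_fn_renN]

theorem mem_fn_subst {d e : ℕ} (T : HO d) (σ : Fin d → HO e) {i : ℕ} (h : i ∈ fn (subst σ T)) :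
    i ∈ fn T ∨ ∃ X, i ∈ fn (σ X) := by
  have key : ∀ {d e : ℕ} (k : ℕ) (σ : Fin d → HO e) (i : ℕ),
      (∃ X, i ∈ fn (upSub k σ X)) → ∃ X, i ∈ fn (σ X) := by
    rintro d e k σ i ⟨X, hX⟩
    induction X using Fin.addCases with
    | left j => exact ⟨j, by simpa [upSub_castAdd, fn_renP] using hX⟩
    | right j => simp [upSub_natAdd, fn] at hX
  induction T generalizing e i with
  | nil => simp [subst, fn] at h
  | var X => exact .inr ⟨X, h⟩
  | inp u T ih =>
    simp only [subst, fn, Set.mem_union] at h ⊢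
    exact h.elim (fun h => .inl (.inl h)) fun h => (ih _ h).imp .inr (key _ _ _)
  | out u A T ih ih' => simp only [subst, fn, Set.mem_union] at h ⊢; grind
  | par T T' ih ih' => simp only [subst, fn, Set.mem_union] at h ⊢; grind
  | nu T ih => simpa only [mem_fn_shift, fn, Set.mem_ofPred_eq] using ih _ h
  | repInp u T ih =>
    simp only [subst, fn, Set.mem_union] at h ⊢
    exact h.elim (fun h => .inl (.inl h)) fun h => (ih _ h).imp .inr (key _ _ _)
  | repOut u A T ih ih' => simp only [subst, fn, Set.mem_union] at h ⊢; grind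
  | pabs n T ih => exact (ih _ h).imp_right (key _ _ _)
  | nabs n T ih => simpa only [mem_fn_shift, fn, Set.mem_ofPred_eq] using ih _ h
  | papp n T K ih ih' => simp only [subst, fn, Set.mem_union, Set.mem_iUnion] at h ⊢; grind
  | napp n T v ih => simp only [subst, fn, Set.mem_union] at h ⊢; grind

theorem renN_congr {d : ℕ} (T : HO d) {ρ ρ' : ℕ → ℕ} (h : ∀ i ∈ fn T, ρ i = ρ' i) :
    renN ρ T = renN ρ' T := by
  have key : ∀ (k : ℕ) (ρ ρ' : ℕ → ℕ) (s : Set ℕ), (∀ i, i + k ∈ s → ρ i = ρ' i) →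
      ∀ i ∈ s, upName k ρ i = upName k ρ' i := by
    intro k ρ ρ' s h i hi
    simp only [upName]
    split_ifs with hk
    · rfl
    · rw [h]; rwa [Nat.sub_add_cancel (by omega)]
  induction T generalizing ρ ρ' with
  | nil => rfl
  | var X => rfl
  | inp u T ih => simp only [fn, Set.mem_union] at h; simp only [renN]; grind
  | out u A T ih ih' => simp only [fn, Set.mem_union] at h; simp only [renN]; grind
  | par T T' ih ih' => simp only [fn, Set.mem_union] at h; simp only [renN]; grind
  | nu T ih => exact congrArg nu (ih (key _ _ _ _ h))
  | repInp u T ih => simp only [fn, Set.mem_union] at h; simp only [renN]; grind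
  | repOut u A T ih ih' => simp only [fn, Set.mem_union] at h; simp only [renN]; grind
  | pabs n T ih => exact congrArg (pabs n) (ih h)
  | nabs n T ih => exact congrArg (nabs n) (ih (key _ _ _ _ h))
  | papp n T K ih ih' =>
    simp only [fn, Set.mem_union, Set.mem_iUnion] at h
    simp only [renN]
    rw [ih fun i hi => h i (.inl hi)]
    congr 1
    funext j
    exact ih' j fun i hi => h i (.inr ⟨j, hi⟩)
  | napp n T v ih =>
    simp only [fn, Set.mem_union, Set.mem_range] at h
    simp only [renN]
    rw [ih fun i hi => h i (.inl hi)]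
    congr 1
    funext j
    exact h _ (.inr ⟨j, rfl⟩)

/-- A term in which the name `0` is not free is a shift. -/
theorem shift_one_pred {d : ℕ} {T : HO d} (h : 0 ∉ fn T) : shift 1 (renN Nat.pred T) = T := by
  rw [shift, renN_renN]
  conv_rhs => rw [← renN_id T]
  refine renN_congr _ fun i hi => ?_
  rcases i with _ | i
  · exact absurd hi h
  · rfl

theorem pred_shift_one {d : ℕ} (T : HO d) : renN Nat.pred (shift 1 T) = T := by
  rw [shift, renN_renN, renN_eq_self]
  intro i; simp

theorem zero_notMem_fn_shift {d : ℕ} (T : HO d) : 0 ∉ fn (shift 1 T) := by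
  simp [shift, mem_fn_renN]

/-! ### Structural congruence without the application laws -/

/-- The least congruence with the laws of structural congruence for parallel composition and
restriction, but without the two application laws. -/
inductive Cong : {d : ℕ} → HO d → HO d → Prop
  | refl {d : ℕ} (T : HO d) : Cong T T
  | symm {d : ℕ} {T T' : HO d} : Cong T T' → Cong T' T
  | trans {d : ℕ} {T T' T'' : HO d} : Cong T T' → Cong T' T'' → Cong T T''
  | parNil {d : ℕ} (T : HO d) : Cong (par T nil) T
  | parComm {d : ℕ} (T T' : HO d) : Cong (par T T') (par T' T)
  | parAssoc {d : ℕ} (T T' T'' : HO d) : Cong (par (par T T') T'') (par T (par T' T''))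
  | nuComm {d : ℕ} (T : HO d) : Cong (nu (nu T)) (nu (nu (renN (rotName 1) T)))
  | nuPar {d : ℕ} (T T' : HO d) : Cong (nu (par T (shift 1 T'))) (par (nu T) T')
  | inp {d : ℕ} (u : ℕ) {T T' : HO (d + 1)} : Cong T T' → Cong (inp u T) (inp u T')
  | out {d : ℕ} (u : ℕ) {A A' T T' : HO d} :
      Cong A A' → Cong T T' → Cong (out u A T) (out u A' T')
  | par {d : ℕ} {T T' S S' : HO d} : Cong T T' → Cong S S' → Cong (par T S) (par T' S')
  | nu {d : ℕ} {T T' : HO d} : Cong T T' → Cong (nu T) (nu T')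
  | repInp {d : ℕ} (u : ℕ) {T T' : HO (d + 1)} : Cong T T' → Cong (repInp u T) (repInp u T')
  | repOut {d : ℕ} (u : ℕ) {A A' T T' : HO d} :
      Cong A A' → Cong T T' → Cong (repOut u A T) (repOut u A' T')
  | pabs {d : ℕ} (n : ℕ) {T T' : HO (d + (n + 1))} : Cong T T' → Cong (pabs n T) (pabs n T')
  | nabs {d : ℕ} (n : ℕ) {T T' : HO d} : Cong T T' → Cong (nabs n T) (nabs n T')
  | papp {d : ℕ} (n : ℕ) {T T' : HO d} {K K' : Fin (n + 1) → HO d} :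
      Cong T T' → (∀ i, Cong (K i) (K' i)) → Cong (papp n T K) (papp n T' K')
  | napp {d : ℕ} (n : ℕ) {T T' : HO d} (v : Fin (n + 1) → ℕ) :
      Cong T T' → Cong (napp n T v) (napp n T' v)

theorem Cong.struct {d : ℕ} {T T' : HO d} (h : Cong T T') : Struct T T' := by
  induction h with
  | refl T => exact .refl _
  | symm _ ih => exact ih.symm
  | trans _ _ ih ih' => exact ih.trans ih'
  | parNil T => exact .parNil _
  | parComm T T' => exact .parComm _ _
  | parAssoc T T' T'' => exact .parAssoc _ _ _
  | nuComm T => exact .nuComm _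
  | nuPar T T' => exact .nuPar _ _
  | inp u _ ih => exact .inp _ ih
  | out u _ _ ih ih' => exact .out _ ih ih'
  | par _ _ ih ih' => exact .par ih ih'
  | nu _ ih => exact .nu ih
  | repInp u _ ih => exact .repInp _ ih
  | repOut u _ _ ih ih' => exact .repOut _ ih ih'
  | pabs n _ ih => exact .pabs _ ih
  | nabs n _ ih => exact .nabs _ ih
  | papp n _ _ ih ih' => exact .papp _ ih ih'
  | napp n v _ ih => exact .napp _ _ ih

theorem Cong.renN {d : ℕ} {T T' : HO d} (h : Cong T T') (ρ : ℕ → ℕ) :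
    Cong (HO.renN ρ T) (HO.renN ρ T') := by
  induction h generalizing ρ with
  | refl T => exact .refl _
  | symm _ ih => exact (ih ρ).symm
  | trans _ _ ih ih' => exact (ih ρ).trans (ih' ρ)
  | parNil T => exact .parNil _
  | parComm T T' => exact .parComm _ _
  | parAssoc T T' T'' => exact .parAssoc _ _ _
  | nuComm T =>
    have := Cong.nuComm (HO.renN (upName 1 (upName 1 ρ)) T)
    simpa [HO.renN, renN_renN, rotName_one_upName] using this
  | nuPar T T' =>
    simp only [HO.renN]
    rw [renN_shift_comm (l := 1) (τ := ρ) T' (by simp [upName])]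
    exact .nuPar _ _
  | inp u _ ih => exact .inp _ (ih ρ)
  | out u _ _ ih ih' => exact .out _ (ih ρ) (ih' ρ)
  | par _ _ ih ih' => exact .par (ih ρ) (ih' ρ)
  | nu _ ih => exact .nu (ih _)
  | repInp u _ ih => exact .repInp _ (ih ρ)
  | repOut u _ _ ih ih' => exact .repOut _ (ih ρ) (ih' ρ)
  | pabs n _ ih => exact .pabs _ (ih ρ)
  | nabs n _ ih => exact .nabs _ (ih _)
  | papp n _ _ ih ih' => exact .papp _ (ih ρ) fun i => ih' i ρ
  | napp n v _ ih => exact .napp _ _ (ih ρ)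

theorem Cong.subst {d e : ℕ} {T T' : HO d} (h : Cong T T') (σ : Fin d → HO e) :
    Cong (HO.subst σ T) (HO.subst σ T') := by
  induction h generalizing e with
  | refl T => exact .refl _
  | symm _ ih => exact (ih σ).symm
  | trans _ _ ih ih' => exact (ih σ).trans (ih' σ)
  | parNil T => exact .parNil _
  | parComm T T' => exact .parComm _ _
  | parAssoc T T' T'' => exact .parAssoc _ _ _
  | nuComm T =>
    simp only [HO.subst]
    rw [subst_rot]
    exact .nuComm _
  | nuPar T T' =>
    simp only [HO.subst]
    rw [subst_shift]
    exact .nuPar _ _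
  | inp u _ ih => exact .inp _ (ih _)
  | out u _ _ ih ih' => exact .out _ (ih _) (ih' _)
  | par _ _ ih ih' => exact .par (ih _) (ih' _)
  | nu _ ih => exact .nu (ih _)
  | repInp u _ ih => exact .repInp _ (ih _)
  | repOut u _ _ ih ih' => exact .repOut _ (ih _) (ih' _)
  | pabs n _ ih => exact .pabs _ (ih _)
  | nabs n _ ih => exact .nabs _ (ih _)
  | papp n _ _ ih ih' => exact .papp _ (ih _) fun i => ih' i _
  | napp n v _ ih => exact .napp _ _ (ih _)

theorem Cong.upSub {d e : ℕ} {σ σ' : Fin d → HO e} (h : ∀ X, Cong (σ X) (σ' X)) (k : ℕ)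
    (X : Fin (d + k)) : Cong (HO.upSub k σ X) (HO.upSub k σ' X) := by
  induction X using Fin.addCases with
  | left i => simpa only [upSub_castAdd, renP_eq_subst] using (h i).subst _
  | right j => simpa only [upSub_natAdd] using .refl _

theorem Cong.subst_right {d e : ℕ} (T : HO d) {σ σ' : Fin d → HO e}
    (h : ∀ X, Cong (σ X) (σ' X)) : Cong (HO.subst σ T) (HO.subst σ' T) := by
  induction T generalizing e with
  | nil => exact .refl _
  | var X => exact h X
  | inp u T ih => exact .inp _ (ih (upSub h 1))
  | out u A T ih ih' => exact .out _ (ih h) (ih' h)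
  | par T T' ih ih' => exact .par (ih h) (ih' h)
  | nu T ih => exact .nu (ih fun X => (h X).renN _)
  | repInp u T ih => exact .repInp _ (ih (upSub h 1))
  | repOut u A T ih ih' => exact .repOut _ (ih h) (ih' h)
  | pabs n T ih => exact .pabs _ (ih (upSub h _))
  | nabs n T ih => exact .nabs _ (ih fun X => (h X).renN _)
  | papp n T K ih ih' => exact .papp _ (ih h) fun i => ih' i h
  | napp n T v ih => exact .napp _ _ (ih h)

theorem Cong.instP {d k : ℕ} {T T' : HO (d + k)} {K K' : Fin k → HO d} (h : Cong T T')
    (h' : ∀ i, Cong (K i) (K' i)) : Cong (HO.instP T K) (HO.instP T' K') := by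
  refine (h.subst _).trans (Cong.subst_right _ fun X => ?_)
  induction X using Fin.addCases with
  | left i => simpa using .refl _
  | right j => simpa using h' j

theorem Cong.fn_eq {d : ℕ} {T T' : HO d} (h : Cong T T') : fn T = fn T' := by
  induction h with
  | refl T => rfl
  | symm _ ih => exact ih.symm
  | trans _ _ ih ih' => exact ih.trans ih'
  | parNil T => simp [fn]
  | parComm T T' => simp [fn, Set.union_comm]
  | parAssoc T T' T'' => simp [fn, Set.union_assoc]
  | nuComm T =>
    ext i
    simp only [fn, Set.mem_ofPred_eq, mem_fn_renN]
    constructor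
    · exact fun h => ⟨_, h, by simp [rotName]⟩
    · rintro ⟨_ | _ | j, hj, h⟩ <;> simp [rotName] at h
      subst h; exact hj
  | nuPar T T' =>
    ext i
    simp only [fn, Set.mem_ofPred_eq, Set.mem_union, mem_fn_shift]
  | papp n _ _ ih ih' => simp only [fn, ih, ih']
  | _ => simp_all only [fn]

/-! ### Heads of terms -/

/-- The congruence classes of terms. -/
def congSetoid (d : ℕ) : Setoid (HO d) := ⟨Cong, Cong.refl, Cong.symm, Cong.trans⟩

/-- The abstractions with `d` free process variables, with bodies up to `Cong`. -/
abbrev AbsClass (d : ℕ) : Type :=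
  (Σ n : ℕ, Quotient (congSetoid (d + (n + 1)))) ⊕ (ℕ × Quotient (congSetoid d))

/-- The multiset of the abstractions that occur as parallel components of a term, or `⊤` if it has
components of another form than an abstraction.  This invariant of `Cong` shows that `Cong` is
injective on abstractions and does not relate them to variables or to `0`. -/
def absHeads : {d : ℕ} → HO d → WithTop (Multiset (AbsClass d))
  | _, nil => 0
  | _, par T T' => absHeads T + absHeads T'
  | d, pabs n T => (({.inl ⟨n, Quotient.mk (congSetoid _) T⟩} : Multiset (AbsClass d)) : WithTop _)
  | d, nabs n T => (({.inr ⟨n, Quotient.mk (congSetoid _) T⟩} : Multiset (AbsClass d)) : WithTop _)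
  | _, _ => ⊤

theorem Cong.absHeads_eq {d : ℕ} {T T' : HO d} (h : Cong T T') : absHeads T = absHeads T' := by
  induction h with
  | refl T => rfl
  | symm _ ih => exact ih.symm
  | trans _ _ ih ih' => exact ih.trans ih'
  | parNil T => simp [absHeads]
  | parComm T T' => simp [absHeads, add_comm]
  | parAssoc T T' T'' => simp [absHeads, add_assoc]
  | nuPar T T' => simp [absHeads]
  | par _ _ ih ih' => simp [absHeads, ih, ih']
  | @pabs _ n T T' h _ =>
    have : Quotient.mk (congSetoid _) T = Quotient.mk (congSetoid _) T' := Quotient.sound h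
    simp [absHeads, this]
  | @nabs _ n T T' h _ =>
    have : Quotient.mk (congSetoid _) T = Quotient.mk (congSetoid _) T' := Quotient.sound h
    simp [absHeads, this]
  | _ => rfl

theorem Cong.pabs_inj {d n : ℕ} {T T' : HO (d + (n + 1))}
    (h : Cong (HO.pabs n T) (HO.pabs n T')) : Cong T T' := by
  have := h.absHeads_eq
  simp only [absHeads, WithTop.coe_inj, Multiset.singleton_inj, Sum.inl.injEq, Sigma.mk.injEq,
    heq_eq_eq, true_and] at this
  exact Quotient.exact this

theorem Cong.nabs_inj {d n : ℕ} {T T' : HO d}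
    (h : Cong (HO.nabs n T) (HO.nabs n T')) : Cong T T' := by
  have := h.absHeads_eq
  simp only [absHeads, WithTop.coe_inj, Multiset.singleton_inj, Sum.inr.injEq, Prod.mk.injEq,
    true_and] at this
  exact Quotient.exact this

/-! ### Parallel reduction -/

/-- Parallel reduction with the application laws.  The head of a contracted application may itself
be reduced to an abstraction first, and the abstraction is only needed up to `Cong`, as in
`(⟨X⟩T | 0)⟨K⟩`. -/
inductive PRed : {d : ℕ} → HO d → HO d → Prop
  | nil {d : ℕ} : PRed (nil : HO d) nil
  | var {d : ℕ} (X : Fin d) : PRed (var X) (var X)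
  | inp {d : ℕ} (u : ℕ) {T T' : HO (d + 1)} : PRed T T' → PRed (inp u T) (inp u T')
  | out {d : ℕ} (u : ℕ) {A A' T T' : HO d} :
      PRed A A' → PRed T T' → PRed (out u A T) (out u A' T')
  | par {d : ℕ} {T T' S S' : HO d} : PRed T T' → PRed S S' → PRed (par T S) (par T' S')
  | nu {d : ℕ} {T T' : HO d} : PRed T T' → PRed (nu T) (nu T')
  | repInp {d : ℕ} (u : ℕ) {T T' : HO (d + 1)} : PRed T T' → PRed (repInp u T) (repInp u T')
  | repOut {d : ℕ} (u : ℕ) {A A' T T' : HO d} :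
      PRed A A' → PRed T T' → PRed (repOut u A T) (repOut u A' T')
  | pabs {d : ℕ} (n : ℕ) {T T' : HO (d + (n + 1))} : PRed T T' → PRed (pabs n T) (pabs n T')
  | nabs {d : ℕ} (n : ℕ) {T T' : HO d} : PRed T T' → PRed (nabs n T) (nabs n T')
  | papp {d : ℕ} (n : ℕ) {T T' : HO d} {K K' : Fin (n + 1) → HO d} :
      PRed T T' → (∀ i, PRed (K i) (K' i)) → PRed (papp n T K) (papp n T' K')
  | napp {d : ℕ} (n : ℕ) {T T' : HO d} (v : Fin (n + 1) → ℕ) :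
      PRed T T' → PRed (napp n T v) (napp n T' v)
  | pbeta {d : ℕ} (n : ℕ) {F F' : HO d} {T : HO (d + (n + 1))} {K K' : Fin (n + 1) → HO d} :
      PRed F F' → Cong F' (pabs n T) → (∀ i, PRed (K i) (K' i)) →
        PRed (papp n F K) (instP T K')
  | nbeta {d : ℕ} (n : ℕ) {F F' T : HO d} (v : Fin (n + 1) → ℕ) :
      PRed F F' → Cong F' (nabs n T) → PRed (napp n F v) (instN T v)

namespace PRed

theorem refl {d : ℕ} (T : HO d) : PRed T T := by
  induction T with
  | nil => exact .nil
  | var X => exact .var X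
  | inp u T ih => exact .inp _ ih
  | out u A T ih ih' => exact .out _ ih ih'
  | par T T' ih ih' => exact .par ih ih'
  | nu T ih => exact .nu ih
  | repInp u T ih => exact .repInp _ ih
  | repOut u A T ih ih' => exact .repOut _ ih ih'
  | pabs n T ih => exact .pabs _ ih
  | nabs n T ih => exact .nabs _ ih
  | papp n T K ih ih' => exact .papp _ ih ih'
  | napp n T v ih => exact .napp _ _ ih

theorem struct {d : ℕ} {T T' : HO d} (h : PRed T T') : Struct T T' := by
  induction h with
  | nil => exact .refl _
  | var X => exact .refl _
  | inp u _ ih => exact .inp _ ih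
  | out u _ _ ih ih' => exact .out _ ih ih'
  | par _ _ ih ih' => exact .par ih ih'
  | nu _ ih => exact .nu ih
  | repInp u _ ih => exact .repInp _ ih
  | repOut u _ _ ih ih' => exact .repOut _ ih ih'
  | pabs n _ ih => exact .pabs _ ih
  | nabs n _ ih => exact .nabs _ ih
  | papp n _ _ ih ih' => exact .papp _ ih ih'
  | napp n v _ ih => exact .napp _ _ ih
  | pbeta n _ hc _ ih ih' => exact (Struct.papp n (ih.trans hc.struct) ih').trans (.pbeta _ _ _)
  | nbeta n v _ hc ih => exact (Struct.napp n v (ih.trans hc.struct)).trans (.nbeta _ _ _)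

theorem renN {d : ℕ} {T T' : HO d} (h : PRed T T') (ρ : ℕ → ℕ) :
    PRed (HO.renN ρ T) (HO.renN ρ T') := by
  induction h generalizing ρ with
  | nil => exact .nil
  | var X => exact .var X
  | inp u _ ih => exact .inp _ (ih ρ)
  | out u _ _ ih ih' => exact .out _ (ih ρ) (ih' ρ)
  | par _ _ ih ih' => exact .par (ih ρ) (ih' ρ)
  | nu _ ih => exact .nu (ih _)
  | repInp u _ ih => exact .repInp _ (ih ρ)
  | repOut u _ _ ih ih' => exact .repOut _ (ih ρ) (ih' ρ)
  | pabs n _ ih => exact .pabs _ (ih ρ)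
  | nabs n _ ih => exact .nabs _ (ih _)
  | papp n _ _ ih ih' => exact .papp _ (ih ρ) fun i => ih' i ρ
  | napp n v _ ih => exact .napp _ _ (ih ρ)
  | pbeta n _ hc _ ih ih' =>
    rw [renN_instP]
    exact .pbeta _ (ih ρ) (hc.renN ρ) fun i => ih' i ρ
  | nbeta n v _ hc ih =>
    rw [renN_instN]
    exact .nbeta _ _ (ih ρ) (hc.renN ρ)

theorem subst {d e : ℕ} {T T' : HO d} (h : PRed T T') (σ : Fin d → HO e) :
    PRed (HO.subst σ T) (HO.subst σ T') := by
  induction h generalizing e with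
  | nil => exact .nil
  | var X => exact .refl _
  | inp u _ ih => exact .inp _ (ih _)
  | out u _ _ ih ih' => exact .out _ (ih _) (ih' _)
  | par _ _ ih ih' => exact .par (ih _) (ih' _)
  | nu _ ih => exact .nu (ih _)
  | repInp u _ ih => exact .repInp _ (ih _)
  | repOut u _ _ ih ih' => exact .repOut _ (ih _) (ih' _)
  | pabs n _ ih => exact .pabs _ (ih _)
  | nabs n _ ih => exact .nabs _ (ih _)
  | papp n _ _ ih ih' => exact .papp _ (ih _) fun i => ih' i _
  | napp n v _ ih => exact .napp _ _ (ih _)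
  | pbeta n _ hc _ ih ih' =>
    rw [subst_instP]
    exact .pbeta _ (ih _) (hc.subst _) fun i => ih' i _
  | nbeta n v _ hc ih =>
    rw [subst_instN]
    exact .nbeta _ _ (ih _) (hc.subst _)

theorem upSub {d e : ℕ} {σ σ' : Fin d → HO e} (h : ∀ X, PRed (σ X) (σ' X)) (k : ℕ)
    (X : Fin (d + k)) : PRed (HO.upSub k σ X) (HO.upSub k σ' X) := by
  induction X using Fin.addCases with
  | left i => simpa only [upSub_castAdd, renP_eq_subst] using (h i).subst _
  | right j => simpa only [upSub_natAdd] using .refl _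

/-- Parallel reduction is closed under simultaneous reduction of a term and of a substitution. -/
theorem subst' {d e : ℕ} {T T' : HO d} (h : PRed T T') {σ σ' : Fin d → HO e}
    (hσ : ∀ X, PRed (σ X) (σ' X)) : PRed (HO.subst σ T) (HO.subst σ' T') := by
  induction h generalizing e with
  | nil => exact .nil
  | var X => exact hσ X
  | inp u _ ih => exact .inp _ (ih (upSub hσ _))
  | out u _ _ ih ih' => exact .out _ (ih hσ) (ih' hσ)
  | par _ _ ih ih' => exact .par (ih hσ) (ih' hσ)
  | nu _ ih => exact .nu (ih fun X => (hσ X).renN _)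
  | repInp u _ ih => exact .repInp _ (ih (upSub hσ _))
  | repOut u _ _ ih ih' => exact .repOut _ (ih hσ) (ih' hσ)
  | pabs n _ ih => exact .pabs _ (ih (upSub hσ _))
  | nabs n _ ih => exact .nabs _ (ih fun X => (hσ X).renN _)
  | papp n _ _ ih ih' => exact .papp _ (ih hσ) fun i => ih' i hσ
  | napp n v _ ih => exact .napp _ _ (ih hσ)
  | pbeta n _ hc _ ih ih' =>
    rw [subst_instP]
    exact .pbeta _ (ih hσ) (hc.subst _) fun i => ih' i hσ
  | nbeta n v _ hc ih =>
    rw [subst_instN]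
    exact .nbeta _ _ (ih hσ) (hc.subst _)

theorem instP {d k : ℕ} {T T' : HO (d + k)} {K K' : Fin k → HO d} (h : PRed T T')
    (h' : ∀ i, PRed (K i) (K' i)) : PRed (HO.instP T K) (HO.instP T' K') := by
  refine h.subst' fun X => ?_
  induction X using Fin.addCases with
  | left i => simpa using .refl _
  | right j => simpa using h' j

/-- Reduction does not introduce free names; it may erase some. -/
theorem fn_subset {d : ℕ} {T T' : HO d} (h : PRed T T') : fn T' ⊆ fn T := by
  induction h with
  | nil => exact subset_rfl
  | var X => exact subset_rfl
  | nu _ ih => exact fun i hi => ih hi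
  | nabs n _ ih => exact fun i hi => ih hi
  | @pbeta d n F F' T K K' _ hc _ ih ih' =>
    intro i hi
    rw [hc.fn_eq] at ih
    rcases mem_fn_subst _ _ hi with hi | ⟨X, hX⟩
    · exact .inl (ih hi)
    · induction X using Fin.addCases with
      | left j => simp [fn] at hX
      | right j => exact .inr (Set.mem_iUnion.2 ⟨j, ih' j (by simpa using hX)⟩)
  | @nbeta d n F F' T v _ hc ih =>
    intro i hi
    rw [hc.fn_eq] at ih
    obtain ⟨j, hj, rfl⟩ := (mem_fn_renN _ _ _).1 hi
    simp only [instName]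
    split_ifs with hjn
    · exact .inr ⟨_, rfl⟩
    · refine .inl (ih ?_)
      simpa [fn, Nat.sub_add_cancel (Nat.le_of_not_lt hjn)] using hj
  | papp n _ _ ih ih' => exact Set.union_subset_union ih (Set.iUnion_mono ih')
  | _ => simp only [fn]; gcongr

/-- Reductions of a shift are shifts of reductions. -/
theorem of_shift {d : ℕ} {T U : HO d} (h : PRed (shift 1 T) U) :
    ∃ U', U = shift 1 U' ∧ PRed T U' := by
  refine ⟨HO.renN Nat.pred U, (shift_one_pred fun h0 => ?_).symm, ?_⟩
  · exact zero_notMem_fn_shift _ (h.fn_subset h0)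
  · simpa only [pred_shift_one] using h.renN Nat.pred

end PRed

/-- Every reduction of `T` is matched by one of `T'`, up to congruence. -/
def RedSim {d : ℕ} (T T' : HO d) : Prop := ∀ U, PRed T U → ∃ U', PRed T' U' ∧ Cong U U'

/-- The laws of `Cong` rearrange reductions but neither create nor destroy them; for the law
`nuPar`, this is because reduction does not introduce free names. -/
theorem Cong.redSim {d : ℕ} {T T' : HO d} (h : Cong T T') : RedSim T T' ∧ RedSim T' T := by
  induction h with
  | refl T => exact ⟨fun U h => ⟨U, h, .refl _⟩, fun U h => ⟨U, h, .refl _⟩⟩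
  | symm _ ih => exact ih.symm
  | trans _ _ ih ih' =>
    constructor
    · intro U h
      obtain ⟨U', h', c⟩ := ih.1 U h
      obtain ⟨U'', h'', c'⟩ := ih'.1 U' h'
      exact ⟨U'', h'', c.trans c'⟩
    · intro U h
      obtain ⟨U', h', c⟩ := ih'.2 U h
      obtain ⟨U'', h'', c'⟩ := ih.2 U' h'
      exact ⟨U'', h'', c.trans c'⟩
  | parNil T =>
    constructor
    · rintro U (_ | _)
      rename_i T' S' h h'
      cases h'
      exact ⟨_, h, .parNil _⟩
    · intro U h
      exact ⟨_, .par h .nil, (Cong.parNil _).symm⟩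
  | parComm T T' =>
    constructor <;>
    · rintro U (_ | _)
      rename_i h h'
      exact ⟨_, .par h' h, .parComm _ _⟩
  | parAssoc T T' T'' =>
    constructor
    · rintro U (_ | _)
      rename_i h h''
      cases h with | par h h' =>
      exact ⟨_, .par h (.par h' h''), .parAssoc _ _ _⟩
    · rintro U (_ | _)
      rename_i h h''
      cases h'' with | par h' h'' =>
      exact ⟨_, .par (.par h h') h'', (Cong.parAssoc _ _ _).symm⟩
  | nuComm T =>
    constructor
    · rintro U (_ | _)
      rename_i h
      cases h with | nu h =>
      exact ⟨_, .nu (.nu (h.renN _)), .nuComm _⟩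
    · rintro U (_ | _)
      rename_i h
      cases h with | @nu _ _ U h =>
      have := h.renN (rotName 1)
      rw [renN_renN, renN_eq_self _ rotName_one_rotName_one] at this
      exact ⟨_, .nu (.nu this), .nuComm _⟩
  | nuPar T T' =>
    constructor
    · rintro U (_ | _)
      rename_i h
      cases h with | par h h' =>
      obtain ⟨V, rfl, r⟩ := h'.of_shift
      exact ⟨_, .par (.nu h) r, .nuPar _ _⟩
    · rintro U (_ | _)
      rename_i h h'
      cases h with | nu h =>
      exact ⟨_, .nu (.par h (h'.renN _)), (Cong.nuPar _ _).symm⟩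
  | inp u _ ih =>
    constructor
    · rintro U (_ | _)
      rename_i h
      obtain ⟨V, h, c⟩ := ih.1 _ h
      exact ⟨_, .inp _ h, .inp _ c⟩
    · rintro U (_ | _)
      rename_i h
      obtain ⟨V, h, c⟩ := ih.2 _ h
      exact ⟨_, .inp _ h, .inp _ c⟩
  | out u _ _ ih ih' =>
    constructor
    · rintro U (_ | _)
      rename_i h h'
      obtain ⟨V, h, c⟩ := ih.1 _ h
      obtain ⟨V', h', c'⟩ := ih'.1 _ h'
      exact ⟨_, .out _ h h', .out _ c c'⟩
    · rintro U (_ | _)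
      rename_i h h'
      obtain ⟨V, h, c⟩ := ih.2 _ h
      obtain ⟨V', h', c'⟩ := ih'.2 _ h'
      exact ⟨_, .out _ h h', .out _ c c'⟩
  | par _ _ ih ih' =>
    constructor
    · rintro U (_ | _)
      rename_i h h'
      obtain ⟨V, h, c⟩ := ih.1 _ h
      obtain ⟨V', h', c'⟩ := ih'.1 _ h'
      exact ⟨_, .par h h', .par c c'⟩
    · rintro U (_ | _)
      rename_i h h'
      obtain ⟨V, h, c⟩ := ih.2 _ h
      obtain ⟨V', h', c'⟩ := ih'.2 _ h'
      exact ⟨_, .par h h', .par c c'⟩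
  | nu _ ih =>
    constructor
    · rintro U (_ | _)
      rename_i h
      obtain ⟨V, h, c⟩ := ih.1 _ h
      exact ⟨_, .nu h, .nu c⟩
    · rintro U (_ | _)
      rename_i h
      obtain ⟨V, h, c⟩ := ih.2 _ h
      exact ⟨_, .nu h, .nu c⟩
  | repInp u _ ih =>
    constructor
    · rintro U (_ | _)
      rename_i h
      obtain ⟨V, h, c⟩ := ih.1 _ h
      exact ⟨_, .repInp _ h, .repInp _ c⟩
    · rintro U (_ | _)
      rename_i h
      obtain ⟨V, h, c⟩ := ih.2 _ h
      exact ⟨_, .repInp _ h, .repInp _ c⟩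
  | repOut u _ _ ih ih' =>
    constructor
    · rintro U (_ | _)
      rename_i h h'
      obtain ⟨V, h, c⟩ := ih.1 _ h
      obtain ⟨V', h', c'⟩ := ih'.1 _ h'
      exact ⟨_, .repOut _ h h', .repOut _ c c'⟩
    · rintro U (_ | _)
      rename_i h h'
      obtain ⟨V, h, c⟩ := ih.2 _ h
      obtain ⟨V', h', c'⟩ := ih'.2 _ h'
      exact ⟨_, .repOut _ h h', .repOut _ c c'⟩
  | pabs n _ ih =>
    constructor
    · rintro U (_ | _)
      rename_i h
      obtain ⟨V, h, c⟩ := ih.1 _ h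
      exact ⟨_, .pabs _ h, .pabs _ c⟩
    · rintro U (_ | _)
      rename_i h
      obtain ⟨V, h, c⟩ := ih.2 _ h
      exact ⟨_, .pabs _ h, .pabs _ c⟩
  | nabs n _ ih =>
    constructor
    · rintro U (_ | _)
      rename_i h
      obtain ⟨V, h, c⟩ := ih.1 _ h
      exact ⟨_, .nabs _ h, .nabs _ c⟩
    · rintro U (_ | _)
      rename_i h
      obtain ⟨V, h, c⟩ := ih.2 _ h
      exact ⟨_, .nabs _ h, .nabs _ c⟩
  | papp n _ _ ih ih' =>
    constructor
    · rintro U h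
      cases h with
      | papp _ h h' =>
        obtain ⟨V, h, c⟩ := ih.1 _ h
        choose V' h' c' using fun i => (ih' i).1 _ (h' i)
        exact ⟨_, .papp _ h h', .papp _ c c'⟩
      | pbeta _ h hc h' =>
        obtain ⟨V, h, c⟩ := ih.1 _ h
        choose V' h' c' using fun i => (ih' i).1 _ (h' i)
        exact ⟨_, .pbeta _ h (c.symm.trans hc) h', .instP (.refl _) c'⟩
    · rintro U h
      cases h with
      | papp _ h h' =>
        obtain ⟨V, h, c⟩ := ih.2 _ h
        choose V' h' c' using fun i => (ih' i).2 _ (h' i)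
        exact ⟨_, .papp _ h h', .papp _ c c'⟩
      | pbeta _ h hc h' =>
        obtain ⟨V, h, c⟩ := ih.2 _ h
        choose V' h' c' using fun i => (ih' i).2 _ (h' i)
        exact ⟨_, .pbeta _ h (c.symm.trans hc) h', .instP (.refl _) c'⟩
  | napp n v _ ih =>
    constructor
    · rintro U h
      cases h with
      | napp _ _ h =>
        obtain ⟨V, h, c⟩ := ih.1 _ h
        exact ⟨_, .napp _ _ h, .napp _ _ c⟩
      | nbeta _ _ h hc =>
        obtain ⟨V, h, c⟩ := ih.1 _ h
        exact ⟨_, .nbeta _ _ h (c.symm.trans hc), .refl _⟩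
    · rintro U h
      cases h with
      | napp _ _ h =>
        obtain ⟨V, h, c⟩ := ih.2 _ h
        exact ⟨_, .napp _ _ h, .napp _ _ c⟩
      | nbeta _ _ h hc =>
        obtain ⟨V, h, c⟩ := ih.2 _ h
        exact ⟨_, .nbeta _ _ h (c.symm.trans hc), .refl _⟩

/-- If a term is congruent to an abstraction, then so are its reductions. -/
theorem PRed.of_cong_pabs {d n : ℕ} {F F' : HO d} {T : HO (d + (n + 1))} (h : PRed F F')
    (c : Cong F (HO.pabs n T)) : ∃ T', PRed T T' ∧ Cong F' (HO.pabs n T') := by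
  obtain ⟨_, h', c'⟩ := c.redSim.1 _ h
  cases h' with | pabs _ h' => exact ⟨_, h', c'⟩

theorem PRed.of_cong_nabs {d n : ℕ} {F F' T : HO d} (h : PRed F F')
    (c : Cong F (HO.nabs n T)) : ∃ T', PRed T T' ∧ Cong F' (HO.nabs n T') := by
  obtain ⟨_, h', c'⟩ := c.redSim.1 _ h
  cases h' with | nabs _ h' => exact ⟨_, h', c'⟩

/-- The diamond property of parallel reduction, up to congruence.  If only one side contracts an
application, the other side can still do so, as the head stays congruent to an abstraction. -/
theorem PRed.diamond {d : ℕ} {T U₁ U₂ : HO d} (h₁ : PRed T U₁) (h₂ : PRed T U₂) :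
    ∃ V₁ V₂, PRed U₁ V₁ ∧ PRed U₂ V₂ ∧ Cong V₁ V₂ := by
  induction h₁ with
  | nil => cases h₂; exact ⟨_, _, .nil, .nil, .refl _⟩
  | var X => cases h₂; exact ⟨_, _, .var X, .var X, .refl _⟩
  | inp u _ ih =>
    cases h₂ with | inp _ h =>
    obtain ⟨_, _, r₁, r₂, c⟩ := ih h
    exact ⟨_, _, .inp _ r₁, .inp _ r₂, .inp _ c⟩
  | out u _ _ ih ih' =>
    cases h₂ with | out _ h h' =>
    obtain ⟨_, _, r₁, r₂, c⟩ := ih h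
    obtain ⟨_, _, r₁', r₂', c'⟩ := ih' h'
    exact ⟨_, _, .out _ r₁ r₁', .out _ r₂ r₂', .out _ c c'⟩
  | par _ _ ih ih' =>
    cases h₂ with | par h h' =>
    obtain ⟨_, _, r₁, r₂, c⟩ := ih h
    obtain ⟨_, _, r₁', r₂', c'⟩ := ih' h'
    exact ⟨_, _, .par r₁ r₁', .par r₂ r₂', .par c c'⟩
  | nu _ ih =>
    cases h₂ with | nu h =>
    obtain ⟨_, _, r₁, r₂, c⟩ := ih h
    exact ⟨_, _, .nu r₁, .nu r₂, .nu c⟩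
  | repInp u _ ih =>
    cases h₂ with | repInp _ h =>
    obtain ⟨_, _, r₁, r₂, c⟩ := ih h
    exact ⟨_, _, .repInp _ r₁, .repInp _ r₂, .repInp _ c⟩
  | repOut u _ _ ih ih' =>
    cases h₂ with | repOut _ h h' =>
    obtain ⟨_, _, r₁, r₂, c⟩ := ih h
    obtain ⟨_, _, r₁', r₂', c'⟩ := ih' h'
    exact ⟨_, _, .repOut _ r₁ r₁', .repOut _ r₂ r₂', .repOut _ c c'⟩
  | pabs n _ ih =>
    cases h₂ with | pabs _ h =>
    obtain ⟨_, _, r₁, r₂, c⟩ := ih h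
    exact ⟨_, _, .pabs _ r₁, .pabs _ r₂, .pabs _ c⟩
  | nabs n _ ih =>
    cases h₂ with | nabs _ h =>
    obtain ⟨_, _, r₁, r₂, c⟩ := ih h
    exact ⟨_, _, .nabs _ r₁, .nabs _ r₂, .nabs _ c⟩
  | papp n _ _ ih ih' =>
    cases h₂ with
    | papp _ h h' =>
      obtain ⟨_, _, r₁, r₂, c⟩ := ih h
      choose _ _ r₁' r₂' c' using fun i => ih' i (h' i)
      exact ⟨_, _, .papp _ r₁ r₁', .papp _ r₂ r₂', .papp _ c c'⟩
    | pbeta _ h hc h' =>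
      obtain ⟨_, _, r₁, r₂, c⟩ := ih h
      choose _ _ r₁' r₂' c' using fun i => ih' i (h' i)
      obtain ⟨_, r, hc'⟩ := r₂.of_cong_pabs hc
      exact ⟨_, _, .pbeta _ r₁ (c.trans hc') r₁', .instP r r₂', .instP (.refl _) c'⟩
  | napp n v _ ih =>
    cases h₂ with
    | napp _ _ h =>
      obtain ⟨_, _, r₁, r₂, c⟩ := ih h
      exact ⟨_, _, .napp _ _ r₁, .napp _ _ r₂, .napp _ _ c⟩
    | nbeta _ _ h hc =>
      obtain ⟨_, _, r₁, r₂, c⟩ := ih h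
      obtain ⟨_, r, hc'⟩ := r₂.of_cong_nabs hc
      exact ⟨_, _, .nbeta _ _ r₁ (c.trans hc'), r.renN _, .refl _⟩
  | pbeta n _ hc₁ _ ih ih' =>
    cases h₂ with
    | papp _ h h' =>
      obtain ⟨_, _, r₁, r₂, c⟩ := ih h
      choose _ _ r₁' r₂' c' using fun i => ih' i (h' i)
      obtain ⟨_, r, hc'⟩ := r₁.of_cong_pabs hc₁
      exact ⟨_, _, .instP r r₁', .pbeta _ r₂ (c.symm.trans hc') r₂', .instP (.refl _) c'⟩
    | pbeta _ h hc h' =>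
      obtain ⟨_, _, r₁, r₂, c⟩ := ih h
      choose _ _ r₁' r₂' c' using fun i => ih' i (h' i)
      obtain ⟨_, s₁, hc₁'⟩ := r₁.of_cong_pabs hc₁
      obtain ⟨_, s₂, hc₂'⟩ := r₂.of_cong_pabs hc
      -- the reducts of the two heads are congruent abstractions, so their bodies are congruent
      exact ⟨_, _, .instP s₁ r₁', .instP s₂ r₂',
        .instP (hc₁'.symm.trans (c.trans hc₂')).pabs_inj c'⟩
  | nbeta n v _ hc₁ ih =>
    cases h₂ with
    | napp _ _ h =>
      obtain ⟨_, _, r₁, r₂, c⟩ := ih h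
      obtain ⟨_, r, hc'⟩ := r₁.of_cong_nabs hc₁
      exact ⟨_, _, r.renN _, .nbeta _ _ r₂ (c.symm.trans hc'), .refl _⟩
    | nbeta _ _ h hc =>
      obtain ⟨_, _, r₁, r₂, c⟩ := ih h
      obtain ⟨_, s₁, hc₁'⟩ := r₁.of_cong_nabs hc₁
      obtain ⟨_, s₂, hc₂'⟩ := r₂.of_cong_nabs hc
      exact ⟨_, _, s₁.renN _, s₂.renN _,
        (hc₁'.symm.trans (c.trans hc₂')).nabs_inj.renN _⟩

/-! ### Confluence -/

/-- Sequences of `n` parallel reductions.  As parallel reduction is reflexive, these are also the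
sequences of at most `n` reductions, so that reductions of several components of a term can be
given the same length. -/
def PReds {d : ℕ} : ℕ → HO d → HO d → Prop
  | 0, T, U => T = U
  | n + 1, T, U => ∃ S, PRed T S ∧ PReds n S U

namespace PReds

theorem refl {d : ℕ} (n : ℕ) (T : HO d) : PReds n T T := by
  induction n with
  | zero => rfl
  | succ n ih => exact ⟨T, .refl T, ih⟩

theorem trans {d m n : ℕ} {T U V : HO d} (h : PReds m T U) (h' : PReds n U V) :
    PReds (m + n) T V := by
  induction m generalizing T with
  | zero => cases h; rwa [Nat.zero_add]
  | succ m ih =>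
    obtain ⟨S, h, hs⟩ := h
    rw [Nat.add_right_comm]
    exact ⟨S, h, ih hs⟩

theorem mono {d m n : ℕ} {T U : HO d} (h : PReds m T U) (hmn : m ≤ n) : PReds n T U := by
  obtain ⟨k, rfl⟩ := Nat.exists_eq_add_of_le hmn
  exact h.trans (refl k U)

theorem struct {d n : ℕ} {T U : HO d} (h : PReds n T U) : Struct T U := by
  induction n generalizing T with
  | zero => cases h; exact .refl _
  | succ n ih =>
    obtain ⟨S, h, hs⟩ := h
    exact h.struct.trans (ih hs)

theorem map {d e n : ℕ} {f : HO d → HO e} (hf : ∀ {T T'}, PRed T T' → PRed (f T) (f T'))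
    {T U : HO d} (h : PReds n T U) : PReds n (f T) (f U) := by
  induction n generalizing T with
  | zero => exact congrArg f h
  | succ n ih =>
    obtain ⟨S, h, hs⟩ := h
    exact ⟨_, hf h, ih hs⟩

theorem map₂ {d d' e n : ℕ} {f : HO d → HO d' → HO e}
    (hf : ∀ {T T' S S'}, PRed T T' → PRed S S' → PRed (f T S) (f T' S'))
    {T U : HO d} {S V : HO d'} (h : PReds n T U) (h' : PReds n S V) :
    PReds n (f T S) (f U V) := by
  induction n generalizing T S with
  | zero => cases h; cases h'; rfl
  | succ n ih =>
    obtain ⟨_, h, hs⟩ := h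
    obtain ⟨_, h', hs'⟩ := h'
    exact ⟨_, hf h h', ih hs hs'⟩

theorem papp {d n k : ℕ} {T U : HO d} {K L : Fin (k + 1) → HO d} (h : PReds n T U)
    (h' : ∀ i, PReds n (K i) (L i)) : PReds n (HO.papp k T K) (HO.papp k U L) := by
  induction n generalizing T K with
  | zero => cases h; cases funext h'; rfl
  | succ n ih =>
    obtain ⟨_, h, hs⟩ := h
    choose _ h' hs' using h'
    exact ⟨_, .papp k h h', ih hs hs'⟩

theorem inp_inv {d n u : ℕ} {T : HO (d + 1)} {U : HO d} (h : PReds n (inp u T) U) :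
    ∃ T', U = inp u T' ∧ PReds n T T' := by
  induction n generalizing T with
  | zero => exact ⟨T, h.symm, rfl⟩
  | succ n ih =>
    obtain ⟨_, h, hs⟩ := h
    cases h with | inp _ h =>
    obtain ⟨T', rfl, hs'⟩ := ih hs
    exact ⟨T', rfl, _, h, hs'⟩

theorem repInp_inv {d n u : ℕ} {T : HO (d + 1)} {U : HO d} (h : PReds n (repInp u T) U) :
    ∃ T', U = repInp u T' ∧ PReds n T T' := by
  induction n generalizing T with
  | zero => exact ⟨T, h.symm, rfl⟩
  | succ n ih =>
    obtain ⟨_, h, hs⟩ := h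
    cases h with | repInp _ h =>
    obtain ⟨T', rfl, hs'⟩ := ih hs
    exact ⟨T', rfl, _, h, hs'⟩

theorem out_inv {d n u : ℕ} {A T U : HO d} (h : PReds n (out u A T) U) :
    ∃ A' T', U = out u A' T' ∧ PReds n A A' ∧ PReds n T T' := by
  induction n generalizing A T with
  | zero => exact ⟨A, T, h.symm, rfl, rfl⟩
  | succ n ih =>
    obtain ⟨_, h, hs⟩ := h
    cases h with | out _ h h' =>
    obtain ⟨A', T', rfl, hs, hs'⟩ := ih hs
    exact ⟨A', T', rfl, ⟨_, h, hs⟩, _, h', hs'⟩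

theorem repOut_inv {d n u : ℕ} {A T U : HO d} (h : PReds n (repOut u A T) U) :
    ∃ A' T', U = repOut u A' T' := by
  induction n generalizing A T with
  | zero => exact ⟨A, T, h.symm⟩
  | succ n ih =>
    obtain ⟨_, h, hs⟩ := h
    cases h with | repOut _ h h' =>
    exact ih hs

theorem par_inv {d n : ℕ} {T S U : HO d} (h : PReds n (par T S) U) :
    ∃ T' S', U = par T' S' ∧ PReds n T T' ∧ PReds n S S' := by
  induction n generalizing T S with
  | zero => exact ⟨T, S, h.symm, rfl, rfl⟩
  | succ n ih =>
    obtain ⟨_, h, hs⟩ := h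
    cases h with | par h h' =>
    obtain ⟨A', T', rfl, hs, hs'⟩ := ih hs
    exact ⟨A', T', rfl, ⟨_, h, hs⟩, _, h', hs'⟩

theorem nu_inv {d n : ℕ} {T U : HO d} (h : PReds n (nu T) U) :
    ∃ T', U = nu T' ∧ PReds n T T' := by
  induction n generalizing T with
  | zero => exact ⟨T, h.symm, rfl⟩
  | succ n ih =>
    obtain ⟨_, h, hs⟩ := h
    cases h with | nu h =>
    obtain ⟨T', rfl, hs'⟩ := ih hs
    exact ⟨T', rfl, _, h, hs'⟩

theorem nus_inv {d n k : ℕ} {T U : HO d} (h : PReds n (nus k T) U) :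
    ∃ T', U = nus k T' ∧ PReds n T T' := by
  induction k generalizing U with
  | zero => exact ⟨U, rfl, h⟩
  | succ k ih =>
    obtain ⟨V, rfl, h'⟩ := nu_inv h
    obtain ⟨T', rfl, r⟩ := ih h'
    exact ⟨T', rfl, r⟩

theorem of_cong {d n : ℕ} {T T' U : HO d} (h : PReds n T U) (c : Cong T T') :
    ∃ U', PReds n T' U' ∧ Cong U U' := by
  induction n generalizing T T' with
  | zero => cases h; exact ⟨T', rfl, c⟩
  | succ n ih =>
    obtain ⟨_, h, hs⟩ := h
    obtain ⟨_, h', c⟩ := c.redSim.1 _ h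
    obtain ⟨U', hs', c⟩ := ih hs c
    exact ⟨U', ⟨_, h', hs'⟩, c⟩

/-- A single reduction and a sequence of reductions can be joined, up to congruence. -/
theorem strip {d n : ℕ} {T U V : HO d} (h : PRed T U) (h' : PReds n T V) :
    ∃ W W', PReds n U W ∧ PRed V W' ∧ Cong W W' := by
  induction n generalizing T U with
  | zero => cases h'; exact ⟨U, U, rfl, h, .refl _⟩
  | succ n ih =>
    obtain ⟨S, h', hs⟩ := h'
    obtain ⟨X, Y, hX, hY, c⟩ := h.diamond h'
    obtain ⟨W, W', hW, hW', c'⟩ := ih hY hs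
    obtain ⟨W₀, hW₀, c''⟩ := hW.of_cong c.symm
    exact ⟨W₀, W', ⟨X, hX, hW₀⟩, hW', c''.symm.trans c'⟩

theorem confluence {d m n : ℕ} {T U V : HO d} (h : PReds m T U) (h' : PReds n T V) :
    ∃ W W', PReds n U W ∧ PReds m V W' ∧ Cong W W' := by
  induction m generalizing T V with
  | zero => cases h; exact ⟨V, V, h', rfl, .refl _⟩
  | succ m ih =>
    obtain ⟨S, h, hs⟩ := h
    obtain ⟨X, Y, hX, hY, c⟩ := strip h h'
    obtain ⟨W, W', hW, hW', c'⟩ := ih hs hX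
    obtain ⟨W₀, hW₀, c''⟩ := hW'.of_cong c
    exact ⟨W, W₀, hW, ⟨Y, hY, hW₀⟩, c'.trans c''⟩

end PReds

/-- The terms have a common reduct, up to congruence. -/
def Joinable {d : ℕ} (T T' : HO d) : Prop :=
  ∃ n U U', PReds n T U ∧ PReds n T' U' ∧ Cong U U'

namespace Joinable

theorem of_cong {d : ℕ} {T T' : HO d} (h : Cong T T') : Joinable T T' := ⟨0, T, T', rfl, rfl, h⟩

theorem of_pred {d : ℕ} {T T' : HO d} (h : PRed T T') : Joinable T T' :=
  ⟨1, T', T', ⟨_, h, rfl⟩, .refl _ _, .refl _⟩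

theorem symm {d : ℕ} {T T' : HO d} : Joinable T T' → Joinable T' T :=
  fun ⟨n, U, U', h, h', c⟩ => ⟨n, U', U, h', h, c.symm⟩

theorem trans {d : ℕ} {T T' T'' : HO d} : Joinable T T' → Joinable T' T'' → Joinable T T'' := by
  rintro ⟨m, U, U', h, h', c⟩ ⟨n, V', V, r', r, c'⟩
  obtain ⟨W, W', hW, hW', e⟩ := h'.confluence r'
  obtain ⟨X, hX, eX⟩ := hW.of_cong c.symm
  obtain ⟨Y, hY, eY⟩ := hW'.of_cong c'
  exact ⟨m + n, X, Y, h.trans hX, Nat.add_comm n m ▸ r.trans hY, eX.symm.trans (e.trans eY)⟩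

theorem map {d e : ℕ} {f : HO d → HO e} (hf : ∀ {T T'}, PRed T T' → PRed (f T) (f T'))
    (hc : ∀ {T T'}, Cong T T' → Cong (f T) (f T')) {T T' : HO d} :
    Joinable T T' → Joinable (f T) (f T') :=
  fun ⟨n, _, _, h, h', c⟩ => ⟨n, _, _, h.map hf, h'.map hf, hc c⟩

theorem map₂ {d d' e : ℕ} {f : HO d → HO d' → HO e}
    (hf : ∀ {T T' S S'}, PRed T T' → PRed S S' → PRed (f T S) (f T' S'))
    (hc : ∀ {T T' S S'}, Cong T T' → Cong S S' → Cong (f T S) (f T' S'))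
    {T T' : HO d} {S S' : HO d'} : Joinable T T' → Joinable S S' → Joinable (f T S) (f T' S') := by
  rintro ⟨m, _, _, h, h', c⟩ ⟨n, _, _, r, r', e⟩
  exact ⟨m + n, _, _, .map₂ hf (h.mono (Nat.le_add_right _ _)) (r.mono (Nat.le_add_left _ _)),
    .map₂ hf (h'.mono (Nat.le_add_right _ _)) (r'.mono (Nat.le_add_left _ _)), hc c e⟩

theorem papp {d k : ℕ} {T T' : HO d} {K K' : Fin (k + 1) → HO d} (hT : Joinable T T')
    (hK : ∀ i, Joinable (K i) (K' i)) : Joinable (HO.papp k T K) (HO.papp k T' K') := by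
  obtain ⟨m, _, _, h, h', c⟩ := hT
  choose n _ _ r r' e using hK
  have hn : ∀ i, n i ≤ m + ∑ j, n j := fun i =>
    (Finset.single_le_sum (fun _ _ => Nat.zero_le _) (Finset.mem_univ i)).trans
      (Nat.le_add_left _ _)
  exact ⟨m + ∑ j, n j, _, _,
    .papp (h.mono (Nat.le_add_right _ _)) fun i => (r i).mono (hn i),
    .papp (h'.mono (Nat.le_add_right _ _)) fun i => (r' i).mono (hn i), .papp k c e⟩

end Joinable

/-- The Church-Rosser theorem for structural congruence. -/
theorem Struct.joinable {d : ℕ} {T T' : HO d} (h : Struct T T') : Joinable T T' := by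
  induction h with
  | refl T => exact .of_cong (.refl _)
  | symm _ ih => exact ih.symm
  | trans _ _ ih ih' => exact ih.trans ih'
  | parNil T => exact .of_cong (.parNil _)
  | parComm T T' => exact .of_cong (.parComm _ _)
  | parAssoc T T' T'' => exact .of_cong (.parAssoc _ _ _)
  | nuComm T => exact .of_cong (.nuComm _)
  | nuPar T T' => exact .of_cong (.nuPar _ _)
  | pbeta n T K => exact .of_pred (.pbeta n (.refl _) (.refl _) fun _ => .refl _)
  | nbeta n T v => exact .of_pred (.nbeta n v (.refl _) (.refl _))
  | inp u _ ih => exact ih.map (.inp u) (.inp u)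
  | out u _ _ ih ih' => exact ih.map₂ (.out u) (.out u) ih'
  | par _ _ ih ih' => exact ih.map₂ .par .par ih'
  | nu _ ih => exact ih.map .nu .nu
  | repInp u _ ih => exact ih.map (.repInp u) (.repInp u)
  | repOut u _ _ ih ih' => exact ih.map₂ (.repOut u) (.repOut u) ih'
  | pabs n _ ih => exact ih.map (.pabs n) (.pabs n)
  | nabs n _ ih => exact ih.map (.nabs n) (.nabs n)
  | papp n _ _ ih ih' => exact ih.papp ih'
  | napp n v _ ih => exact ih.map (.napp n v) (.napp n v)

/-- Terms that parallel reduction does not change, up to congruence. -/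
def IsNormal {d : ℕ} (T : HO d) : Prop := ∀ U, PRed T U → Cong T U

theorem IsNormal.of_cong {d : ℕ} {T T' : HO d} (h : IsNormal T) (c : Cong T T') :
    IsNormal T' := fun U r => by
  obtain ⟨U', r', c'⟩ := c.redSim.2 U r
  exact c.symm.trans ((h U' r').trans c'.symm)

theorem IsNormal.cong {d n : ℕ} {T U : HO d} (h : IsNormal T) (r : PReds n T U) : Cong T U := by
  induction n generalizing T with
  | zero => cases r; exact .refl _
  | succ n ih =>
    obtain ⟨S, r, rs⟩ := r
    exact (h S r).trans (ih (h.of_cong (h S r)) rs)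

/-- A term that is structurally congruent to a normal term reduces to it, up to congruence. -/
theorem Struct.reds {d : ℕ} {T M : HO d} (h : Struct T M) (hM : IsNormal M) :
    ∃ n U, PReds n T U ∧ Cong U M := by
  obtain ⟨n, U, U', r, r', c⟩ := h.joinable
  exact ⟨n, U, r, c.trans (hM.cong r').symm⟩

namespace IsNormal

theorem nil {d : ℕ} : IsNormal (HO.nil : HO d) := by rintro _ (_ | _); exact .refl _

theorem var {d : ℕ} (X : Fin d) : IsNormal (HO.var X) := by rintro _ (_ | _); exact .refl _

theorem inp {d : ℕ} (u : ℕ) {T : HO (d + 1)} (h : IsNormal T) : IsNormal (HO.inp u T) := by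
  rintro _ (_ | _); exact .inp _ (h _ ‹_›)

theorem repInp {d : ℕ} (u : ℕ) {T : HO (d + 1)} (h : IsNormal T) :
    IsNormal (HO.repInp u T) := by
  rintro _ (_ | _); exact .repInp _ (h _ ‹_›)

theorem out {d : ℕ} (u : ℕ) {A T : HO d} (hA : IsNormal A) (h : IsNormal T) :
    IsNormal (HO.out u A T) := by
  rintro _ (_ | _); exact .out _ (hA _ ‹_›) (h _ ‹_›)

theorem par {d : ℕ} {T T' : HO d} (h : IsNormal T) (h' : IsNormal T') :
    IsNormal (HO.par T T') := by
  rintro _ (_ | _); exact .par (h _ ‹_›) (h' _ ‹_›)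

theorem nu {d : ℕ} {T : HO d} (h : IsNormal T) : IsNormal (HO.nu T) := by
  rintro _ (_ | _); exact .nu (h _ ‹_›)

theorem nus {d : ℕ} (k : ℕ) {T : HO d} (h : IsNormal T) : IsNormal (HO.nus k T) := by
  induction k with
  | zero => exact h
  | succ k ih => exact ih.nu

theorem pabs {d : ℕ} (n : ℕ) {T : HO (d + (n + 1))} (h : IsNormal T) :
    IsNormal (HO.pabs n T) := by
  rintro _ (_ | _); exact .pabs _ (h _ ‹_›)

theorem nabs {d : ℕ} (n : ℕ) {T : HO d} (h : IsNormal T) : IsNormal (HO.nabs n T) := by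
  rintro _ (_ | _); exact .nabs _ (h _ ‹_›)

theorem papp {d : ℕ} (n : ℕ) {F : HO d} {K : Fin (n + 1) → HO d} (hF : IsNormal F)
    (hK : ∀ i, IsNormal (K i)) (hne : ∀ T, ¬ Cong F (HO.pabs n T)) :
    IsNormal (HO.papp n F K) := by
  intro U h
  cases h with
  | papp _ h h' => exact .papp _ (hF _ h) fun i => hK i _ (h' i)
  | pbeta _ h hc h' => exact absurd ((hF _ h).trans hc) (hne _)

theorem napp {d : ℕ} (n : ℕ) {F : HO d} (v : Fin (n + 1) → ℕ) (hF : IsNormal F)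
    (hne : ∀ T, ¬ Cong F (HO.nabs n T)) : IsNormal (HO.napp n F v) := by
  intro U h
  cases h with
  | napp _ _ h => exact .napp _ _ (hF _ h)
  | nbeta _ _ h hc => exact absurd ((hF _ h).trans hc) (hne _)

theorem nameMsg {d : ℕ} (n : ℕ) : IsNormal (HO.nameMsg n : HO d) :=
  .pabs _ (.napp _ _ (.var _) fun _ h => by simpa [absHeads] using h.absHeads_eq)

/-- Encodings contain no application of an abstraction. -/
theorem encode (d : ℕ) (P : PiProc) : IsNormal (_root_.encode d P) := by
  have body : ∀ {d : ℕ} (T : HO (d + 1)), IsNormal T →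
      IsNormal (HO.papp 0 (HO.var (Fin.last d)) fun _ => HO.nabs 0 T) := fun T hT =>
    .papp _ (.var _) (fun _ => hT.nabs _) fun _ h => by simpa [absHeads] using h.absHeads_eq
  induction P generalizing d with
  | nil => exact .nil
  | inp m P ih => exact .inp _ (body _ (ih _))
  | out m n P ih => exact .out _ (.nameMsg n) (ih _)
  | nu P ih => exact (ih _).nu
  | par P Q ih ih' => exact (ih _).par (ih' _)
  | rep m P ih => exact .repInp _ (body _ (ih _))

end IsNormal

end HO

/-! ### Renaming in the pi-calculus -/

namespace PiProc

theorem ren_ren (P : PiProc) (ρ τ : ℕ → ℕ) : ren ρ (ren τ P) = ren (fun i => ρ (τ i)) P := by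
  induction P generalizing ρ τ <;> simp_all [ren, upName_comp]

theorem ren_id (P : PiProc) : ren (fun i => i) P = P := by
  induction P <;> simp_all [ren, upName_id]

theorem ren_eq_self (P : PiProc) {ρ : ℕ → ℕ} (h : ∀ i, ρ i = i) : ren ρ P = P := by
  rw [show ρ = fun i => i from funext h, ren_id]

@[simp] theorem shift_zero (P : PiProc) : shift 0 P = P := ren_id P

theorem ren_rotName_zero (P : PiProc) : ren (rotName 0) P = P :=
  ren_eq_self P fun i => by simp only [rotName]; split_ifs <;> omega

theorem ren_shift_comm (P : PiProc) {k l : ℕ} {ρ τ : ℕ → ℕ} (h : ∀ i, ρ (i + k) = τ i + l) :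
    ren ρ (shift k P) = shift l (ren τ P) := by
  simp only [shift, ren_ren, h]

theorem ren_inst (P : PiProc) (b : ℕ) (ρ : ℕ → ℕ) :
    ren ρ (inst P b) = inst (ren (upName 1 ρ) P) (ρ b) := by
  simp only [inst, ren_ren, HO.instName_comp]

/-- The set of free names. -/
def fn : PiProc → Set ℕ
  | nil => ∅
  | inp m P => {m} ∪ {i | i + 1 ∈ fn P}
  | out m n P => {m, n} ∪ fn P
  | nu P => {i | i + 1 ∈ fn P}
  | par P Q => fn P ∪ fn Q
  | rep m P => {m} ∪ {i | i + 1 ∈ fn P}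

theorem mem_fn_ren (P : PiProc) (ρ : ℕ → ℕ) (i : ℕ) :
    i ∈ fn (ren ρ P) ↔ ∃ j ∈ fn P, ρ j = i := by
  have key : ∀ (ρ : ℕ → ℕ) (s : Set ℕ) (i : ℕ),
      (∃ j ∈ s, upName 1 ρ j = i + 1) ↔ ∃ j, j + 1 ∈ s ∧ ρ j = i := by
    intro ρ s i
    constructor
    · rintro ⟨_ | j, hj, h⟩ <;> simp [upName] at h
      exact ⟨j, hj, h⟩
    · rintro ⟨j, hj, rfl⟩
      exact ⟨_, hj, by simp [upName]⟩
  induction P generalizing ρ i with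
  | nil => simp [ren, fn]
  | inp m P ih => simp [ren, fn, ih, key, or_and_right, exists_or, eq_comm]
  | out m n P ih => simp [ren, fn, ih, or_and_right, exists_or, eq_comm]
  | nu P ih => simp [ren, fn, ih, key]
  | par P Q ih ih' => simp [ren, fn, ih, ih', or_and_right, exists_or]
  | rep m P ih => simp [ren, fn, ih, key, or_and_right, exists_or, eq_comm]

theorem ren_congr (P : PiProc) {ρ ρ' : ℕ → ℕ} (h : ∀ i ∈ fn P, ρ i = ρ' i) :
    ren ρ P = ren ρ' P := by
  have key : ∀ (ρ ρ' : ℕ → ℕ) (s : Set ℕ), (∀ i, i + 1 ∈ s → ρ i = ρ' i) →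
      ∀ i ∈ s, upName 1 ρ i = upName 1 ρ' i := by
    rintro ρ ρ' s h (_ | i) hi
    · rfl
    · simp [upName, h i hi]
  induction P generalizing ρ ρ' with
  | nil => rfl
  | inp m P ih =>
    simp only [ren]
    rw [h m (.inl rfl), ih (key _ _ _ fun i hi => h i (.inr hi))]
  | out m n P ih =>
    simp only [ren]
    rw [h m (.inl (.inl rfl)), h n (.inl (.inr rfl)), ih fun i hi => h i (.inr hi)]
  | nu P ih => simp only [ren]; rw [ih (key _ _ _ h)]
  | par P Q ih ih' =>
    simp only [ren]
    rw [ih fun i hi => h i (.inl hi), ih' fun i hi => h i (.inr hi)]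
  | rep m P ih =>
    simp only [ren]
    rw [h m (.inl rfl), ih (key _ _ _ fun i hi => h i (.inr hi))]

theorem exists_fn_lt (P : PiProc) : ∃ N, ∀ i ∈ fn P, i < N := by
  induction P with
  | nil => exact ⟨0, by simp [fn]⟩
  | inp m P ih =>
    obtain ⟨N, hN⟩ := ih
    refine ⟨N + m + 1, ?_⟩
    rintro i (rfl | hi)
    · omega
    · have := hN _ hi; omega
  | out m n P ih =>
    obtain ⟨N, hN⟩ := ih
    refine ⟨N + m + n + 1, ?_⟩
    rintro i ((rfl | rfl) | hi)
    · omega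
    · omega
    · have := hN _ hi; omega
  | nu P ih =>
    obtain ⟨N, hN⟩ := ih
    exact ⟨N, fun i hi => by have := hN _ hi; omega⟩
  | par P Q ih ih' =>
    obtain ⟨N, hN⟩ := ih
    obtain ⟨M, hM⟩ := ih'
    refine ⟨N + M, ?_⟩
    rintro i (hi | hi)
    · have := hN _ hi; omega
    · have := hM _ hi; omega
  | rep m P ih =>
    obtain ⟨N, hN⟩ := ih
    refine ⟨N + m + 1, ?_⟩
    rintro i (rfl | hi)
    · omega
    · have := hN _ hi; omega

end PiProc

namespace PiAct

/-- Replacement of the free names of an action. -/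
def ren (ρ : ℕ → ℕ) : PiAct → PiAct
  | tau => tau
  | inp a b => inp (ρ a) (ρ b)
  | out a b => out (ρ a) (ρ b)
  | bout a => bout (ρ a)

/-- The free names of an action that the acting process has to know. -/
def known : PiAct → Set ℕ
  | tau => ∅
  | inp a _ => {a}
  | out a b => {a, b}
  | bout a => {a}

/-- The names received in an action. -/
def received : PiAct → Set ℕ
  | inp _ b => {b}
  | _ => ∅

@[simp] theorem bn_ren (ρ : ℕ → ℕ) (α : PiAct) : (α.ren ρ).bn = α.bn := by cases α <;> rfl

@[simp] theorem bn_under (α : PiAct) : α.under.bn = α.bn := by cases α <;> rfl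

theorem under_eq_ren (α : PiAct) : α.under = α.ren (· + 1) := by cases α <;> rfl

theorem ren_ren (ρ τ : ℕ → ℕ) (α : PiAct) : (α.ren τ).ren ρ = α.ren fun i => ρ (τ i) := by
  cases α <;> rfl

theorem ren_eq_self {ρ : ℕ → ℕ} (h : ∀ i, ρ i = i) (α : PiAct) : α.ren ρ = α := by
  cases α <;> simp [ren, h]

theorem ren_under (ρ : ℕ → ℕ) (α : PiAct) : α.under.ren (upName 1 ρ) = (α.ren ρ).under := by
  cases α <;> simp [ren, under, upName]

end PiAct

theorem upName_zero (ρ : ℕ → ℕ) : upName 0 ρ = ρ := by funext i; simp [upName]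

theorem rotName_upName (k : ℕ) (ρ : ℕ → ℕ) (i : ℕ) :
    rotName k (upName k (upName 1 ρ) i) = upName 1 (upName k ρ) (rotName k i) := by
  simp only [rotName, upName]
  grind

namespace PiProc

/-- Transitions are preserved by all replacements of names, injective or not. -/
theorem Step.ren {P P' : PiProc} {α : PiAct} (h : Step P α P') (ρ : ℕ → ℕ) :
    Step (PiProc.ren ρ P) (α.ren ρ) (PiProc.ren (upName α.bn ρ) P') := by
  have hs : ∀ (ρ : ℕ → ℕ) (k : ℕ) (Q : PiProc),
      PiProc.ren (upName k ρ) (Q.shift k) = (PiProc.ren ρ Q).shift k := fun ρ k Q =>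
    ren_shift_comm Q fun i => by simp [upName]
  induction h generalizing ρ with
  | inp a b P => simp only [PiAct.bn, upName_zero, ren_inst]; exact .inp _ _ _
  | out a b P => simp only [PiAct.bn, upName_zero]; exact .out _ _ _
  | rep a b P => simp only [PiAct.bn, upName_zero, PiProc.ren, ren_inst]; exact .rep _ _ _
  | @res P P' α _ ih =>
    have h := ih (upName 1 ρ)
    rw [PiAct.ren_under, PiAct.bn_under] at h
    have := Step.res h
    simp only [PiAct.bn_ren, ren_ren, rotName_upName] at this
    simpa only [PiProc.ren, ren_ren] using this
  | opn _ ih =>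
    have := ih (upName 1 ρ)
    simp only [PiAct.ren, PiAct.bn, upName_zero] at this
    exact .opn (by simpa [upName, PiAct.bn] using this)
  | @parL P P' α Q _ ih =>
    have := (ih ρ).parL (PiProc.ren ρ Q)
    simpa only [PiProc.ren, hs, PiAct.bn_ren] using this
  | @parR Q Q' α P _ ih =>
    have := (ih ρ).parR (PiProc.ren ρ P)
    simpa only [PiProc.ren, hs, PiAct.bn_ren] using this
  | comL _ _ ih ih' =>
    have h := ih ρ
    have h' := ih' ρ
    simp only [PiAct.ren, PiAct.bn, upName_zero] at h h' ⊢
    exact .comL h h'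
  | comR _ _ ih ih' =>
    have h := ih ρ
    have h' := ih' ρ
    simp only [PiAct.ren, PiAct.bn, upName_zero] at h h' ⊢
    exact .comR h h'
  | closeL _ _ ih ih' =>
    have h := ih (upName 1 ρ)
    have h' := ih' ρ
    simp only [PiAct.ren, PiAct.bn, upName_zero, hs] at h h' ⊢
    exact .closeL (by simpa [upName] using h) h'
  | closeR _ _ ih ih' =>
    have h := ih ρ
    have h' := ih' (upName 1 ρ)
    simp only [PiAct.ren, PiAct.bn, upName_zero, hs] at h h' ⊢
    exact .closeR h (by simpa [upName] using h')

theorem Step.known_subset {P P' : PiProc} {α : PiAct} (h : Step P α P') : α.known ⊆ fn P := by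
  induction h with
  | inp a b P => exact fun i hi => .inl hi
  | out a b P => exact fun i hi => .inl hi
  | rep a b P => exact fun i hi => .inl hi
  | @res P P' α _ ih =>
    intro i hi
    refine ih (a := i + 1) ?_
    cases α <;> simp_all [PiAct.known, PiAct.under]
  | opn _ ih =>
    rintro i rfl
    exact ih (.inl rfl)
  | parL Q _ ih => exact fun i hi => .inl (ih hi)
  | parR P _ ih => exact fun i hi => .inr (ih hi)
  | _ => exact Set.empty_subset _

/-- A transition introduces no names other than those received and the one extruded. -/
theorem Step.mem_fn {P P' : PiProc} {α : PiAct} (h : Step P α P') {i : ℕ}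
    (hi : i + α.bn ∈ fn P') : i ∈ fn P ∪ α.received := by
  have hinst : ∀ (P : PiProc) (a b i : ℕ), i ∈ fn (inst P b) → i ∈ fn (PiProc.inp a P) ∪ {b} := by
    intro P a b i hi
    obtain ⟨_ | j, hj, rfl⟩ := (mem_fn_ren _ _ _).1 hi
    · exact .inr rfl
    · exact .inl (.inr hj)
  have hshift : ∀ (k i : ℕ) (Q : PiProc), i + k ∈ fn (Q.shift k) → i ∈ fn Q := by
    intro k i Q hi
    obtain ⟨j, hj, h⟩ := (mem_fn_ren _ _ _).1 hi
    rwa [← Nat.add_right_cancel h]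
  induction h generalizing i with
  | inp a b P => exact hinst _ _ _ _ hi
  | out a b P => exact .inl (.inr hi)
  | rep a b P =>
    rcases hi with hi | hi
    · exact hinst _ _ _ _ hi
    · exact .inl hi
  | @res P P' α _ ih =>
    obtain ⟨j, hj, h⟩ := (mem_fn_ren _ _ _).1 hi
    have hji : j = i + 1 + α.under.bn := by
      simp only [rotName, PiAct.bn_under] at h ⊢
      split_ifs at h <;> omega
    subst hji
    refine (ih hj).imp id fun h => ?_
    cases α <;> simp_all [PiAct.received, PiAct.under]
  | opn _ ih =>
    exact (ih hi).imp id fun h => by simp [PiAct.received] at h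
  | parL Q _ ih =>
    rcases hi with hi | hi
    · exact (ih hi).imp .inl id
    · exact .inl (.inr (hshift _ _ _ hi))
  | parR P _ ih =>
    rcases hi with hi | hi
    · exact .inl (.inl (hshift _ _ _ hi))
    · exact (ih hi).imp .inr id
  | comL _ h' ih ih' =>
    rcases hi with hi | hi
    · rcases ih hi with h | rfl
      · exact .inl (.inl h)
      · exact .inl (.inr (h'.known_subset (.inr rfl)))
    · exact (ih' hi).imp .inr id
  | comR h _ ih ih' =>
    rcases hi with hi | hi
    · exact (ih hi).imp .inl id
    · rcases ih' hi with h' | rfl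
      · exact .inl (.inr h')
      · exact .inl (.inl (h.known_subset (.inr rfl)))
  | closeL _ _ ih ih' =>
    rcases hi with hi | hi
    · rcases ih (i := i + 1) hi with h | h
      · exact .inl (.inl (hshift _ _ _ h))
      · simp [PiAct.received] at h
    · exact (ih' hi).imp .inr id
  | closeR _ _ ih ih' =>
    rcases hi with hi | hi
    · exact (ih hi).imp .inl id
    · rcases ih' (i := i + 1) hi with h | h
      · exact .inl (.inr (hshift _ _ _ h))
      · simp [PiAct.received] at h

theorem zero_notMem_fn_shift (P : PiProc) : 0 ∉ fn (shift 1 P) := by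
  simp [shift, mem_fn_ren]

/-- The transitions of a process in which the name `0` does not occur. -/
theorem Step.of_shift {Q Q' : PiProc} {α : PiAct} (h : Step (shift 1 Q) α.under Q') :
    ∃ Q₀, Step Q α Q₀ ∧ Q' = PiProc.ren (upName α.bn (· + 1)) Q₀ := by
  have h1 := h.ren Nat.pred
  rw [shift, ren_ren, ren_eq_self Q (by simp), PiAct.under_eq_ren, PiAct.ren_ren,
    PiAct.ren_eq_self (by simp), PiAct.bn_ren] at h1
  refine ⟨_, h1, ?_⟩
  rw [ren_ren]
  conv_lhs => rw [← ren_id Q']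
  refine ren_congr _ fun i hi => ?_
  have hne : i ≠ α.bn := by
    rintro rfl
    rw [← Nat.zero_add α.bn, ← PiAct.bn_under] at hi
    rcases h.mem_fn hi with h0 | h0
    · exact zero_notMem_fn_shift _ h0
    · cases α <;> simp [PiAct.received, PiAct.under] at h0
  simp only [upName]
  split_ifs <;> simp_all
  omega

theorem Step.shift {Q Q₀ : PiProc} {α : PiAct} (h : Step Q α Q₀) :
    Step (PiProc.shift 1 Q) α.under (PiProc.ren (upName α.bn (· + 1)) Q₀) := by
  rw [PiAct.under_eq_ren]
  exact h.ren _

/-! ### Structural congruence in the pi-calculus -/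

/-- Structural congruence of pi-processes, without rules for prefixes: it mirrors what `HO.Cong`
does to an encoding outside its prefixes. -/
inductive SC : PiProc → PiProc → Prop
  | refl (P : PiProc) : SC P P
  | symm {P Q : PiProc} : SC P Q → SC Q P
  | trans {P Q R : PiProc} : SC P Q → SC Q R → SC P R
  | parNil (P : PiProc) : SC (par P nil) P
  | parComm (P Q : PiProc) : SC (par P Q) (par Q P)
  | parAssoc (P Q R : PiProc) : SC (par (par P Q) R) (par P (par Q R))
  | nuComm (P : PiProc) : SC (nu (nu P)) (nu (nu (ren (rotName 1) P)))
  | nuPar (P Q : PiProc) : SC (nu (par P (shift 1 Q))) (par (nu P) Q)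
  | par {P P' Q Q' : PiProc} : SC P P' → SC Q Q' → SC (par P Q) (par P' Q')
  | nu {P P' : PiProc} : SC P P' → SC (nu P) (nu P')

theorem SC.ren {P Q : PiProc} (h : SC P Q) (ρ : ℕ → ℕ) : SC (PiProc.ren ρ P) (PiProc.ren ρ Q) := by
  induction h generalizing ρ with
  | refl P => exact .refl _
  | symm _ ih => exact (ih ρ).symm
  | trans _ _ ih ih' => exact (ih ρ).trans (ih' ρ)
  | parNil P => exact .parNil _
  | parComm P Q => exact .parComm _ _
  | parAssoc P Q R => exact .parAssoc _ _ _
  | nuComm P =>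
    have := SC.nuComm (PiProc.ren (upName 1 (upName 1 ρ)) P)
    simpa [PiProc.ren, ren_ren, HO.rotName_one_upName] using this
  | nuPar P Q =>
    simp only [PiProc.ren]
    rw [ren_shift_comm (l := 1) (τ := ρ) Q (by simp [upName])]
    exact .nuPar _ _
  | par _ _ ih ih' => exact .par (ih ρ) (ih' ρ)
  | nu _ ih => exact .nu (ih _)

theorem SC.parL {P P' : PiProc} (Q : PiProc) (h : SC P P') :
    SC (PiProc.par P Q) (PiProc.par P' Q) :=
  h.par (.refl Q)

/-- Scope extrusion from the right component. -/
theorem SC.parNu (P Q : PiProc) :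
    SC (PiProc.par P (PiProc.nu Q)) (PiProc.nu (PiProc.par (shift 1 P) Q)) :=
  (SC.parComm _ _).trans ((SC.nuPar _ _).symm.trans (.nu (.parComm _ _)))

/-- Every transition of `P` is matched by one of `Q`, up to structural congruence. -/
def StepSim (P Q : PiProc) : Prop := ∀ α P', Step P α P' → ∃ Q', Step Q α Q' ∧ SC P' Q'

theorem StepSim.trans {P Q R : PiProc} (h : StepSim P Q) (h' : StepSim Q R) : StepSim P R := by
  intro α P' hP
  obtain ⟨Q', hQ, c⟩ := h α P' hP
  obtain ⟨R', hR, c'⟩ := h' α Q' hQ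
  exact ⟨R', hR, c.trans c'⟩

theorem StepSim.nu {P Q : PiProc} (h : StepSim P Q) : StepSim (nu P) (nu Q) := by
  intro α P' hP
  cases hP with
  | res hP =>
    obtain ⟨Q', hQ, c⟩ := h _ _ hP
    exact ⟨_, .res hQ, .nu (c.ren _)⟩
  | opn hP =>
    obtain ⟨Q', hQ, c⟩ := h _ _ hP
    exact ⟨_, .opn hQ, c⟩

theorem StepSim.parL {P Q : PiProc} (R : PiProc) (hc : SC P Q) (h : StepSim P Q)
    (hs : StepSim (shift 1 P) (shift 1 Q)) : StepSim (par P R) (par Q R) := by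
  intro α P' hP
  cases hP with
  | parL _ hP =>
    obtain ⟨Q', hQ, c⟩ := h _ _ hP
    exact ⟨_, .parL _ hQ, c.parL _⟩
  | parR _ hR => exact ⟨_, .parR _ hR, (hc.ren _).parL _⟩
  | comL hP hR =>
    obtain ⟨Q', hQ, c⟩ := h _ _ hP
    exact ⟨_, .comL hQ hR, c.parL _⟩
  | comR hP hR =>
    obtain ⟨Q', hQ, c⟩ := h _ _ hP
    exact ⟨_, .comR hQ hR, c.parL _⟩
  | closeL hP hR =>
    obtain ⟨Q', hQ, c⟩ := hs _ _ hP
    exact ⟨_, .closeL hQ hR, .nu (c.parL _)⟩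
  | closeR hP hR =>
    obtain ⟨Q', hQ, c⟩ := h _ _ hP
    exact ⟨_, .closeR hQ hR, .nu (c.parL _)⟩

theorem stepSim_parNil (P : PiProc) : StepSim (par P nil) P := by
  intro α P' h
  cases h with
  | parL _ h => exact ⟨_, h, .parNil _⟩
  | parR _ h => cases h
  | comL _ h => cases h
  | comR _ h => cases h
  | closeL _ h => cases h
  | closeR _ h => cases h

theorem stepSim_parNil' (P : PiProc) : StepSim P (par P nil) := fun _ _ h =>
  ⟨_, .parL _ h, (SC.parNil _).symm⟩

theorem stepSim_parComm (P Q : PiProc) : StepSim (par P Q) (par Q P) := by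
  intro α P' h
  cases h with
  | parL _ h => exact ⟨_, .parR _ h, .parComm _ _⟩
  | parR _ h => exact ⟨_, .parL _ h, .parComm _ _⟩
  | comL h h' => exact ⟨_, .comR h' h, .parComm _ _⟩
  | comR h h' => exact ⟨_, .comL h' h, .parComm _ _⟩
  | closeL h h' => exact ⟨_, .closeR h' h, .nu (.parComm _ _)⟩
  | closeR h h' => exact ⟨_, .closeL h' h, .nu (.parComm _ _)⟩

theorem stepSim_parAssoc (P Q R : PiProc) : StepSim (par (par P Q) R) (par P (par Q R)) := by
  intro α X h
  cases h with
  | parL _ h =>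
    cases h with
    | parL _ h => exact ⟨_, .parL _ h, .parAssoc _ _ _⟩
    | parR _ h => exact ⟨_, .parR _ (.parL _ h), .parAssoc _ _ _⟩
    | comL h h' => exact ⟨_, .comL h (.parL _ h'), .parAssoc _ _ _⟩
    | comR h h' => exact ⟨_, .comR h (.parL _ h'), .parAssoc _ _ _⟩
    | closeL h h' =>
      refine ⟨_, .closeL h (.parL _ h'), (SC.nuPar _ _).symm.trans (.nu ?_)⟩
      simp only [PiAct.bn, shift_zero]
      exact .parAssoc _ _ _
    | closeR h h' =>
      refine ⟨_, .closeR h (.parL _ h'), (SC.nuPar _ _).symm.trans (.nu ?_)⟩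
      simp only [PiAct.bn, shift_zero]
      exact .parAssoc _ _ _
  | parR _ h => exact ⟨_, .parR _ (.parR _ h), .parAssoc _ _ _⟩
  | comL h h' =>
    cases h with
    | parL _ h => exact ⟨_, .comL h (.parR _ h'), .parAssoc _ _ _⟩
    | parR _ h => exact ⟨_, .parR _ (.comL h h'), .parAssoc _ _ _⟩
  | comR h h' =>
    cases h with
    | parL _ h => exact ⟨_, .comR h (.parR _ h'), .parAssoc _ _ _⟩
    | parR _ h => exact ⟨_, .parR _ (.comR h h'), .parAssoc _ _ _⟩
  | closeL h h' =>
    change Step (par (shift 1 P) (shift 1 Q)) _ _ at h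
    cases h with
    | parL _ h =>
      refine ⟨_, .closeL h (.parR _ h'), .nu ?_⟩
      simp only [PiAct.bn, shift_zero]
      exact .parAssoc _ _ _
    | parR _ h =>
      refine ⟨_, .parR _ (.closeL h h'), ?_⟩
      simp only [PiAct.bn, shift_zero]
      exact .trans (.nu (.parAssoc _ _ _)) (SC.parNu _ _).symm
  | closeR h h' =>
    cases h with
    | parL _ h =>
      refine ⟨_, .closeR h (.parR (shift 1 Q) h'), .nu ?_⟩
      simp only [PiAct.bn, shift_zero]
      exact .parAssoc _ _ _
    | parR _ h =>
      refine ⟨_, .parR _ (.closeR h h'), ?_⟩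
      simp only [PiAct.bn, shift_zero]
      exact .trans (.nu (.parAssoc _ _ _)) (SC.parNu _ _).symm

theorem stepSim_nuComm (P : PiProc) : StepSim (nu (nu P)) (nu (nu (ren (rotName 1) P))) := by
  intro α X h
  cases h with
  | res h =>
    generalize hβ : α.under = β at h
    cases h with
    | @res _ P' _ h =>
      subst hβ
      have h1 := h.ren (rotName 1)
      rw [show α.under.under.ren (rotName 1) = α.under.under by cases α <;> rfl] at h1
      refine ⟨_, .res (.res h1), ?_⟩
      simp only [ren, ren_ren, PiAct.bn_under]
      refine (SC.nuComm _).trans ?_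
      rw [ren_ren]
      have : (fun i => rotName 1 (upName 1 (rotName α.bn) (rotName α.bn i))) =
          fun i => upName 1 (rotName α.bn) (rotName α.bn (upName α.bn (rotName 1) i)) := by
        generalize α.bn = k
        funext i
        obtain h | rfl | rfl | ⟨j, rfl⟩ : i < k ∨ i = k ∨ i = k + 1 ∨ ∃ j, i = k + 2 + j := by
          by_cases h : k + 2 ≤ i
          · exact .inr (.inr (.inr ⟨i - (k + 2), by omega⟩))
          · omega
        · simp [rotName, upName, h]
        · simp [rotName, upName]
        · simp [rotName, upName]
        · have e : k + 2 + j - k = 2 + j := by omega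
          simp [rotName, upName, e]
          grind
      simp only [this]
      exact .refl _
    | opn h =>
      cases α <;> simp only [PiAct.under, PiAct.bout.injEq, reduceCtorEq] at hβ
      subst hβ
      have h1 := h.ren (rotName 1)
      simp only [PiAct.ren, PiAct.bn, upName_zero] at h1
      refine ⟨_, .opn (.res (α := .out _ 0) (by simpa [PiAct.under, rotName] using h1)), ?_⟩
      simp only [PiAct.bn, ren_rotName_zero]
      exact .refl _
  | @opn _ _ a h =>
    cases h with
    | res h =>
      have h1 := h.ren (rotName 1)
      simp only [PiAct.ren, PiAct.under, PiAct.bn, upName_zero] at h1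
      refine ⟨_, .res (.opn (a := a + 1) (by simpa [rotName] using h1)), ?_⟩
      simp only [PiAct.bn, ren_rotName_zero, ren_ren, HO.rotName_one_rotName_one, ren_id]
      exact .refl _

theorem rotName_upName_succ (k i : ℕ) : rotName k (upName k (· + 1) i) = i + 1 := by
  simp only [rotName, upName]
  grind

theorem ren_rotName_shift (P : PiProc) (k : ℕ) :
    ren (rotName k) (shift k P) = ren (upName 1 (· + k)) P := by
  rw [shift, ren_ren]
  congr 1
  funext i
  simp only [rotName, upName]
  grind

theorem ren_rotName_shift_shift (P : PiProc) (k : ℕ) :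
    ren (rotName k) (shift k (shift 1 P)) = shift 1 (shift k P) := by
  simp only [shift, ren_ren]
  congr 1
  funext i
  simp only [rotName]
  grind

/-- Exchanging the two new names of an input of the second one. -/
theorem Step.swap_shift {P P' : PiProc} {a : ℕ} (h : Step (PiProc.shift 1 P) (.inp (a + 2) 0) P') :
    Step (PiProc.ren (upName 1 (· + 1)) P) (.inp (a + 2) 1) (PiProc.ren (rotName 1) P') := by
  have h1 := h.ren (rotName 1)
  simp only [PiAct.ren, PiAct.bn, upName_zero] at h1
  rwa [ren_rotName_shift] at h1

theorem Step.swap_shift' {P P' : PiProc} {a : ℕ}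
    (h : Step (PiProc.ren (upName 1 (· + 1)) P) (.inp (a + 2) 1) P') :
    Step (PiProc.shift 1 P) (.inp (a + 2) 0) (PiProc.ren (rotName 1) P') := by
  have h1 := h.ren (rotName 1)
  simp only [PiAct.ren, PiAct.bn, upName_zero] at h1
  rwa [← ren_rotName_shift, ren_ren, ren_eq_self _ HO.rotName_one_rotName_one] at h1

theorem stepSim_nuPar (P Q : PiProc) : StepSim (nu (par P (shift 1 Q))) (par (nu P) Q) := by
  -- names known to a shifted process are successors
  have hpos : ∀ {Q' : PiProc} {α : PiAct} {i : ℕ}, Step (shift 1 Q) α Q' → i ∈ α.known →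
      ∃ j, i = j + 1 := by
    intro Q' α i h hi
    rcases i with _ | i
    · exact absurd (h.known_subset hi) (zero_notMem_fn_shift _)
    · exact ⟨i, rfl⟩
  intro α X h
  cases h with
  | res h =>
    generalize hβ : α.under = β at h
    cases h with
    | parL _ h =>
      subst hβ
      refine ⟨_, .parL _ (.res h), ?_⟩
      simp only [ren, PiAct.bn_under]
      rw [ren_rotName_shift_shift]
      exact .nuPar _ _
    | parR _ h =>
      subst hβ
      obtain ⟨Q₀, h0, rfl⟩ := h.of_shift
      refine ⟨_, .parR _ h0, ?_⟩
      simp only [ren, PiAct.bn_under, ren_ren, rotName_upName_succ, ren_rotName_shift]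
      exact .nuPar _ _
    | comL h h' =>
      cases α <;> simp only [PiAct.under, reduceCtorEq] at hβ
      obtain ⟨a, rfl⟩ := hpos h' (.inl rfl)
      obtain ⟨b, rfl⟩ := hpos h' (.inr rfl)
      obtain ⟨Q₀, h0, rfl⟩ := h'.of_shift (α := .out a b)
      refine ⟨_, .comL (.res (α := .inp a b) h) h0, ?_⟩
      simp only [PiAct.bn, ren_rotName_zero, upName_zero]
      exact .nuPar _ _
    | @comR _ _ _ _ _ b h h' =>
      cases α <;> simp only [PiAct.under, reduceCtorEq] at hβ
      obtain ⟨a, rfl⟩ := hpos h' rfl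
      simp only [PiAct.bn, ren_rotName_zero]
      rcases b with _ | b
      · exact ⟨_, .closeR (.opn h) h', .refl _⟩
      · obtain ⟨Q₀, h0, rfl⟩ := h'.of_shift (α := .inp a b)
        refine ⟨_, .comR (.res (α := .out a b) h) h0, ?_⟩
        simp only [PiAct.bn, ren_rotName_zero, upName_zero]
        exact .nuPar _ _
    | closeL h h' =>
      cases α <;> simp only [PiAct.under, reduceCtorEq] at hβ
      obtain ⟨a, rfl⟩ := hpos h' rfl
      obtain ⟨Q₀, h0, rfl⟩ := h'.of_shift (α := .bout a)
      refine ⟨_, .closeL (P := nu P) (.res (α := .inp (a + 1) 0) h.swap_shift) h0, ?_⟩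
      simp only [PiAct.bn, ren_rotName_zero]
      refine (SC.nuComm _).trans (.nu ?_)
      simp only [ren, ren_ren, rotName_upName_succ]
      exact .nuPar _ _
    | closeR h h' =>
      cases α <;> simp only [PiAct.under, reduceCtorEq] at hβ
      rename_i P' Q' a
      have ha : a ≠ 0 := by
        rintro rfl
        have := h'.known_subset rfl
        simp [shift, mem_fn_ren] at this
      obtain ⟨a, rfl⟩ := Nat.exists_eq_succ_of_ne_zero ha
      have h1 := h'.ren (rotName 1)
      rw [ren_rotName_shift_shift] at h1
      obtain ⟨Q₀, h0, hQ₀⟩ := h1.of_shift (α := .inp (a + 1) 0)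
      refine ⟨_, .closeR (.res (α := .bout a) h) h0, ?_⟩
      simp only [PiAct.bn, upName_zero, ren_rotName_zero] at hQ₀ ⊢
      refine (SC.nuComm _).trans (.nu ?_)
      simp only [ren, hQ₀]
      exact .nuPar _ _
  | opn h =>
    cases h with
    | parL _ h =>
      refine ⟨_, .parL _ (.opn h), ?_⟩
      simp only [PiAct.bn, shift_zero]
      exact .refl _
    | parR _ h =>
      obtain ⟨j, hj⟩ := hpos h (.inr rfl)
      omega

theorem stepSim_nuPar' (P Q : PiProc) : StepSim (par (nu P) Q) (nu (par P (shift 1 Q))) := by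
  intro α X h
  cases h with
  | parL _ h =>
    cases h with
    | res h =>
      refine ⟨_, .res (.parL _ h), ?_⟩
      simp only [ren, PiAct.bn_under]
      rw [ren_rotName_shift_shift]
      exact (SC.nuPar _ _).symm
    | opn h =>
      refine ⟨_, .opn (.parL _ h), ?_⟩
      simp only [PiAct.bn, shift_zero]
      exact .refl _
  | parR _ h =>
    refine ⟨_, .res (.parR _ h.shift), ?_⟩
    simp only [ren, PiAct.bn_under, ren_ren, rotName_upName_succ, ren_rotName_shift]
    exact (SC.nuPar _ _).symm
  | comL h h' =>
    cases h with
    | res h =>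
      refine ⟨_, .res (α := .tau) (.comL h h'.shift), ?_⟩
      simp only [PiAct.bn, ren_rotName_zero, upName_zero]
      exact (SC.nuPar _ _).symm
  | comR h h' =>
    cases h with
    | res h =>
      refine ⟨_, .res (α := .tau) (.comR h h'.shift), ?_⟩
      simp only [PiAct.bn, ren_rotName_zero, upName_zero]
      exact (SC.nuPar _ _).symm
  | closeL h h' =>
    change Step (nu (ren (upName 1 (· + 1)) P)) _ _ at h
    cases h with
    | res h =>
      refine ⟨_, .res (α := .tau) (.closeL (Step.swap_shift' h) h'.shift), ?_⟩
      simp only [PiAct.bn, ren_rotName_zero]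
      refine .symm ((SC.nuComm _).trans (.nu ?_))
      simp only [ren, ren_ren, rotName_upName_succ, HO.rotName_one_rotName_one, ren_id]
      exact .nuPar _ _
  | closeR h h' =>
    cases h with
    | res h =>
      have h1 := h'.shift.ren (rotName 1)
      rw [ren_rotName_shift_shift, PiAct.bn_under] at h1
      simp only [PiAct.bn, upName_zero] at h1
      refine ⟨_, .res (α := .tau) (.closeR h h1), ?_⟩
      simp only [PiAct.bn, ren_rotName_zero]
      refine .symm ((SC.nuComm _).trans (.nu ?_))
      simp only [ren, ren_ren, HO.rotName_one_rotName_one]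
      exact .nuPar _ _
    | opn h => exact ⟨_, .res (α := .tau) (.comR h h'), by
        simp only [PiAct.bn, ren_rotName_zero]; exact .refl _⟩

theorem stepSim_parAssoc' (P Q R : PiProc) : StepSim (par P (par Q R)) (par (par P Q) R) := by
  have comm : ∀ P Q R : PiProc, StepSim (par (par P Q) R) (par (par Q P) R) := fun P Q R =>
    (stepSim_parComm P Q).parL R (.parComm _ _) (stepSim_parComm (shift 1 P) (shift 1 Q))
  exact (stepSim_parComm _ _).trans <| (comm _ _ _).trans <| (stepSim_parAssoc _ _ _).trans <|
    (stepSim_parComm _ _).trans (comm _ _ _)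

/-- Structurally congruent processes have the same transitions.  The claim is made for all
renamings, because a receiver of an extruded name acts as a shift of itself. -/
theorem SC.stepSim_ren {P Q : PiProc} (h : SC P Q) (ρ : ℕ → ℕ) :
    StepSim (PiProc.ren ρ P) (PiProc.ren ρ Q) ∧ StepSim (PiProc.ren ρ Q) (PiProc.ren ρ P) := by
  have par : ∀ {P P' : PiProc}, SC P P' → (∀ ρ, StepSim (PiProc.ren ρ P) (PiProc.ren ρ P')) →
      ∀ (R : PiProc) (ρ : ℕ → ℕ), StepSim (.par (PiProc.ren ρ P) R) (.par (PiProc.ren ρ P') R) :=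
    fun {P P'} c h R ρ => (h ρ).parL R (c.ren ρ) (by simpa only [shift, ren_ren] using h _)
  induction h generalizing ρ with
  | refl P => exact ⟨fun _ _ h => ⟨_, h, .refl _⟩, fun _ _ h => ⟨_, h, .refl _⟩⟩
  | symm _ ih => exact (ih ρ).symm
  | trans _ _ ih ih' => exact ⟨(ih ρ).1.trans (ih' ρ).1, (ih' ρ).2.trans (ih ρ).2⟩
  | parNil P => exact ⟨stepSim_parNil _, stepSim_parNil' _⟩
  | parComm P Q => exact ⟨stepSim_parComm _ _, stepSim_parComm _ _⟩
  | parAssoc P Q R => exact ⟨stepSim_parAssoc _ _ _, stepSim_parAssoc' _ _ _⟩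
  | nuComm P =>
    have h := stepSim_nuComm (PiProc.ren (upName 1 (upName 1 ρ)) P)
    have h' := stepSim_nuComm (PiProc.ren (rotName 1) (PiProc.ren (upName 1 (upName 1 ρ)) P))
    constructor
    · simpa [PiProc.ren, ren_ren, HO.rotName_one_upName] using h
    · simpa [PiProc.ren, ren_ren, HO.rotName_one_rotName_one, HO.rotName_one_upName] using h'
  | nuPar P Q =>
    simp only [PiProc.ren]
    rw [ren_shift_comm (l := 1) (τ := ρ) Q (by simp [upName])]
    exact ⟨stepSim_nuPar _ _, stepSim_nuPar' _ _⟩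
  | par c c' ih ih' =>
    constructor
    · exact (par c (fun ρ => (ih ρ).1) _ ρ).trans <| (stepSim_parComm _ _).trans <|
        (par c' (fun ρ => (ih' ρ).1) _ ρ).trans (stepSim_parComm _ _)
    · exact (par c.symm (fun ρ => (ih ρ).2) _ ρ).trans <| (stepSim_parComm _ _).trans <|
        (par c'.symm (fun ρ => (ih' ρ).2) _ ρ).trans (stepSim_parComm _ _)
  | nu _ ih => exact ⟨(ih _).1.nu, (ih _).2.nu⟩

theorem SC.stepSim {P Q : PiProc} (h : SC P Q) : StepSim P Q := by
  simpa only [ren_id] using (h.stepSim_ren fun i => i).1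

/-! ### Ground bisimilarity is preserved by parallel composition and restriction -/

theorem Taus.single {P Q : PiProc} (h : Step P .tau Q) : Taus P Q := Relation.ReflTransGen.single h

theorem Taus.trans {P Q R : PiProc} (h : Taus P Q) (h' : Taus Q R) : Taus P R :=
  Relation.ReflTransGen.trans h h'

theorem Taus.map {f : PiProc → PiProc} (hf : ∀ {P Q}, Step P .tau Q → Step (f P) .tau (f Q))
    {P Q : PiProc} (h : Taus P Q) : Taus (f P) (f Q) :=
  Relation.ReflTransGen.lift f (fun _ _ h => hf h) _ _ h

theorem Taus.ren {P Q : PiProc} (h : Taus P Q) (ρ : ℕ → ℕ) :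
    Taus (PiProc.ren ρ P) (PiProc.ren ρ Q) :=
  h.map fun h => by simpa only [PiAct.ren, PiAct.bn, upName_zero] using h.ren ρ

theorem Taus.parL {P Q : PiProc} (h : Taus P Q) (R : PiProc) : Taus (par P R) (par Q R) :=
  h.map (f := fun P => PiProc.par P R)
    fun h => by simpa only [PiAct.bn, shift_zero] using h.parL R

theorem Taus.nu {P Q : PiProc} (h : Taus P Q) : Taus (nu P) (nu Q) :=
  h.map fun h => by
    simpa only [PiAct.bn, ren_rotName_zero] using Step.res (α := .tau) h

theorem Taus.of_shift {P X : PiProc} (h : Taus (shift 1 P) X) :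
    ∃ Q, X = shift 1 Q ∧ Taus P Q := by
  induction h with
  | refl => exact ⟨P, rfl, .refl⟩
  | tail _ h ih =>
    obtain ⟨Q, rfl, hQ⟩ := ih
    obtain ⟨Q', h', rfl⟩ := h.of_shift (α := .tau)
    exact ⟨Q', by simp only [PiAct.bn, upName_zero]; rfl, hQ.trans (.single h')⟩

theorem Weak.weakHat {P Q : PiProc} {α : PiAct} (h : Weak P α Q) : WeakHat P α Q := by
  by_cases hα : α = .tau
  · subst hα
    obtain ⟨P₁, P₂, h₁, h, h₂⟩ := h
    exact .inl ⟨rfl, h₁.trans ((Taus.single h).trans h₂)⟩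
  · exact .inr ⟨hα, h⟩

theorem Step.weakHat {P Q : PiProc} {α : PiAct} (h : Step P α Q) : WeakHat P α Q :=
  Weak.weakHat ⟨P, Q, .refl, h, .refl⟩

theorem WeakHat.taus {P Q : PiProc} (h : WeakHat P .tau Q) : Taus P Q :=
  h.elim (·.2) fun h => absurd rfl h.1

theorem WeakHat.weak {P Q : PiProc} {α : PiAct} (h : WeakHat P α Q) (hα : α ≠ .tau) :
    Weak P α Q :=
  h.elim (fun h => absurd h.1 hα) (·.2)

/-- Weak transitions are preserved by maps that preserve transitions. -/
theorem WeakHat.map {f g : PiProc → PiProc} {α β : PiAct} (hαβ : α = .tau ↔ β = .tau)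
    (hf : ∀ {P Q}, Taus P Q → Taus (f P) (f Q)) (hg : ∀ {P Q}, Taus P Q → Taus (g P) (g Q))
    (hfg : α = .tau → f = g) (hs : ∀ {P Q}, Step P α Q → Step (f P) β (g Q)) {P Q : PiProc}
    (h : WeakHat P α Q) : WeakHat (f P) β (g Q) := by
  rcases h with ⟨hα, h⟩ | ⟨hα, P₁, P₂, h₁, h, h₂⟩
  · exact .inl ⟨hαβ.1 hα, hfg hα ▸ hf h⟩
  · exact .inr ⟨fun h => hα (hαβ.2 h), _, _, hf h₁, hs h, hg h₂⟩

theorem WeakHat.ren {P Q : PiProc} {α : PiAct} (h : WeakHat P α Q) (ρ : ℕ → ℕ) :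
    WeakHat (PiProc.ren ρ P) (α.ren ρ) (PiProc.ren (upName α.bn ρ) Q) :=
  h.map (by cases α <;> simp [PiAct.ren]) (·.ren _) (·.ren _)
    (by rintro rfl; simp only [PiAct.bn, upName_zero]) (·.ren ρ)

theorem WeakHat.parL {P Q : PiProc} {α : PiAct} (h : WeakHat P α Q) (R : PiProc) :
    WeakHat (par P R) α (par Q (R.shift α.bn)) :=
  h.map (f := fun P => PiProc.par P R) (g := fun Q => PiProc.par Q (R.shift α.bn)) Iff.rfl
    (·.parL _) (·.parL _) (by rintro rfl; simp [PiAct.bn]) (·.parL R)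

theorem WeakHat.res {P Q : PiProc} {α : PiAct} (h : WeakHat P α.under Q) :
    WeakHat (PiProc.nu P) α (PiProc.nu (Q.ren (rotName α.bn))) :=
  h.map (g := fun Q => PiProc.nu (Q.ren (rotName α.bn))) (by cases α <;> simp [PiAct.under])
    (·.nu) (fun h => (h.ren _).nu)
    (by cases α <;> simp [PiAct.under, PiAct.bn, ren_rotName_zero]) (.res ·)

theorem GroundBisim.symm {P Q : PiProc} : GroundBisim P Q → GroundBisim Q P :=
  fun ⟨R, hR, h⟩ => ⟨R, hR, hR.1 _ _ h⟩

theorem GroundBisim.step {P Q P' : PiProc} {α : PiAct} (h : GroundBisim P Q) (hP : Step P α P') :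
    ∃ Q', WeakHat Q α Q' ∧ GroundBisim P' Q' := by
  obtain ⟨R, hR, h⟩ := h
  obtain ⟨Q', hQ, h'⟩ := hR.2 _ _ h _ _ hP
  exact ⟨Q', hQ, R, hR, h'⟩

/-- A permutation of the names under `k` binders. -/
def upPerm (k : ℕ) (ρ : Equiv.Perm ℕ) : Equiv.Perm ℕ where
  toFun := upName k ρ
  invFun := upName k ρ.symm
  left_inv i := by rw [← congrFun (upName_comp k ρ.symm ρ) i]; simp [upName_id]
  right_inv i := by rw [← congrFun (upName_comp k ρ ρ.symm) i]; simp [upName_id]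

/-- `rotName N` as a permutation. -/
def rotPerm (N : ℕ) : Equiv.Perm ℕ where
  toFun := rotName N
  invFun i := if i = 0 then N else if i ≤ N then i - 1 else i
  left_inv i := by simp only [rotName]; grind
  right_inv i := by simp only [rotName]; grind

/-- Ground bisimilarity is preserved by permutations of the names. -/
theorem GroundBisim.ren {P Q : PiProc} (h : GroundBisim P Q) (ρ : Equiv.Perm ℕ) :
    GroundBisim (PiProc.ren ρ P) (PiProc.ren ρ Q) := by
  refine ⟨fun X Y => ∃ (ρ : Equiv.Perm ℕ) (P Q : PiProc), X = PiProc.ren ρ P ∧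
    Y = PiProc.ren ρ Q ∧ GroundBisim P Q, ⟨?_, ?_⟩, ρ, P, Q, rfl, rfl, h⟩
  · rintro _ _ ⟨ρ, P, Q, rfl, rfl, h⟩
    exact ⟨ρ, Q, P, rfl, rfl, h.symm⟩
  · rintro _ _ ⟨ρ, P, Q, rfl, rfl, h⟩ α X hX
    have hP := hX.ren ρ.symm
    rw [ren_ren, ren_eq_self _ (by simp)] at hP
    obtain ⟨Q', hQ, h'⟩ := h.step hP
    have hQ := hQ.ren ρ
    rw [PiAct.ren_ren, PiAct.ren_eq_self (by simp), PiAct.bn_ren] at hQ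
    refine ⟨_, hQ, upPerm α.bn ρ, _, _, ?_, rfl, h'⟩
    rw [ren_ren, ren_eq_self]
    exact (upPerm α.bn ρ).right_inv

/-- On two given processes a shift is a permutation of the names. -/
theorem exists_shift_eq (P Q : PiProc) : ∃ ρ : Equiv.Perm ℕ,
    shift 1 P = PiProc.ren ρ P ∧ shift 1 Q = PiProc.ren ρ Q := by
  obtain ⟨M, hM⟩ := exists_fn_lt P
  obtain ⟨N, hN⟩ := exists_fn_lt Q
  refine ⟨rotPerm (M + N), ren_congr _ fun i hi => ?_, ren_congr _ fun i hi => ?_⟩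
  · have := hM i hi
    simp [rotPerm, rotName, show i < M + N by omega]
  · have := hN i hi
    simp [rotPerm, rotName, show i < M + N by omega]

/-- The closure of ground bisimilarity under parallel composition and restriction. -/
inductive BisimCtx : PiProc → PiProc → Prop
  | base {P Q : PiProc} : GroundBisim P Q → BisimCtx P Q
  | par {P Q : PiProc} (R : PiProc) : BisimCtx P Q → BisimCtx (par P R) (par Q R)
  | nu {P Q : PiProc} : BisimCtx P Q → BisimCtx (nu P) (nu Q)

namespace BisimCtx

theorem symm {P Q : PiProc} (h : BisimCtx P Q) : BisimCtx Q P := by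
  induction h with
  | base h => exact .base h.symm
  | par R _ ih => exact .par R ih
  | nu _ ih => exact .nu ih

theorem ren {P Q : PiProc} (h : BisimCtx P Q) (ρ : Equiv.Perm ℕ) :
    BisimCtx (PiProc.ren ρ P) (PiProc.ren ρ Q) := by
  induction h generalizing ρ with
  | base h => exact .base (h.ren ρ)
  | par R _ ih => exact .par _ (ih ρ)
  | nu _ ih => exact .nu (ih (upPerm 1 ρ))

theorem shift_bn {P Q : PiProc} (h : BisimCtx P Q) (α : PiAct) :
    BisimCtx (shift α.bn P) (shift α.bn Q) := by
  have h1 : BisimCtx (shift 1 P) (shift 1 Q) := by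
    obtain ⟨ρ, hP, hQ⟩ := exists_shift_eq P Q
    rw [hP, hQ]
    exact h.ren ρ
  cases α <;> simpa [PiAct.bn]

/-- The transitions of `P` are matched by weak transitions of `Q`, up to `BisimCtx`. -/
def WSim (P Q : PiProc) : Prop := ∀ α P', Step P α P' → ∃ Q', WeakHat Q α Q' ∧ BisimCtx P' Q'

theorem wSim_par {P Q : PiProc} (R : PiProc) (hc : BisimCtx P Q)
    (h : WSim P Q) (hs : WSim (shift 1 P) (shift 1 Q)) : WSim (.par P R) (.par Q R) := by
  intro α P' hP
  cases hP with
  | parL _ hP =>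
    obtain ⟨Q', hQ, c⟩ := h _ _ hP
    exact ⟨_, hQ.parL R, c.par _⟩
  | parR _ hR => exact ⟨_, (hR.parR Q).weakHat, (hc.shift_bn α).par _⟩
  | comL hP hR =>
    obtain ⟨Q', hQ, c⟩ := h _ _ hP
    obtain ⟨Q₁, Q₂, h₁, hQ, h₂⟩ := hQ.weak (by simp)
    exact ⟨_, Weak.weakHat ⟨_, _, h₁.parL R, .comL hQ hR, h₂.parL _⟩, c.par _⟩
  | comR hP hR =>
    obtain ⟨Q', hQ, c⟩ := h _ _ hP
    obtain ⟨Q₁, Q₂, h₁, hQ, h₂⟩ := hQ.weak (by simp)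
    exact ⟨_, Weak.weakHat ⟨_, _, h₁.parL R, .comR hQ hR, h₂.parL _⟩, c.par _⟩
  | closeL hP hR =>
    obtain ⟨Q', hQ, c⟩ := hs _ _ hP
    obtain ⟨Q₁, Q₂, h₁, hQ, h₂⟩ := hQ.weak (by simp)
    obtain ⟨Q₁, rfl, h₁'⟩ := h₁.of_shift
    exact ⟨_, Weak.weakHat ⟨_, _, h₁'.parL R, .closeL hQ hR, (h₂.parL _).nu⟩, (c.par _).nu⟩
  | closeR hP hR =>
    obtain ⟨Q', hQ, c⟩ := h _ _ hP
    obtain ⟨Q₁, Q₂, h₁, hQ, h₂⟩ := hQ.weak (by simp)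
    exact ⟨_, Weak.weakHat ⟨_, _, h₁.parL R, .closeR hQ hR, (h₂.parL _).nu⟩, (c.par _).nu⟩

theorem wSim_nu {P Q : PiProc} (h : WSim P Q) : WSim (.nu P) (.nu Q) := by
  have rot : ∀ {P Q : PiProc}, BisimCtx P Q → ∀ k,
      BisimCtx (PiProc.ren (rotName k) P) (PiProc.ren (rotName k) Q) :=
    fun c k => c.ren (rotPerm k)
  intro α P' hP
  cases hP with
  | res hP =>
    obtain ⟨Q', hQ, c⟩ := h _ _ hP
    exact ⟨_, hQ.res, (rot c _).nu⟩
  | opn hP =>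
    obtain ⟨Q', hQ, c⟩ := h _ _ hP
    obtain ⟨Q₁, Q₂, h₁, hQ, h₂⟩ := hQ.weak (by simp)
    exact ⟨_, Weak.weakHat ⟨_, _, h₁.nu, .opn hQ, h₂⟩, c⟩

/-- Processes related by `BisimCtx` simulate each other.  The permutation `ρ` is needed for the
receivers of an extruded name, which act as shifts of themselves. -/
theorem wSim_ren {P Q : PiProc} (h : BisimCtx P Q) (ρ : Equiv.Perm ℕ) :
    WSim (PiProc.ren ρ P) (PiProc.ren ρ Q) := by
  induction h generalizing ρ with
  | base h =>
    intro α P' hP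
    obtain ⟨Q', hQ, h'⟩ := (h.ren ρ).step hP
    exact ⟨Q', hQ, .base h'⟩
  | @par P Q R h ih =>
    refine wSim_par _ (h.ren ρ) (ih ρ) ?_
    obtain ⟨τ, hP, hQ⟩ := exists_shift_eq (PiProc.ren ρ P) (PiProc.ren ρ Q)
    rw [hP, hQ, ren_ren, ren_ren]
    exact ih (ρ.trans τ)
  | nu _ ih => exact wSim_nu (ih (upPerm 1 ρ))

theorem groundBisim {P Q : PiProc} (h : BisimCtx P Q) : GroundBisim P Q := by
  refine ⟨BisimCtx, ⟨fun _ _ => symm, fun P Q h α P' hP => ?_⟩, h⟩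
  have := h.wSim_ren (Equiv.refl ℕ) α P'
  rw [ren_eq_self P (ρ := Equiv.refl ℕ) fun _ => rfl,
    ren_eq_self Q (ρ := Equiv.refl ℕ) fun _ => rfl] at this
  exact this hP

end BisimCtx

theorem GroundBisim.par {P Q : PiProc} (h : GroundBisim P Q) (R : PiProc) :
    GroundBisim (par P R) (par Q R) := ((BisimCtx.base h).par R).groundBisim

theorem GroundBisim.nu {P Q : PiProc} (h : GroundBisim P Q) : GroundBisim (nu P) (nu Q) :=
  (BisimCtx.base h).nu.groundBisim

end PiProc

namespace HO

/-! ### Transitions up to structural congruence -/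

/-- Terms up to structural congruence. -/
def StructClass (d : ℕ) : Type :=
  Quotient (⟨Struct, Struct.refl, Struct.symm, Struct.trans⟩ : Setoid (HO d))

/-- The class of a term up to structural congruence. -/
def cls {d : ℕ} (T : HO d) : StructClass d := Quotient.mk _ T

theorem cls_eq_iff {d : ℕ} {T T' : HO d} : cls T = cls T' ↔ Struct T T' :=
  ⟨fun h => Quotient.exact h, fun h => Quotient.sound h⟩

theorem Struct.cls_eq {d : ℕ} {T T' : HO d} (h : Struct T T') : cls T = cls T' := cls_eq_iff.2 h

instance (d : ℕ) : Add (StructClass d) :=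
  ⟨Quotient.map₂ HO.par fun _ _ h _ _ h' => Struct.par h h'⟩

instance (d : ℕ) : Zero (StructClass d) := ⟨cls nil⟩

/-- Parallel composition makes the classes a commutative monoid. -/
instance (d : ℕ) : AddCommMonoid (StructClass d) where
  add_assoc a b c := Quotient.inductionOn₃ a b c fun T T' T'' => (Struct.parAssoc T T' T'').cls_eq
  zero_add a := Quotient.inductionOn a fun T =>
    ((Struct.parComm _ _).trans (Struct.parNil T)).cls_eq
  add_zero a := Quotient.inductionOn a fun T => (Struct.parNil T).cls_eq
  add_comm a b := Quotient.inductionOn₂ a b fun T T' => (Struct.parComm T T').cls_eq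
  nsmul := nsmulRec

theorem cls_par {d : ℕ} (T T' : HO d) : cls (par T T') = cls T + cls T' := rfl

theorem cls_nil {d : ℕ} : cls (nil : HO d) = 0 := rfl

theorem Struct.nus {d : ℕ} {T T' : HO d} (h : Struct T T') (k : ℕ) :
    Struct (HO.nus k T) (HO.nus k T') := by
  induction k with
  | zero => exact h
  | succ k ih => exact .nu ih

theorem nus_nus {d : ℕ} (m n : ℕ) (T : HO d) : nus m (nus n T) = nus (m + n) T := by
  induction m with
  | zero => simp [nus]
  | succ m ih => rw [Nat.add_right_comm, nus, nus, ih]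

theorem upName_upName_one (k : ℕ) (ρ : ℕ → ℕ) : upName k (upName 1 ρ) = upName (k + 1) ρ := by
  funext i
  simp only [upName]
  grind

theorem renN_nus {d : ℕ} (k : ℕ) (T : HO d) (ρ : ℕ → ℕ) :
    renN ρ (nus k T) = nus k (renN (upName k ρ) T) := by
  induction k generalizing ρ with
  | zero => simp [nus, upName_zero]
  | succ k ih => rw [nus, renN, ih, upName_upName_one, nus]

theorem struct_nus_par {d : ℕ} (k : ℕ) (T S : HO d) :
    Struct (nus k (par T (shift k S))) (par (nus k T) S) := by
  induction k generalizing S with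
  | zero => simpa [nus] using .refl _
  | succ k ih =>
    have h := ih (shift 1 S)
    rw [shift_shift, Nat.add_comm] at h
    exact (Struct.nu h).trans (.nuPar _ _)

theorem struct_par_nus {d : ℕ} (k : ℕ) (T S : HO d) :
    Struct (nus k (par (shift k T) S)) (par T (nus k S)) :=
  ((Struct.parComm _ _).nus k).trans ((struct_nus_par k S T).trans (.parComm _ _))

/-- Two prefixes of restrictions are merged. -/
theorem struct_nus_par_nus {d : ℕ} (m n : ℕ) (T S : HO d) :
    Struct (par (nus n T) (nus m S))
      (nus (n + m) (par (shift m T) (renN (upName m (· + n)) S))) := by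
  rw [← nus_nus]
  refine (struct_nus_par n T (nus m S)).symm.trans (.nus ?_ n)
  rw [shift, renN_nus]
  exact (struct_par_nus m _ _).symm

/-- A restriction is moved inwards. -/
theorem struct_nu_nus {d : ℕ} (k : ℕ) (T : HO d) :
    Struct (nu (nus k T)) (nus k (nu (renN (rotName k) T))) := by
  induction k generalizing T with
  | zero =>
    rw [renN_eq_self]
    · exact .refl _
    · intro i; simp only [rotName]; split_ifs <;> omega
  | succ k ih =>
    refine (Struct.nuComm _).trans (.nu ?_)
    rw [renN_nus]
    refine (ih _).trans (.nus ?_ k)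
    rw [renN_renN]
    have : (fun i => rotName k (upName k (rotName 1) i)) = rotName (k + 1) := by
      funext i
      simp only [rotName, upName]
      grind
    rw [this]
    exact .refl _

/-- `G` is a receiver on `u` with body `F`, and `C` is what remains of it after a reception. -/
inductive Recv (u : ℕ) (F : HO 1) : HO 0 → HO 0 → Prop
  | inp : Recv u F (inp u F) nil
  | repInp : Recv u F (repInp u F) (repInp u F)

/-- `H` is a sender of `A` on `u` that continues as `S`. -/
inductive Send (u : ℕ) (A : HO 0) : HO 0 → HO 0 → Prop
  | out (S : HO 0) : Send u A S (out u A S)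
  | repOut (S : HO 0) : Send u A (par S (repOut u A S)) (repOut u A S)

theorem Recv.renN {u : ℕ} {F : HO 1} {G C : HO 0} (h : Recv u F G C) (ρ : ℕ → ℕ) :
    Recv (ρ u) (HO.renN ρ F) (HO.renN ρ G) (HO.renN ρ C) := by
  cases h
  · exact .inp
  · exact .repInp

theorem Send.renN {u : ℕ} {A S H : HO 0} (h : Send u A S H) (ρ : ℕ → ℕ) :
    Send (ρ u) (HO.renN ρ A) (HO.renN ρ S) (HO.renN ρ H) := by
  cases h
  · exact .out _
  · exact .repOut _

/-- The form of a transition up to structural congruence: restrictions in front of the acting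
components and of a rest `R`.  In an output the `k` extruded names are outermost, and `n` is the
number of the restrictions that stay. -/
def Prenex (T : HO 0) : HOAct → HO 0 → Prop
  | .tau, T' => ∃ n u F G C A S H R, Recv u F G C ∧ Send u A S H ∧
      Struct T (nus n (par G (par H R))) ∧
      Struct T' (nus n (par (par (inst F A) C) (par S R)))
  | .inp a A, T' => ∃ n F G C R, Recv (a + n) F G C ∧ Struct T (nus n (par G R)) ∧
      Struct T' (nus n (par (par (inst F (shift n A)) C) R))
  | .out k a A, T' => ∃ n S H R, Send (a + k + n) (shift n A) S H ∧
      Struct T (nus k (nus n (par H R))) ∧ Struct T' (nus n (par S R))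

theorem renN_rotName_zero {d : ℕ} (T : HO d) : renN (rotName 0) T = T :=
  renN_eq_self T fun i => by simp only [rotName]; split_ifs <;> omega

/-- Every transition has a prenex form.  The rule `str` is absorbed, because the form is only
required up to structural congruence, which has the laws to move restrictions outwards. -/
theorem Step.prenex {T T' : HO 0} {α : HOAct} (h : Step T α T') : Prenex T α T' := by
  induction h with
  | inp a A T =>
    refine ⟨0, T, _, _, nil, .inp, (Struct.parNil _).symm, ?_⟩
    rw [shift_zero, ← cls_eq_iff]
    simp [nus, cls_par, cls_nil]
  | out a A T =>
    refine ⟨0, T, _, nil, ?_, (Struct.parNil _).symm, (Struct.parNil _).symm⟩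
    rw [shift_zero]
    exact .out T
  | repInp a A T =>
    refine ⟨0, T, _, _, nil, .repInp, (Struct.parNil _).symm, ?_⟩
    rw [shift_zero]
    exact (Struct.parNil _).symm
  | repOut a A T =>
    refine ⟨0, _, _, nil, ?_, (Struct.parNil _).symm, (Struct.parNil _).symm⟩
    rw [shift_zero]
    exact .repOut T
  | @res T T' α _ ih =>
    cases α with
    | tau =>
      obtain ⟨n, u, F, G, C, A, S, H, R, hG, hH, hT, hT'⟩ := ih
      refine ⟨n + 1, u, F, G, C, A, S, H, R, hG, hH, .nu hT, .nu ?_⟩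
      rwa [HOAct.bn, renN_rotName_zero]
      all_goals simp
    | inp a A =>
      obtain ⟨n, F, G, C, R, hG, hT, hT'⟩ := ih
      refine ⟨n + 1, F, G, C, R, ?_, .nu hT, .nu ?_⟩
      · rwa [Nat.add_comm n, ← Nat.add_assoc]
      · rw [shift_shift, Nat.add_comm] at hT'
        rwa [HOAct.bn, renN_rotName_zero]
        all_goals simp
    | out k a A =>
      obtain ⟨n, S, H, R, hH, hT, hT'⟩ := ih
      refine ⟨n + 1, HO.renN (upName n (rotName k)) S, HO.renN (upName n (rotName k)) H,
        HO.renN (upName n (rotName k)) R, ?_,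
        (Struct.nu hT).trans ((struct_nu_nus k _).trans (.nus ?_ k)), .nu ((hT'.renN _).trans ?_)⟩
      · have := hH.renN (upName n (rotName k))
        rw [renN_shift_comm (l := n) (τ := rotName k) _ (by simp [upName]), renN_renN] at this
        have e : (fun i => rotName k (skipName k i)) = (· + 1) := by
          funext i
          simp only [rotName, skipName]
          grind
        have e' : upName n (rotName k) (a + 1 + k + n) = a + k + (n + 1) := by
          simp only [rotName, upName]
          grind
        rw [e, e'] at this
        rw [Nat.add_comm n 1, ← shift_shift, Nat.add_comm 1 n]
        exact this
      · rw [renN_nus]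
        exact .refl _
      · rw [HOAct.bn, renN_nus]
        exact .refl _
  | @opn T T' A k a _ _ ih =>
    obtain ⟨n, S, H, R, hH, hT, hT'⟩ := ih
    refine ⟨n, S, H, R, ?_, .nu hT, hT'⟩
    rwa [Nat.add_comm k, ← Nat.add_assoc]
  | @par T T' α S _ ih =>
    cases α with
    | tau =>
      obtain ⟨n, u, F, G, C, A, S', H, R, hG, hH, hT, hT'⟩ := ih
      rw [show shift HOAct.tau.bn S = S from shift_zero S]
      refine ⟨n, u, F, G, C, A, S', H, HO.par R (shift n S), hG, hH,
        (hT.par (.refl _)).trans ((struct_nus_par n _ _).symm.trans (.nus ?_ n)),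
        (hT'.par (.refl _)).trans ((struct_nus_par n _ _).symm.trans (.nus ?_ n))⟩
      · rw [← cls_eq_iff]
        simp only [cls_par]
        abel
      · rw [← cls_eq_iff]
        simp only [cls_par]
        abel
    | inp a A =>
      obtain ⟨n, F, G, C, R, hG, hT, hT'⟩ := ih
      rw [show shift (HOAct.inp a A).bn S = S from shift_zero S]
      refine ⟨n, F, G, C, HO.par R (shift n S), hG,
        (hT.par (.refl _)).trans ((struct_nus_par n _ _).symm.trans (.nus ?_ n)),
        (hT'.par (.refl _)).trans ((struct_nus_par n _ _).symm.trans (.nus ?_ n))⟩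
      · exact .parAssoc _ _ _
      · exact .parAssoc _ _ _
    | out k a A =>
      obtain ⟨n, S', H, R, hH, hT, hT'⟩ := ih
      refine ⟨n, S', H, HO.par R (shift n (shift k S)), hH,
        (hT.par (.refl _)).trans ((struct_nus_par k _ _).symm.trans (.nus ?_ k)),
        (hT'.par (.refl _)).trans ((struct_nus_par n _ _).symm.trans (.nus ?_ n))⟩
      · exact (struct_nus_par n _ _).symm.trans (.nus (.parAssoc _ _ _) n)
      · exact .parAssoc _ _ _
  | @com T T' S S' A k a _ _ ih ih' =>
    obtain ⟨n, F, G, C, R, hG, hT, hT'⟩ := ih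
    obtain ⟨m, S₁, H, R', hH, hS, hS'⟩ := ih'
    have hG := hG.renN (· + m)
    have hH := hH.renN (upName m (· + n))
    have e : upName m (· + n) (a + k + m) = a + k + n + m := by simp [upName]
    have e' : HO.renN (upName m (· + n)) (shift m A) = shift m (shift n A) :=
      renN_shift_comm _ (by simp [upName])
    rw [e, e'] at hH
    refine ⟨k + (n + m), _, _, _, _, _, _, _,
      HO.par (shift m R) (HO.renN (upName m (· + n)) R'), hG, hH, ?_, ?_⟩
    · rw [← nus_nus]
      refine (Struct.par (.refl T) hS).trans ((struct_par_nus k T _).symm.trans (.nus ?_ k))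
      refine (Struct.par hT (.refl _)).trans ((struct_nus_par_nus _ _ _ _).trans (.nus ?_ _))
      rw [← cls_eq_iff]
      simp only [shift, HO.renN, cls_par]
      abel
    · rw [← nus_nus]
      refine .nus ((hT'.par hS').trans ((struct_nus_par_nus _ _ _ _).trans (.nus ?_ _))) k
      rw [← cls_eq_iff]
      simp only [shift, HO.renN, cls_par, renN_inst]
      abel
  | @str T T' S S' α hS _ hT ih =>
    cases α with
    | tau =>
      obtain ⟨n, u, F, G, C, A, S', H, R, hG, hH, hT₁, hT₂⟩ := ih
      exact ⟨n, u, F, G, C, A, S', H, R, hG, hH, hS.trans hT₁, hT.symm.trans hT₂⟩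
    | inp a A =>
      obtain ⟨n, F, G, C, R, hG, hT₁, hT₂⟩ := ih
      exact ⟨n, F, G, C, R, hG, hS.trans hT₁, hT.symm.trans hT₂⟩
    | out k a A =>
      obtain ⟨n, S', H, R, hH, hT₁, hT₂⟩ := ih
      exact ⟨n, S', H, R, hH, hS.trans hT₁, hT.symm.trans hT₂⟩

end HO

open HO

/-! ### The encoding -/

theorem renN_nameMsg {d : ℕ} (ρ : ℕ → ℕ) (n : ℕ) :
    renN ρ (nameMsg n : HO d) = nameMsg (ρ n) := rfl

theorem renN_encode (d : ℕ) (P : PiProc) (ρ : ℕ → ℕ) :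
    renN ρ (encode d P) = encode d (P.ren ρ) := by
  induction P generalizing d ρ <;> simp_all [encode, renN, PiProc.ren, renN_nameMsg]

theorem subst_encode {d e : ℕ} (P : PiProc) (σ : Fin d → HO e) :
    subst σ (encode d P) = encode e P := by
  have hl : ∀ {d e : ℕ} (σ : Fin d → HO e), upSub 1 σ (Fin.last d) = var (Fin.last e) :=
    fun σ => upSub_natAdd 1 σ 0
  induction P generalizing d e with
  | out m n P ih =>
    simp only [encode, subst, nameMsg, ih]
    rw [upSub_natAdd]
  | _ => simp_all [encode, subst]

theorem encode_injective (d : ℕ) {P Q : PiProc} (h : encode d P = encode d Q) : P = Q := by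
  induction P generalizing d Q with
  | nil => cases Q <;> simp [encode] at h ⊢
  | inp m P ih =>
    cases Q <;> simp [encode, funext_iff] at h ⊢
    exact ⟨h.1, ih _ h.2⟩
  | out m n P ih =>
    cases Q <;> simp [encode, nameMsg, funext_iff] at h ⊢
    exact ⟨h.1, h.2.1, ih _ h.2.2⟩
  | nu P ih =>
    cases Q <;> simp [encode] at h ⊢
    exact ih _ h
  | par P Q ih ih' =>
    cases Q <;> simp [encode] at h ⊢
    exact ⟨ih _ h.1, ih' _ h.2⟩
  | rep m P ih =>
    cases Q <;> simp [encode, funext_iff] at h ⊢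
    exact ⟨h.1, ih _ h.2⟩

theorem renN_enc (P : PiProc) (ρ : ℕ → ℕ) : renN ρ (enc P) = enc (P.ren ρ) := renN_encode 0 P ρ

theorem shift_enc (P : PiProc) (k : ℕ) : HO.shift k (enc P) = enc (P.shift k) := renN_enc P _

theorem PiProc.SC.enc {P Q : PiProc} (h : PiProc.SC P Q) : Struct (enc P) (enc Q) := by
  induction h with
  | refl P => exact .refl _
  | symm _ ih => exact ih.symm
  | trans _ _ ih ih' => exact ih.trans ih'
  | parNil P => exact .parNil _
  | parComm P Q => exact .parComm _ _
  | parAssoc P Q R => exact .parAssoc _ _ _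
  | nuComm P =>
    have := Struct.nuComm (_root_.enc P)
    rwa [renN_enc] at this
  | nuPar P Q =>
    have := Struct.nuPar (_root_.enc P) (_root_.enc Q)
    rwa [shift_enc] at this
  | par _ _ ih ih' => exact .par ih ih'
  | nu _ ih => exact .nu ih

/-- The body `Y⟨⟨x⟩⟦P⟧⟩` of an encoded input. -/
def encBody (d : ℕ) (P : PiProc) : HO (d + 1) :=
  papp 0 (var (Fin.last d)) fun _ => nabs 0 (encode (d + 1) P)

theorem renN_encBody (d : ℕ) (P : PiProc) (ρ : ℕ → ℕ) :
    renN ρ (encBody d P) = encBody d (P.ren (upName 1 ρ)) := by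
  simp [encBody, renN, renN_encode]

theorem inst_encBody (P : PiProc) (A : HO 0) :
    inst (encBody 0 P) A = papp 0 A fun _ => nabs 0 (enc P) := by
  have h : Fin.addCases (motive := fun _ => HO 0) (var : Fin 0 → HO 0) (fun _ : Fin 1 => A)
      (Fin.last 0) = A := Fin.addCases_right (motive := fun _ => HO 0) (0 : Fin 1)
  simp only [inst, instP, encBody, subst, h, subst_encode, enc]

/-- A reception of the message that represents `b` instantiates the body with `b`. -/
theorem struct_inst_encBody (P : PiProc) {A : HO 0} {b : ℕ} (h : Struct A (nameMsg b)) :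
    Struct (inst (encBody 0 P) A) (enc (P.inst b)) := by
  rw [inst_encBody]
  refine (Struct.papp 0 h fun _ => .refl _).trans ((Struct.pbeta _ _ _).trans ?_)
  have : instP (napp 0 (var (Fin.natAdd 0 0)) fun _ => b) (fun _ : Fin 1 => nabs 0 (enc P)) =
      napp 0 (nabs 0 (enc P)) fun _ => b := by
    simp only [instP, subst]
    congr 1
  rw [this]
  refine (Struct.nbeta _ _ _).trans ?_
  rw [instN, renN_enc]
  exact .refl _

/-! ### The encoding preserves transitions -/

/-- The transition of encodings that corresponds to a transition of the pi-calculus. -/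
def EncStep (P : PiProc) : PiAct → PiProc → Prop
  | .tau, P' => HO.Step (enc P) .tau (enc P')
  | .inp a b, P' => ∀ A, Struct A (nameMsg b) → HO.Step (enc P) (.inp a A) (enc P')
  | .out a b, P' => HO.Step (enc P) (.out 0 a (nameMsg b)) (enc P')
  | .bout a, P' => HO.Step (enc P) (.out 1 a (nameMsg 0)) (enc P')

theorem PiProc.Step.encStep {P P' : PiProc} {α : PiAct} (h : PiProc.Step P α P') :
    EncStep P α P' := by
  have res : ∀ {P P' : PiProc} {α : HOAct}, HO.Step (enc P) α.under (enc P') →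
      HO.Step (enc (.nu P)) α (enc (.nu (P'.ren (rotName α.bn)))) := by
    intro P P' α h
    have := HO.Step.res h
    rwa [renN_enc] at this
  have parL : ∀ {P P' Q : PiProc} {α : HOAct}, HO.Step (enc P) α (enc P') →
      HO.Step (enc (.par P Q)) α (enc (.par P' (Q.shift α.bn))) := by
    intro P P' Q α h
    have := h.par (enc Q)
    rwa [shift_enc] at this
  have parR : ∀ {P Q Q' : PiProc} {α : HOAct}, HO.Step (enc Q) α (enc Q') →
      HO.Step (enc (.par P Q)) α (enc (.par (P.shift α.bn) Q')) :=
    fun h => .str (.parComm _ _) (parL h) (.parComm _ _)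
  have com : ∀ {P P' Q Q' : PiProc} {a b : ℕ},
      (∀ A, Struct A (nameMsg b) → HO.Step (enc P) (.inp a A) (enc P')) →
      HO.Step (enc Q) (.out 0 a (nameMsg b)) (enc Q') →
      HO.Step (enc (.par P Q)) .tau (enc (.par P' Q')) := by
    intro P P' Q Q' a b h h'
    refine .com (k := 0) ?_ h'
    rw [HO.shift_zero]
    exact h _ (.refl _)
  have close : ∀ {P P' Q Q' : PiProc} {a : ℕ},
      (∀ A, Struct A (nameMsg 0) → HO.Step (enc (P.shift 1)) (.inp (a + 1) A) (enc P')) →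
      HO.Step (enc Q) (.out 1 a (nameMsg 0)) (enc Q') →
      HO.Step (enc (.par P Q)) .tau (enc (.nu (.par P' Q'))) := by
    intro P P' Q Q' a h h'
    refine .com (k := 1) (T := enc P) ?_ h'
    rw [shift_enc]
    exact h _ (.refl _)
  induction h with
  | inp a b P =>
    exact fun A hA => .str (.refl _) (.inp a A (encBody 0 P)) (struct_inst_encBody P hA)
  | out a b P => exact .out _ _ _
  | rep a b P =>
    exact fun A hA => .str (.refl _) (.repInp a A (encBody 0 P))
      ((struct_inst_encBody P hA).par (.refl _))
  | @res P P' α _ ih =>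
    cases α with
    | tau => exact res (α := .tau) ih
    | inp a b => exact fun A hA => res (α := .inp a A) (ih _ (hA.shift 1))
    | out a b => exact res (α := .out 0 a (nameMsg b)) ih
    | bout a => exact res (α := .out 1 a (nameMsg 0)) ih
  | opn _ ih => exact .opn ih (by simp [nameMsg, HO.fn])
  | @parL P P' α Q _ ih =>
    cases α with
    | tau => exact parL ih
    | inp a b => exact fun A hA => parL (ih A hA)
    | out a b => exact parL ih
    | bout a => exact parL ih
  | @parR Q Q' α P _ ih =>
    cases α with
    | tau => exact parR ih
    | inp a b => exact fun A hA => parR (ih A hA)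
    | out a b => exact parR ih
    | bout a => exact parR ih
  | comL _ _ ih ih' => exact com ih ih'
  | comR _ _ ih ih' => exact .str (.parComm _ _) (com ih' ih) (.parComm _ _)
  | closeL _ _ ih ih' => exact close ih ih'
  | closeR _ _ ih ih' => exact .str (.parComm _ _) (close ih' ih) (.nu (.parComm _ _))

/-! ### The encoding reflects transitions -/

/-- The term is built from restrictions, parallel compositions and prefixes as the encoding of the
process; the arguments and continuations of its prefixes agree with the encoding up to `Cong`. -/
inductive Represents : {d : ℕ} → HO d → PiProc → Prop
  | nil {d : ℕ} : Represents (nil : HO d) .nil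
  | par {d : ℕ} {T T' : HO d} {P P' : PiProc} :
      Represents T P → Represents T' P' → Represents (par T T') (.par P P')
  | nu {d : ℕ} {T : HO d} {P : PiProc} : Represents T P → Represents (nu T) (.nu P)
  | inp {d : ℕ} (m : ℕ) {F : HO (d + 1)} {P : PiProc} :
      Cong F (encBody d P) → Represents (inp m F) (.inp m P)
  | rep {d : ℕ} (m : ℕ) {F : HO (d + 1)} {P : PiProc} :
      Cong F (encBody d P) → Represents (repInp m F) (.rep m P)
  | out {d : ℕ} (m n : ℕ) {A T : HO d} {P : PiProc} :
      Cong A (nameMsg n) → Cong T (encode d P) → Represents (out m A T) (.out m n P)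

namespace Represents

theorem encode (d : ℕ) (P : PiProc) : Represents (encode d P) P := by
  induction P generalizing d with
  | nil => exact .nil
  | inp m P ih => exact .inp _ (.refl _)
  | out m n P ih => exact .out _ _ (.refl _) (.refl _)
  | nu P ih => exact .nu (ih d)
  | par P Q ih ih' => exact .par (ih d) (ih' d)
  | rep m P ih => exact .rep _ (.refl _)

theorem cong {d : ℕ} {T : HO d} {P : PiProc} (h : Represents T P) :
    Cong T (_root_.encode d P) := by
  induction h with
  | nil => exact .refl _
  | par _ _ ih ih' => exact .par ih ih'
  | nu _ ih => exact .nu ih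
  | inp m h => exact .inp _ h
  | rep m h => exact .repInp _ h
  | out m n h h' => exact .out _ h h'

theorem renN {d : ℕ} {T : HO d} {P : PiProc} (h : Represents T P) (ρ : ℕ → ℕ) :
    Represents (HO.renN ρ T) (P.ren ρ) := by
  induction h generalizing ρ with
  | nil => exact .nil
  | par _ _ ih ih' => exact .par (ih ρ) (ih' ρ)
  | nu _ ih => exact .nu (ih _)
  | inp m h => exact .inp _ (renN_encBody _ _ ρ ▸ h.renN ρ)
  | rep m h => exact .rep _ (renN_encBody _ _ ρ ▸ h.renN ρ)
  | out m n h h' => exact .out _ _ (h.renN ρ) (renN_encode _ _ ρ ▸ h'.renN ρ)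

/-- Only shifts are represented by shifts, as `Cong` preserves the free names. -/
theorem of_shift {d : ℕ} {T : HO d} {P : PiProc} (h : Represents (shift 1 T) P) :
    ∃ P', P = P'.shift 1 ∧ Represents T P' := by
  refine ⟨P.ren Nat.pred, ?_, ?_⟩
  · refine encode_injective d ?_
    rw [PiProc.shift, ← renN_encode, ← renN_encode]
    refine (shift_one_pred ?_).symm
    rw [← h.cong.fn_eq]
    exact zero_notMem_fn_shift T
  · simpa only [pred_shift_one] using h.renN Nat.pred

end Represents

/-- `Cong` acts on a term that represents a process as structural congruence does on the process,
except inside prefixes, where the process does not change. -/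
theorem HO.Cong.represents {d : ℕ} {T T' : HO d} (h : Cong T T') :
    (∀ P, Represents T P → ∃ P', Represents T' P' ∧ PiProc.SC P P') ∧
      ∀ P, Represents T' P → ∃ P', Represents T P' ∧ PiProc.SC P P' := by
  induction h with
  | refl T => exact ⟨fun P h => ⟨P, h, .refl _⟩, fun P h => ⟨P, h, .refl _⟩⟩
  | symm _ ih => exact ih.symm
  | trans _ _ ih ih' =>
    constructor
    · intro P h
      obtain ⟨P', h, c⟩ := ih.1 P h
      obtain ⟨P'', h, c'⟩ := ih'.1 P' h
      exact ⟨P'', h, c.trans c'⟩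
    · intro P h
      obtain ⟨P', h, c⟩ := ih'.2 P h
      obtain ⟨P'', h, c'⟩ := ih.2 P' h
      exact ⟨P'', h, c.trans c'⟩
  | parNil T =>
    constructor
    · rintro P (_ | ⟨h, _ | _⟩)
      exact ⟨_, h, .parNil _⟩
    · exact fun P h => ⟨_, .par h .nil, (PiProc.SC.parNil _).symm⟩
  | parComm T T' =>
    constructor <;>
    · rintro P (_ | ⟨h, h'⟩)
      exact ⟨_, .par h' h, .parComm _ _⟩
  | parAssoc T T' T'' =>
    constructor
    · rintro P (_ | ⟨_ | ⟨h, h'⟩, h''⟩)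
      exact ⟨_, .par h (.par h' h''), .parAssoc _ _ _⟩
    · rintro P (_ | ⟨h, _ | ⟨h', h''⟩⟩)
      exact ⟨_, .par (.par h h') h'', (PiProc.SC.parAssoc _ _ _).symm⟩
  | nuComm T =>
    constructor
    · rintro P (_ | _ | ⟨_ | _ | ⟨h⟩⟩)
      exact ⟨_, .nu (.nu (h.renN _)), .nuComm _⟩
    · rintro P (_ | _ | ⟨_ | _ | ⟨h⟩⟩)
      have := h.renN (rotName 1)
      rw [renN_renN, renN_eq_self _ rotName_one_rotName_one] at this
      exact ⟨_, .nu (.nu this), .nuComm _⟩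
  | nuPar T T' =>
    constructor
    · rintro P (_ | _ | ⟨_ | ⟨h, h'⟩⟩)
      obtain ⟨P', rfl, r⟩ := h'.of_shift
      exact ⟨_, .par (.nu h) r, .nuPar _ _⟩
    · rintro P (_ | ⟨_ | _ | ⟨h⟩, h'⟩)
      exact ⟨_, .nu (.par h (h'.renN _)), (PiProc.SC.nuPar _ _).symm⟩
  | inp u c _ =>
    constructor
    · rintro P (_ | _ | _ | ⟨_, h⟩)
      exact ⟨_, .inp _ (c.symm.trans h), .refl _⟩
    · rintro P (_ | _ | _ | ⟨_, h⟩)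
      exact ⟨_, .inp _ (c.trans h), .refl _⟩
  | repInp u c _ =>
    constructor
    · rintro P (_ | _ | _ | _ | ⟨_, h⟩)
      exact ⟨_, .rep _ (c.symm.trans h), .refl _⟩
    · rintro P (_ | _ | _ | _ | ⟨_, h⟩)
      exact ⟨_, .rep _ (c.trans h), .refl _⟩
  | out u c c' _ _ =>
    constructor
    · rintro P (_ | _ | _ | _ | _ | ⟨_, _, h, h'⟩)
      exact ⟨_, .out _ _ (c.symm.trans h) (c'.symm.trans h'), .refl _⟩
    · rintro P (_ | _ | _ | _ | _ | ⟨_, _, h, h'⟩)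
      exact ⟨_, .out _ _ (c.trans h) (c'.trans h'), .refl _⟩
  | par _ _ ih ih' =>
    constructor
    · rintro P (_ | ⟨h, h'⟩)
      obtain ⟨_, h, c⟩ := ih.1 _ h
      obtain ⟨_, h', c'⟩ := ih'.1 _ h'
      exact ⟨_, .par h h', .par c c'⟩
    · rintro P (_ | ⟨h, h'⟩)
      obtain ⟨_, h, c⟩ := ih.2 _ h
      obtain ⟨_, h', c'⟩ := ih'.2 _ h'
      exact ⟨_, .par h h', .par c c'⟩
  | nu _ ih =>
    constructor
    · rintro P (_ | _ | ⟨h⟩)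
      obtain ⟨_, h, c⟩ := ih.1 _ h
      exact ⟨_, .nu h, .nu c⟩
    · rintro P (_ | _ | ⟨h⟩)
      obtain ⟨_, h, c⟩ := ih.2 _ h
      exact ⟨_, .nu h, .nu c⟩
  | _ => constructor <;> (intro P h; cases h)

/-- A term that is structurally congruent to the encoding of `P` reduces to a term that represents
a process structurally congruent to `P`. -/
theorem HO.Struct.represents {T : HO 0} {P : PiProc} (h : Struct T (enc P)) :
    ∃ n U P', PReds n T U ∧ Represents U P' ∧ PiProc.SC P P' := by
  obtain ⟨n, U, r, c⟩ := h.reds (.encode 0 P)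
  obtain ⟨P', h', c'⟩ := c.represents.2 P (.encode 0 P)
  exact ⟨n, U, P', r, h', c'⟩

namespace PiProc

/-- Restriction of the `k` innermost names. -/
def nus : ℕ → PiProc → PiProc
  | 0, P => P
  | k + 1, P => nu (nus k P)

theorem Step.nus_tau {P P' : PiProc} (h : Step P .tau P') (k : ℕ) :
    Step (nus k P) .tau (nus k P') := by
  induction k with
  | zero => exact h
  | succ k ih => simpa only [PiAct.bn, ren_rotName_zero, nus] using Step.res (α := .tau) ih

theorem Step.nus_inp {P P' : PiProc} {a b : ℕ} (k : ℕ) (h : Step P (.inp (a + k) (b + k)) P') :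
    Step (nus k P) (.inp a b) (nus k P') := by
  induction k generalizing a b with
  | zero => exact h
  | succ k ih =>
    have := ih (a := a + 1) (b := b + 1) (by convert h using 2 <;> omega)
    simpa only [PiAct.bn, ren_rotName_zero, nus] using Step.res (α := .inp a b) this

theorem Step.nus_out {P P' : PiProc} {a b : ℕ} (k : ℕ) (h : Step P (.out (a + k) (b + k)) P') :
    Step (nus k P) (.out a b) (nus k P') := by
  induction k generalizing a b with
  | zero => exact h
  | succ k ih =>
    have := ih (a := a + 1) (b := b + 1) (by convert h using 2 <;> omega)
    simpa only [PiAct.bn, ren_rotName_zero, nus] using Step.res (α := .out a b) this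

end PiProc

theorem enc_nus (k : ℕ) (P : PiProc) : enc (P.nus k) = HO.nus k (enc P) := by
  induction k with
  | zero => rfl
  | succ k ih => exact congrArg HO.nu ih

theorem Represents.of_nus {d k : ℕ} {T : HO d} {P : PiProc} (h : Represents (HO.nus k T) P) :
    ∃ P', P = P'.nus k ∧ Represents T P' := by
  induction k generalizing P with
  | zero => exact ⟨P, rfl, h⟩
  | succ k ih =>
    cases h with | nu h =>
    obtain ⟨P', rfl, r⟩ := ih h
    exact ⟨P', rfl, r⟩

/-- A term that reduces to one representing `P` is structurally congruent to `⟦P⟧`. -/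
theorem Represents.struct {T U : HO 0} {n : ℕ} {P : PiProc} (h : Represents U P)
    (r : PReds n T U) : Struct T (enc P) := r.struct.trans h.cong.struct

/-- A receiver that reduces to an encoded input behaves as that input. -/
theorem HO.Recv.backward {u n : ℕ} {F : HO 1} {G C U : HO 0} {X : PiProc} (h : Recv u F G C)
    (r : PReds n G U) (hX : Represents U X) {A : HO 0} {b : ℕ} (hA : Struct A (nameMsg b)) :
    ∃ X', PiProc.Step X (.inp u b) X' ∧ Struct (par (inst F A) C) (enc X') := by
  cases h with
  | inp =>
    obtain ⟨F', rfl, r'⟩ := r.inp_inv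
    cases hX with | inp _ c =>
    exact ⟨_, .inp _ _ _, (Struct.parNil _).trans
      (((r'.struct.trans c.struct).inst (.refl A)).trans (struct_inst_encBody _ hA))⟩
  | repInp =>
    obtain ⟨F', rfl, r'⟩ := r.repInp_inv
    cases hX with | rep _ c =>
    exact ⟨_, .rep _ _ _, .par
      (((r'.struct.trans c.struct).inst (.refl A)).trans (struct_inst_encBody _ hA))
      (.repInp _ (r'.struct.trans c.struct))⟩

/-- A sender that reduces to an encoded output behaves as that output.  Replicated outputs do
not occur, as they are preserved by reduction and no encoding contains them. -/
theorem HO.Send.backward {u n : ℕ} {A S H U : HO 0} {Y : PiProc} (h : Send u A S H)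
    (r : PReds n H U) (hY : Represents U Y) :
    ∃ b Y', PiProc.Step Y (.out u b) Y' ∧ Struct A (nameMsg b) ∧ Struct S (enc Y') := by
  cases h with
  | out =>
    obtain ⟨A', S', rfl, r₁, r₂⟩ := r.out_inv
    cases hY with | out _ b c c' =>
    exact ⟨b, _, .out _ _ _, r₁.struct.trans c.struct, r₂.struct.trans c'.struct⟩
  | repOut =>
    obtain ⟨A', S', rfl⟩ := r.repOut_inv
    cases hY

theorem HO.Struct.backward_inp {T T' A : HO 0} {P : PiProc} {a b : ℕ} (hT : Struct T (enc P))
    (h : HO.Step T (.inp a A) T') (hA : Struct A (nameMsg b)) :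
    ∃ P', PiProc.Step P (.inp a b) P' ∧ Struct T' (enc P') := by
  obtain ⟨n, F, G, C, R, hG, hT₁, hT'⟩ := h.prenex
  obtain ⟨_, U, P₁, r, hU, c⟩ := (hT₁.symm.trans hT).represents
  obtain ⟨U, rfl, r₁⟩ := r.nus_inv
  obtain ⟨G', R', rfl, rG, rR⟩ := r₁.par_inv
  obtain ⟨P₂, rfl, hP₂⟩ := hU.of_nus
  cases hP₂ with | par hX hZ =>
  obtain ⟨X', hs, hX'⟩ := hG.backward rG hX (hA.shift n)
  obtain ⟨P', hP, c'⟩ := c.symm.stepSim _ _ ((hs.parL _).nus_inp n)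
  refine ⟨P', hP, hT'.trans (Struct.trans ?_ c'.enc)⟩
  rw [enc_nus, PiAct.bn, PiProc.shift_zero]
  · exact .nus (hX'.par (hZ.struct rR)) n
  · simp

theorem HO.Struct.backward_tau {T T' : HO 0} {P : PiProc} (hT : Struct T (enc P))
    (h : HO.Step T .tau T') : ∃ P', PiProc.Step P .tau P' ∧ Struct T' (enc P') := by
  obtain ⟨n, u, F, G, C, A, S, H, R, hG, hH, hT₁, hT'⟩ := h.prenex
  obtain ⟨_, U, P₁, r, hU, c⟩ := (hT₁.symm.trans hT).represents
  obtain ⟨U, rfl, r₁⟩ := r.nus_inv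
  obtain ⟨G', U', rfl, rG, r₂⟩ := r₁.par_inv
  obtain ⟨H', R', rfl, rH, rR⟩ := r₂.par_inv
  obtain ⟨P₂, rfl, hP₂⟩ := hU.of_nus
  cases hP₂ with | par hX hYZ =>
  cases hYZ with | par hY hZ =>
  obtain ⟨b, Y', hs', hA, hY'⟩ := hH.backward rH hY
  obtain ⟨X', hs, hX'⟩ := hG.backward rG hX hA
  obtain ⟨P', hP, c'⟩ := c.symm.stepSim _ _ ((PiProc.Step.comL hs (hs'.parL _)).nus_tau n)
  refine ⟨P', hP, hT'.trans (Struct.trans ?_ c'.enc)⟩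
  rw [enc_nus, PiAct.bn, PiProc.shift_zero]
  · exact .nus (hX'.par (hY'.par (hZ.struct rR))) n
  · simp

/-- A sender in prenex position of a term in the image of the encoding. -/
theorem HO.Send.backward_nus {T A S H R : HO 0} {P : PiProc} {u n : ℕ} (hH : Send u A S H)
    (hT : Struct T (nus n (par H R))) (hP : Struct T (enc P)) :
    ∃ b Y Y', PiProc.SC P (Y.nus n) ∧ PiProc.Step Y (.out u b) Y' ∧ Struct A (nameMsg b) ∧
      Struct (par S R) (enc Y') := by
  obtain ⟨_, U, P₁, r, hU, c⟩ := (hT.symm.trans hP).represents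
  obtain ⟨U, rfl, r₁⟩ := r.nus_inv
  obtain ⟨H', R', rfl, rH, rR⟩ := r₁.par_inv
  obtain ⟨P₂, rfl, hP₂⟩ := hU.of_nus
  cases hP₂ with | par hY hZ =>
  obtain ⟨b, Y', hs, hA, hY'⟩ := hH.backward rH hY
  refine ⟨b, _, _, c, hs.parL _, hA, ?_⟩
  rw [PiAct.bn, PiProc.shift_zero]
  · exact hY'.par (hZ.struct rR)
  · simp

theorem struct_nameMsg_iff {b c : ℕ} : Struct (nameMsg b : HO 0) (nameMsg c) ↔ b = c := by
  refine ⟨fun h => ?_, fun h => h ▸ .refl _⟩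
  obtain ⟨n, U, r, e⟩ := h.reds (.nameMsg c)
  have := (((IsNormal.nameMsg b).cong r).trans e).fn_eq
  simpa [nameMsg, HO.fn] using this

/-- If a term that avoids the `n` innermost names represents a name, then this name is not one of
them, whichever further names the term contains. -/
theorem HO.Struct.of_shift_nameMsg {A : HO 0} {n b : ℕ} (h : Struct (HO.shift n A) (nameMsg b)) :
    ∃ c, b = c + n ∧ Struct A (nameMsg c) := by
  have h' := h.renN (· - n)
  rw [HO.shift, renN_renN, renN_eq_self _ (by simp), renN_nameMsg] at h'
  exact ⟨b - n, struct_nameMsg_iff.1 (h.symm.trans (h'.shift n)), h'⟩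

/-- Any of `m + 1` restricted names can be made the outermost one. -/
theorem struct_nus_succ {d m c : ℕ} (hc : c ≤ m) : ∃ π : ℕ → ℕ, π c = m ∧
    (∀ i, m < i → π i = i) ∧
      ∀ T : HO d, Struct (HO.nus (m + 1) T) (HO.nu (HO.nus m (renN π T))) := by
  refine ⟨fun i => (PiProc.rotPerm m).symm (rotName c i), ?_, ?_, ?_⟩
  · simp [PiProc.rotPerm, rotName]
  · intro i hi
    have h1 : ¬ i < c := by omega
    have h2 : i ≠ c := by omega
    have h3 : i ≠ 0 := by omega
    have h4 : ¬ i ≤ m := by omega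
    simp [PiProc.rotPerm, rotName, h1, h2, h3, h4]
  · intro T
    have e : HO.nus (m + 1) T = HO.nus (m - c) (HO.nu (HO.nus c T)) := by
      rw [show m + 1 = m - c + (c + 1) by omega, ← nus_nus]
      rfl
    have e' : HO.nus (m - c) (HO.nus c (HO.nu (renN (rotName c) T))) =
        HO.nus m (HO.nu (renN (rotName c) T)) := by
      rw [nus_nus, Nat.sub_add_cancel hc]
    rw [e]
    refine ((struct_nu_nus c T).nus (m - c)).trans ?_
    rw [e']
    have := (struct_nu_nus m (renN (fun i => (PiProc.rotPerm m).symm (rotName c i)) T)).symm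
    rw [renN_renN] at this
    have e'' : (fun i => rotName m ((PiProc.rotPerm m).symm (rotName c i))) = rotName c :=
      funext fun i => (PiProc.rotPerm m).apply_symm_apply _
    rwa [e''] at this

/-- An output of a term in the image is a free output or a bound output of the process.  The
message may contain further free names, which disappear in the application laws; hence the number
`k` of extruded names is arbitrary.  In the case of a bound output, `f` inserts the extruded names
into the scope of the bound name. -/
theorem HO.Struct.backward_out {T T' A : HO 0} {P : PiProc} {k a : ℕ} (hP : Struct T (enc P))
    (h : HO.Step T (.out k a A) T') :
    (∃ b P', Struct A (nameMsg (b + k)) ∧ PiProc.Step P (.out a b) P' ∧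
      Struct (HO.nus k T') (enc P')) ∨
    ∃ (f : ℕ → ℕ) (P' : PiProc), (∀ i, f (i + 1) = i + k) ∧
      Struct A (nameMsg (f 0)) ∧ PiProc.Step P (.bout a) P' ∧
      ∀ W, Struct (HO.nus k (HO.par (HO.renN f W) T')) (HO.nu (HO.par W (enc P'))) := by
  obtain ⟨n, S, H, R, hH, hT, hT'⟩ := h.prenex
  obtain ⟨b, Y, Y', c, hY, hA, hY'⟩ := hH.backward_nus (n := k + n) (by rwa [← nus_nus]) hP
  obtain ⟨b, rfl, hA'⟩ := hA.of_shift_nameMsg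
  -- If `b < k`, the name sent is one of the extruded names, and the process has a bound output.
  by_cases hb : k ≤ b
  · left
    obtain ⟨b, rfl⟩ := Nat.exists_eq_add_of_le' hb
    have hs : PiProc.Step (Y.nus (k + n)) (.out a b) (Y'.nus (k + n)) :=
      PiProc.Step.nus_out (k + n) (by convert hY using 2 <;> omega)
    obtain ⟨P', hP', c'⟩ := c.symm.stepSim _ _ hs
    refine ⟨b, P', hA', hP', (hT'.nus k).trans (Struct.trans ?_ c'.enc)⟩
    rw [enc_nus, nus_nus]
    exact hY'.nus _
  · right
    -- The name sent is made the outermost of the `m + 1` extruded names; the others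
    -- stay restricted.
    obtain ⟨m, rfl⟩ := Nat.exists_eq_add_one_of_ne_zero (show k ≠ 0 by omega)
    obtain ⟨π, hπb, hπ, hnus⟩ := struct_nus_succ (d := 0) (show b ≤ m by omega)
    have hH' := hH.renN (upName n π)
    rw [renN_shift_comm (l := n) (τ := π) A (by simp [upName])] at hH'
    have e : upName n π (a + (m + 1) + n) = a + 1 + (m + n) := by
      simp only [upName, Nat.add_sub_cancel]
      rw [hπ _ (by omega)]
      split_ifs <;> omega
    rw [e] at hH'
    have hT₂ : Struct T (HO.nus (m + n + 1)
        (HO.par (HO.renN (upName n π) H) (HO.renN (upName n π) R))) := by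
      refine hT.trans ((hnus _).trans ?_)
      rw [renN_nus, nus_nus]
      exact .refl _
    obtain ⟨b', Z, Z', c, hZ, hA₂, hZ'⟩ := hH'.backward_nus hT₂ hP
    have hb' : b' = 0 + (m + n) := by
      refine struct_nameMsg_iff.1 (hA₂.symm.trans (((hA'.renN π).shift n).trans ?_))
      rw [renN_nameMsg, hπb, HO.shift, renN_nameMsg, Nat.zero_add]
      exact .refl _
    subst hb'
    obtain ⟨P', hP', c'⟩ := c.symm.stepSim _ _ (.opn (hZ.nus_out (m + n)))
    refine ⟨fun i => if i = 0 then b else i + m, P', ?_, hA', hP', fun W =>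
      (hnus _).trans (.nu ?_)⟩
    · intro i
      simp only [Nat.add_eq_zero_iff, one_ne_zero, and_false, if_false]
      omega
    · have eW : HO.renN π (HO.renN (fun i => if i = 0 then b else i + m) W) = HO.shift m W := by
        rw [renN_renN, HO.shift]
        congr 1
        funext i
        rcases i with _ | i
        · simp [hπb]
        · simpa using hπ _ (by omega)
      rw [HO.renN, eW]
      refine (struct_par_nus m _ _).trans (.par (.refl _) (Struct.trans ?_ c'.enc))
      refine ((hT'.renN π).nus m).trans ?_
      rw [renN_nus, nus_nus, enc_nus]
      exact hZ'.nus _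

/-! ### Weak soundness -/

theorem PiProc.Taus.enc {Q Q' : PiProc} (h : PiProc.Taus Q Q') {S : HO 0}
    (hS : Struct S (enc Q)) : ∃ S', HO.Taus S S' ∧ Struct S' (_root_.enc Q') := by
  induction h with
  | refl => exact ⟨S, .refl, hS⟩
  | tail _ h ih =>
    obtain ⟨S', hS', c⟩ := ih
    exact ⟨_, hS'.tail (.str c h.encStep (.refl _)), .refl _⟩

/-- A weak transition of `Q` is replayed by every term structurally congruent to `⟦Q⟧`. -/
theorem PiProc.Weak.enc {Q Q' : PiProc} {α : PiAct} {β : HOAct} (h : PiProc.Weak Q α Q')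
    (hαβ : ∀ {P P' : PiProc}, PiProc.Step P α P' → HO.Step (enc P) β (_root_.enc P')) {S : HO 0}
    (hS : Struct S (_root_.enc Q)) : ∃ S', HO.Weak S β S' ∧ Struct S' (_root_.enc Q') := by
  obtain ⟨Q₁, Q₂, h₁, h, h₂⟩ := h
  obtain ⟨S₁, hS₁, c₁⟩ := h₁.enc hS
  obtain ⟨S₂, hS₂, c₂⟩ := h₂.enc (.refl _)
  exact ⟨S₂, ⟨S₁, _, hS₁, .str c₁ (hαβ h) (.refl _), hS₂⟩, c₂⟩

theorem isNameAbs_of_nameMsg {A B : HO 0} {b c : ℕ} (hA : Struct A (nameMsg b))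
    (hB : Struct B (nameMsg c)) (h : IsNameAbs A) : IsNameAbs B := by
  obtain ⟨n, T, h⟩ := h
  exact ⟨n, _, hB.trans ((hA.symm.trans h).renN fun _ => c)⟩

/-- Weak soundness: ground bisimilarity, transported to the image of the encoding, is a context
bisimulation within the image. -/
theorem isContextBisim_image : IsContextBisim InImage RepresentsName fun T S =>
    ∃ P Q, Struct T (enc P) ∧ Struct S (enc Q) ∧ PiProc.GroundBisim P Q := by
  refine ⟨?_, ?_, ?_⟩
  · rintro T S ⟨P, Q, hT, hS, h⟩
    exact ⟨Q, P, hS, hT, h.symm⟩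
  · rintro T S ⟨P, Q, hT, hS, h⟩
    exact ⟨⟨P, hT⟩, ⟨Q, hS⟩⟩
  rintro T S ⟨P, Q, hT, hS, h⟩
  refine ⟨?_, ?_, ?_⟩
  · intro T' hT'
    obtain ⟨P', hP', c⟩ := hT.backward_tau hT'
    obtain ⟨Q', hQ', h'⟩ := h.step hP'
    obtain ⟨S', hS', c'⟩ := hQ'.taus.enc hS
    exact ⟨S', hS', P', Q', c, c', h'⟩
  · rintro a A T' ⟨b, hA⟩ hT'
    obtain ⟨P', hP', c⟩ := hT.backward_inp hT' hA
    obtain ⟨Q', hQ', h'⟩ := h.step hP'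
    obtain ⟨S', hS', c'⟩ := (hQ'.weak (by simp)).enc (fun h => h.encStep A hA) hS
    exact ⟨S', hS', P', Q', c, c', h'⟩
  · intro k a A T' hT'
    rcases hT.backward_out hT' with ⟨b, P', hA, hP', c⟩ | ⟨f, P', hf, hA, hP', c⟩
    · obtain ⟨Q', hQ', h'⟩ := h.step hP'
      obtain ⟨S', hS', c'⟩ := (hQ'.weak (by simp)).enc (fun h => h.encStep) hS
      refine ⟨0, _, S', hS', iff_of_true ⟨_, _, hA⟩ ⟨_, _, .refl _⟩,
        ⟨isNameAbs_of_nameMsg hA (.refl _), isNameAbs_of_nameMsg (.refl _) hA⟩, ?_⟩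
      rintro E - ⟨PE, hE⟩
      rw [shift_zero] at hE
      refine ⟨.par P' PE, .par Q' PE, ?_, ?_, h'.par PE⟩
      -- For a free output the context does not involve the extruded names, up to `≡`, so it leaves
      -- their scope.
      · have e : Struct (inst (E.shift k) A) (HO.shift k (inst E (nameMsg b))) := by
          rw [HO.shift, HO.shift, renN_inst]
          exact .inst (.refl _) hA
        refine ((Struct.par e (.refl T')).nus k).trans ((struct_par_nus k _ _).trans ?_)
        exact (Struct.par hE c).trans (.parComm _ _)
      · rw [shift_zero]
        exact (Struct.par hE c').trans (.parComm _ _)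
    · obtain ⟨Q', hQ', h'⟩ := h.step hP'
      obtain ⟨S', hS', c'⟩ := (hQ'.weak (by simp)).enc (fun h => h.encStep) hS
      refine ⟨1, _, S', hS', iff_of_true ⟨_, _, hA⟩ ⟨_, _, .refl _⟩,
        ⟨isNameAbs_of_nameMsg hA (.refl _), isNameAbs_of_nameMsg (.refl _) hA⟩, ?_⟩
      rintro E - ⟨PE, hE⟩
      refine ⟨.nu (.par P' PE), .nu (.par Q' PE), ?_, ?_, (h'.par PE).nu⟩
      -- Only the extruded name that is sent matters to the context, up to `≡`.
      · have e : Struct (inst (E.shift k) A) (renN f (inst (E.shift 1) (nameMsg 0))) := by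
          rw [renN_inst, renN_shift_comm (l := k) (τ := fun i => i) E hf, renN_id]
          exact .inst (.refl _) hA
        refine ((Struct.par e (.refl T')).nus k).trans ((c _).trans (.nu ?_))
        exact (Struct.par hE (.refl _)).trans (.parComm _ _)
      · exact .nu ((Struct.par hE c').trans (.parComm _ _))

/-! ### Failure of full soundness -/

namespace HO

/-- The number of prefixes in active position, where a replicated input counts twice, so that a
term of weight one has no replicated input.  The weight is invariant under `Cong`, but not under
the application laws; it is only meaningful for normal terms. -/
def weight : {d : ℕ} → HO d → ℕ
  | _, par T T' => weight T + weight T'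
  | _, nu T => weight T
  | _, inp _ _ => 1
  | _, out _ _ _ => 1
  | _, repInp _ _ => 2
  | _, repOut _ _ _ => 1
  | _, _ => 0

theorem weight_renN {d : ℕ} (T : HO d) (ρ : ℕ → ℕ) : weight (renN ρ T) = weight T := by
  induction T generalizing ρ <;> simp_all [weight, renN]

theorem weight_nus {d : ℕ} (k : ℕ) (T : HO d) : weight (nus k T) = weight T := by
  induction k with
  | zero => rfl
  | succ k ih => exact ih

theorem Cong.weight_eq {d : ℕ} {T T' : HO d} (h : Cong T T') : weight T = weight T' := by
  induction h with
  | refl T => rfl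
  | symm _ ih => exact ih.symm
  | trans _ _ ih ih' => exact ih.trans ih'
  | parNil T => rfl
  | parComm T T' => exact Nat.add_comm _ _
  | parAssoc T T' T'' => exact Nat.add_assoc _ _ _
  | nuComm T => simp [weight, weight_renN]
  | nuPar T T' => simp [weight, shift, weight_renN]
  | par _ _ ih ih' => simp [weight, ih, ih']
  | nu _ ih => simpa [weight] using ih
  | _ => rfl

theorem Recv.weight_pos {u n : ℕ} {F : HO 1} {G C U : HO 0} (h : Recv u F G C)
    (r : PReds n G U) : 1 ≤ weight U := by
  cases h with
  | inp => obtain ⟨F', rfl, -⟩ := r.inp_inv; simp [weight]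
  | repInp => obtain ⟨F', rfl, -⟩ := r.repInp_inv; simp [weight]

theorem Send.weight_pos {u n : ℕ} {A S H U : HO 0} (h : Send u A S H)
    (r : PReds n H U) : 1 ≤ weight U := by
  cases h with
  | out => obtain ⟨A', S', rfl, -⟩ := r.out_inv; simp [weight]
  | repOut => obtain ⟨A', S', rfl⟩ := r.repOut_inv; simp [weight]

/-- The receiving prefix survives in the normal form. -/
theorem Step.one_le_weight {T T' A M : HO 0} {a : ℕ} (h : Step T (.inp a A) T')
    (c : Struct T M) (hM : IsNormal M) : 1 ≤ weight M := by
  obtain ⟨n, F, G, C, R, hG, hT, -⟩ := h.prenex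
  obtain ⟨_, U, r, e⟩ := (hT.symm.trans c).reds hM
  obtain ⟨U, rfl, r₁⟩ := r.nus_inv
  obtain ⟨G', R', rfl, rG, -⟩ := r₁.par_inv
  rw [← e.weight_eq, weight_nus]
  exact (hG.weight_pos rG).trans (Nat.le_add_right _ _)

theorem Step.two_le_weight {T T' M : HO 0} (h : Step T .tau T') (c : Struct T M)
    (hM : IsNormal M) : 2 ≤ weight M := by
  obtain ⟨n, u, F, G, C, A, S, H, R, hG, hH, hT, -⟩ := h.prenex
  obtain ⟨_, U, r, e⟩ := (hT.symm.trans c).reds hM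
  obtain ⟨U, rfl, r₁⟩ := r.nus_inv
  obtain ⟨G', U', rfl, rG, r₂⟩ := r₁.par_inv
  obtain ⟨H', R', rfl, rH, -⟩ := r₂.par_inv
  rw [← e.weight_eq, weight_nus]
  have := hG.weight_pos rG
  have := hH.weight_pos rH
  simp only [weight]
  omega

/-- An internal move needs a receiver and a sender, hence a normal form of weight at least two. -/
theorem Taus.eq_of_weight_lt {T T' M : HO 0} (h : Taus T T') (c : Struct T M) (hM : IsNormal M)
    (hw : weight M < 2) : T' = T := by
  rcases Relation.ReflTransGen.cases_head h with h | ⟨S, h, -⟩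
  · exact h.symm
  · exact absurd (h.two_le_weight c hM) (by omega)

/-- Sending `0` to the encoding of a process with a single prefix blocks its continuation. -/
theorem Step.inp_nil {T T' : HO 0} {P : PiProc} {a : ℕ} (h : Step T (.inp a nil) T')
    (c : Struct T (enc P)) (hP : weight (enc P) = 1) :
    ∃ M, Struct T' M ∧ IsNormal M ∧ weight M = 0 := by
  obtain ⟨n, F, G, C, R, hG, hT, hT'⟩ := h.prenex
  obtain ⟨_, U, r, e⟩ := (hT.symm.trans c).reds (.encode 0 P)
  obtain ⟨U, rfl, r₁⟩ := r.nus_inv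
  obtain ⟨G', R', rfl, rG, rR⟩ := r₁.par_inv
  obtain ⟨_, hU, -⟩ := e.represents.2 P (.encode 0 P)
  obtain ⟨_, rfl, hGR⟩ := hU.of_nus
  cases hGR with | par hX hZ =>
  have hw := e.weight_eq
  rw [weight_nus, hP, weight] at hw
  cases hG with
  | inp =>
    obtain ⟨F', rfl, rF⟩ := rG.inp_inv
    cases hX with | @inp _ _ P₁ cF =>
    have hw : weight R' = 0 := by simp only [weight] at hw; omega
    refine ⟨HO.nus n (HO.par (HO.par (HO.papp 0 nil fun _ => HO.nabs 0 (enc P₁)) nil) R'),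
      hT'.trans (.nus (.par (.par ?_ (.refl _)) rR.struct) n), ?_, ?_⟩
    · rw [← inst_encBody]
      exact (rF.struct.trans cF.struct).inst (.refl _)
    · refine ((IsNormal.papp 0 .nil (fun _ => (IsNormal.encode 0 P₁).nabs 0) fun T h => ?_).par
        .nil |>.par ((IsNormal.encode 0 _).of_cong hZ.cong.symm)).nus n
      simpa [absHeads] using h.absHeads_eq
    · rw [weight_nus]
      simpa [weight] using hw
  | repInp =>
    obtain ⟨F', rfl, -⟩ := rG.repInp_inv
    simp only [weight] at hw
    omega

end HO

/-- The process `a(x).a(y).0` and the process `a(x).0 | a(y).0` are ground bisimilar. -/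
theorem groundBisim_inp_inp : PiProc.GroundBisim (.inp 0 (.inp 1 .nil))
    (.par (.inp 0 .nil) (.inp 0 .nil)) := by
  have key : ∀ α P', PiProc.Step (.inp 0 (.inp 1 .nil)) α P' →
      ∃ Q', PiProc.Step (.par (.inp 0 .nil) (.inp 0 .nil)) α Q' ∧ PiProc.SC P' Q' := by
    intro α P' h
    cases h with | inp _ b _ =>
    exact ⟨_, .parL _ (.inp _ b _), ((PiProc.SC.parComm _ _).trans (.parNil _)).symm⟩
  have key' : ∀ α Q', PiProc.Step (.par (.inp 0 .nil) (.inp 0 .nil)) α Q' →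
      ∃ P', PiProc.Step (.inp 0 (.inp 1 .nil)) α P' ∧ PiProc.SC Q' P' := by
    intro α Q' h
    cases h with
    | parL _ h =>
      cases h with | inp _ b _ =>
      exact ⟨_, .inp _ b _, (PiProc.SC.parComm _ _).trans (.parNil _)⟩
    | parR _ h =>
      cases h with | inp _ b _ =>
      exact ⟨_, .inp _ b _, .parNil _⟩
    | comL _ h => cases h
    | comR h _ => cases h
    | closeL _ h => cases h
    | closeR h _ => cases h
  refine ⟨fun P Q => (P = .inp 0 (.inp 1 .nil) ∧ Q = .par (.inp 0 .nil) (.inp 0 .nil)) ∨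
    (Q = .inp 0 (.inp 1 .nil) ∧ P = .par (.inp 0 .nil) (.inp 0 .nil)) ∨ PiProc.SC P Q,
    ⟨?_, ?_⟩, .inl ⟨rfl, rfl⟩⟩
  · rintro P Q (h | h | h)
    · exact .inr (.inl h)
    · exact .inl h
    · exact .inr (.inr h.symm)
  · rintro P Q (⟨rfl, rfl⟩ | ⟨rfl, rfl⟩ | h) α P' hP
    · obtain ⟨Q', hQ, c⟩ := key _ _ hP
      exact ⟨Q', hQ.weakHat, .inr (.inr c)⟩
    · obtain ⟨Q', hQ, c⟩ := key' _ _ hP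
      exact ⟨Q', hQ.weakHat, .inr (.inr c)⟩
    · obtain ⟨Q', hQ, c⟩ := h.stepSim _ _ hP
      exact ⟨Q', hQ.weakHat, .inr (.inr c)⟩

/-- The context that sends `0` twice on `a` distinguishes the encodings of `a(x).a(y).0` and
`a(x).0 | a(y).0`: the encoding of the first process is blocked after one input. -/
theorem not_contextBisim_inp_inp : ¬ HO.ContextBisim (enc (.inp 0 (.inp 1 .nil)))
    (enc (.par (.inp 0 .nil) (.inp 0 .nil))) := by
  rintro ⟨R, ⟨hsymm, -, hR⟩, h⟩
  have hstep : HO.Step (enc (.inp 0 .nil)) (.inp 0 HO.nil) (inst (encBody 0 .nil) HO.nil) :=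
    .inp 0 HO.nil (encBody 0 .nil)
  -- Two receptions of `0` by the encoding of the second process, one in each component.
  have h₁ := hstep.par (enc (.inp 0 .nil))
  have h₂ := hstep.par (inst (encBody 0 .nil) HO.nil)
  obtain ⟨S₁, ⟨T₁, T₂, w₁, hs, w₂⟩, hR₁⟩ :=
    (hR _ _ (hsymm _ _ h)).2.1 _ _ _ trivial h₁
  have hP : IsNormal (enc (.inp 0 (.inp 1 .nil))) := .encode _ _
  -- The encoding of the first process has no internal moves, and after one reception of `0` its
  -- normal form has weight zero, so that a second reception is impossible.
  cases w₁.eq_of_weight_lt (.refl _) hP (by decide)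
  obtain ⟨M, c, hM, hw⟩ := hs.inp_nil (.refl _) rfl
  cases w₂.eq_of_weight_lt c hM (by omega)
  obtain ⟨S₂, ⟨T₃, T₄, w₃, hs', -⟩, -⟩ := (hR _ _ hR₁).2.1 0 HO.nil _ trivial
    (.str (.parComm _ _) (by rw [HOAct.bn, shift_zero]; exact h₂; simp) (.refl _))
  cases w₃.eq_of_weight_lt c hM (by omega)
  have := hs'.one_le_weight c hM
  omega

theorem mainTheorem4 :
    (∀ P Q : PiProc, PiProc.GroundBisim P Q → ImageContextBisim (enc P) (enc Q)) ∧
    (∃ P Q : PiProc, PiProc.GroundBisim P Q ∧ ¬ HO.ContextBisim (enc P) (enc Q)) :=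
  ⟨fun P Q h => ⟨_, isContextBisim_image, P, Q, .refl _, .refl _, h⟩,
    _, _, groundBisim_inp_inp, not_contextBisim_inp_inp⟩
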